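/- **Lemma 5.1.** Let $K$ be an algebraically closed field and let $Q$ be a finite connected quiver with at least two vertices such that exactly two arrows start and exactly two arrows end at each vertex. For an arrow $\alpha$ let $\bar\alpha$ be the other arrow with the same source. Let $f$ be a permutation of the arrows with $f^3=1$ and $s(f(\alpha))=t(\alpha)$ for all arrows $\alpha$, and put $g(\alpha)=\overline{f(\alpha)}$. Let $n_\alpha$ be the length of the $g$-cycle of $\alpha$, let $m_\alpha\in\mathbb N^*$ and $c_\alpha\in K^*$ be constant on $g$-cycles, and let $A_\alpha=\alpha g(\alpha)\cdots g^{m_\alpha n_\alpha-2}(\alpha)$ (paths are composed from left to right). Call $\alpha$ virtual if $m_\alpha n_\alpha=2$. Assume that for all arrows $\alpha$: $m_\alpha n_\alpha\ge 2$; $m_\alpha n_\alpha\ge 3$ if $\bar\alpha$ is virtual and not a loop; $m_\alpha n_\alpha\ge 4$ if $\bar\alpha$ is a virtual loop. Let $\Lambda=KQ/I$ be the weighted surface algebra, where $I$ is the ideal of the path algebra $KQ$ generated by 1. $\alpha f(\alpha)-c_{\bar\alpha}A_{\bar\alpha}$ for all arrows $\alpha$; 2. $\alpha f(\alpha)g(f(\alpha))$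 for all arrows $\alpha$ such that neither $f^2(\alpha)$ is virtual, nor ($f(\bar\alpha)$ is virtual and $m_{\bar\alpha}=1$, $n_{\bar\alpha}=3$); 3. $\alpha g(\alpha)f(g(\alpha))$ for all arrows $\alpha$ such that neither $f(\alpha)$ is virtual, nor ($f^2(\alpha)$ is virtual and $m_{f(\alpha)}=1$, $n_{f(\alpha)}=3$). Modules are right $\Lambda$-modules; $P_v=e_v\Lambda$ for a vertex $v$, $S_v=P_v/\operatorname{rad}P_v$, and $\Omega(M)$, $\Omega^{-1}(M)$ denote the kernel of a projective cover and the cokernel of an injective hull of $M$. Let $\alpha\colon i\to j$ be an arrow such that $\bar\alpha$ is a virtual loop (at $i$). Assume that $\Lambda$ is not the singular triangle algebra, that is, there is no arrow $\beta$ such that $\bar\beta$ and $f(g(\beta))$ are virtual loops, $m_\beta=1$, $n_\beta=4$ and $c_{\bar\beta}\,c_\beta^2\,c_{f(g(\beta))}=1$. Then $P_i$ is both a projective cover and an injective hull of $S_i$, and there is an exact sequence of $\Lambda$-modules $$0\to\Omega^{-1}(S_i)\to P_j\to P_j\to\Omega(S_i)\to 0 .$$ Spliced with $0\to\Omega(S_i)\to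 P_i\to S_i\to 0$ and $0\to S_i\to P_i\to\Omega^{-1}(S_i)\to 0$ it gives a minimal projective resolution $$\cdots\to P_i\to P_i\to P_j\to P_j\to P_i\to S_i\to 0$$ whose terms and maps repeat with period $4$. In particular $S_i$ is periodic of period $4$: $\Omega^4(S_i)\cong S_i$, and $\Omega^k(S_i)\not\cong S_i$ for $k=1,2,3$. -/

import Mathlib

noncomputable section

/-! ## Quivers and path algebras -/

/-- A quiver with vertex set `V` and arrow set `E`. -/
structure ArrowQuiver (V : Type*) (E : Type*) where
  src : E → V
  tgt : E → V

namespace ArrowQuiver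

variable {V : Type*} {E : Type*} (Q : ArrowQuiver V E)

/-- The list `l` of arrows can be walked through, from left to right, starting at `v`. -/
def IsWalk : V → List E → Prop
  | _, [] => True
  | v, a :: l => Q.src a = v ∧ IsWalk (Q.tgt a) l

/-- The vertex at which the walk `l` from `v` ends. -/
def walkEnd : V → List E → V
  | v, [] => v
  | _, a :: l => walkEnd (Q.tgt a) l

lemma walkEnd_append (v : V) (l l' : List E) :
    Q.walkEnd v (l ++ l') = Q.walkEnd (Q.walkEnd v l) l' := by
  induction l generalizing v with
  | nil => rfl
  | cons a l ih => exact ih _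

lemma isWalk_append {v : V} {l l' : List E} :
    Q.IsWalk v (l ++ l') ↔ Q.IsWalk v l ∧ Q.IsWalk (Q.walkEnd v l) l' := by
  induction l generalizing v with
  | nil => simp [IsWalk, walkEnd]
  | cons a l ih => simp [IsWalk, walkEnd, ih, and_assoc]

/-- A path of the quiver, of any length `≥ 0`; arrows are composed from left to right. -/
@[ext] structure Path where
  start : V
  arrows : List E
  isWalk : Q.IsWalk start arrows

namespace Path

variable {Q}

/-- The vertex at which a path ends. -/
def finish (p : Q.Path) : V := Q.walkEnd p.start p.arrows

/-- First `p`, then `q`. -/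
def comp (p q : Q.Path) (h : p.finish = q.start) : Q.Path where
  start := p.start
  arrows := p.arrows ++ q.arrows
  isWalk := Q.isWalk_append.2 ⟨p.isWalk, by
    have := q.isWalk
    rw [← h] at this
    exact this⟩

lemma finish_comp (p q : Q.Path) (h : p.finish = q.start) : (p.comp q h).finish = q.finish := by
  have h' : Q.walkEnd p.start p.arrows = q.start := h
  simp only [finish, comp, walkEnd_append, h']

variable (Q)

/-- The path of length zero at `v`. -/
def nil (v : V) : Q.Path := ⟨v, [], trivial⟩

/-- An arrow as a path of length one. -/
def single (a : E) : Q.Path := ⟨Q.src a, [a], rfl, trivial⟩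

end Path

/-- The path algebra: the vector space with basis the set of all paths. -/
def PathAlgebra (K : Type*) [Field K] : Type _ := Q.Path →₀ K

namespace PathAlgebra

variable (K : Type*) [Field K]

instance : AddCommGroup (Q.PathAlgebra K) := inferInstanceAs (AddCommGroup (Q.Path →₀ K))

instance : Module K (Q.PathAlgebra K) := inferInstanceAs (Module K (Q.Path →₀ K))

/-- A path as an element of the path algebra. -/
def ofPath (p : Q.Path) : Q.PathAlgebra K := Finsupp.single p (1 : K)

open Classical in
/-- The product of two paths: their composition if it exists and zero otherwise. -/
def mulPath (p q : Q.Path) : Q.PathAlgebra K :=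
  if h : p.finish = q.start then ofPath Q K (p.comp q h) else 0

/-- The bilinear extension of the product of paths. -/
def mulHom : Q.PathAlgebra K →ₗ[K] Q.PathAlgebra K →ₗ[K] Q.PathAlgebra K :=
  Finsupp.linearCombination K
    (fun p => (Finsupp.linearCombination K (mulPath Q K p) :
      Q.PathAlgebra K →ₗ[K] Q.PathAlgebra K))

instance : Mul (Q.PathAlgebra K) := ⟨fun x y => mulHom Q K x y⟩

instance [Fintype V] : One (Q.PathAlgebra K) := ⟨∑ v : V, ofPath Q K (Path.nil Q v)⟩

lemma mul_def (x y : Q.PathAlgebra K) : x * y = mulHom Q K x y := rfl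

lemma mulHom_ofPath (p q : Q.Path) :
    mulHom Q K (ofPath Q K p) (ofPath Q K q) = mulPath Q K p q := by
  unfold mulHom ofPath
  erw [Finsupp.linearCombination_single, one_smul, Finsupp.linearCombination_single, one_smul]

variable {K Q} in
lemma hom_ext {M : Type*} [AddCommGroup M] [Module K M] {φ ψ : Q.PathAlgebra K →ₗ[K] M}
    (h : ∀ p, φ (ofPath Q K p) = ψ (ofPath Q K p)) : φ = ψ :=
  Finsupp.lhom_ext' fun p => LinearMap.ext_ring (h p)

lemma mulPath_assoc (p q r : Q.Path) :
    mulHom Q K (mulPath Q K p q) (ofPath Q K r) =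
      mulHom Q K (ofPath Q K p) (mulPath Q K q r) := by
  by_cases h : p.finish = q.start <;> by_cases h' : q.finish = r.start
  · have h1 : (p.comp q h).finish = r.start := by rw [Path.finish_comp, h']
    have h2 : p.finish = (q.comp r h').start := h
    rw [mulPath, mulPath, dif_pos h, dif_pos h', mulHom_ofPath, mulHom_ofPath, mulPath, mulPath,
      dif_pos h1, dif_pos h2]
    congr 1
    ext1
    · rfl
    · exact List.append_assoc _ _ _
  · have h1 : ¬ (p.comp q h).finish = r.start := by rw [Path.finish_comp]; exact h'
    rw [mulPath, mulPath, dif_pos h, dif_neg h', mulHom_ofPath, mulPath, dif_neg h1, map_zero]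
  · have h2 : ¬ p.finish = (q.comp r h').start := h
    rw [mulPath, mulPath, dif_neg h, dif_pos h', mulHom_ofPath, mulPath, dif_neg h2, map_zero,
      LinearMap.zero_apply]
  · rw [mulPath, mulPath, dif_neg h, dif_neg h', map_zero, map_zero, LinearMap.zero_apply]

lemma mulHom_assoc (x y z : Q.PathAlgebra K) :
    mulHom Q K (mulHom Q K x y) z = mulHom Q K x (mulHom Q K y z) := by
  let L : Q.PathAlgebra K →ₗ[K] Q.PathAlgebra K →ₗ[K] Q.PathAlgebra K →ₗ[K] Q.PathAlgebra K :=
    (mulHom Q K).compr₂ (mulHom Q K)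
  let R : Q.PathAlgebra K →ₗ[K] Q.PathAlgebra K →ₗ[K] Q.PathAlgebra K →ₗ[K] Q.PathAlgebra K :=
    ((LinearMap.llcomp K (Q.PathAlgebra K) (Q.PathAlgebra K) (Q.PathAlgebra K)).compl₂
      (mulHom Q K)).comp (mulHom Q K)
  have hLR : L = R := by
    refine hom_ext fun p => hom_ext fun q => hom_ext fun r => ?_
    simp only [L, R, LinearMap.compr₂_apply, LinearMap.comp_apply, LinearMap.compl₂_apply,
      LinearMap.llcomp_apply, mulHom_ofPath]
    exact mulPath_assoc Q K p q r
  exact LinearMap.congr_fun (LinearMap.congr_fun (LinearMap.congr_fun hLR x) y) z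

lemma one_def [Fintype V] : (1 : Q.PathAlgebra K) = ∑ v : V, ofPath Q K (Path.nil Q v) := rfl

lemma one_mulHom [Fintype V] (x : Q.PathAlgebra K) : mulHom Q K 1 x = x := by
  have h : mulHom Q K 1 = LinearMap.id := by
    refine hom_ext fun p => ?_
    rw [LinearMap.id_apply, one_def, map_sum, LinearMap.sum_apply, Finset.sum_eq_single p.start]
    · have hp : (Path.nil Q p.start).finish = p.start := rfl
      rw [mulHom_ofPath, mulPath, dif_pos hp]
      rfl
    · intro v _ hv
      have hp : ¬ (Path.nil Q v).finish = p.start := hv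
      rw [mulHom_ofPath, mulPath, dif_neg hp]
    · simp
  rw [h, LinearMap.id_apply]

lemma mulHom_one [Fintype V] (x : Q.PathAlgebra K) : mulHom Q K x 1 = x := by
  have h : (mulHom Q K).flip 1 = LinearMap.id := by
    refine hom_ext fun p => ?_
    rw [LinearMap.flip_apply, LinearMap.id_apply, one_def, map_sum, Finset.sum_eq_single p.finish]
    · have hp : p.finish = (Path.nil Q p.finish).start := rfl
      rw [mulHom_ofPath, mulPath, dif_pos hp]
      congr 1
      ext1
      · rfl
      · exact List.append_nil _
    · intro v _ hv
      have hp : ¬ p.finish = (Path.nil Q v).start := fun h => hv h.symm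
      rw [mulHom_ofPath, mulPath, dif_neg hp]
    · simp
  exact LinearMap.congr_fun h x

instance [Fintype V] : Ring (Q.PathAlgebra K) :=
  { (inferInstance : AddCommGroup (Q.PathAlgebra K)),
    (inferInstance : Mul (Q.PathAlgebra K)), (inferInstance : One (Q.PathAlgebra K)) with
    left_distrib := fun x y z => by simp only [mul_def, map_add]
    right_distrib := fun x y z => by simp only [mul_def, map_add, LinearMap.add_apply]
    zero_mul := fun x => by simp only [mul_def, map_zero, LinearMap.zero_apply]
    mul_zero := fun x => by simp only [mul_def, map_zero]
    mul_assoc := mulHom_assoc Q K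
    one_mul := one_mulHom Q K
    mul_one := mulHom_one Q K }

instance [Fintype V] : Algebra K (Q.PathAlgebra K) :=
  Algebra.ofModule
    (fun r x y => by simp only [mul_def, map_smul, LinearMap.smul_apply])
    (fun r x y => by simp only [mul_def, map_smul])

/-- The path of length zero at a vertex, in the path algebra. -/
def vertex (v : V) : Q.PathAlgebra K := ofPath Q K (Path.nil Q v)

/-- An arrow, in the path algebra. -/
def arrow (a : E) : Q.PathAlgebra K := ofPath Q K (Path.single Q a)

end PathAlgebra

end ArrowQuiver

/-! ## Triangulation quivers -/

/-- A triangulation quiver: a connected `2`-regular quiver with at least two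
vertices (`Nat.card` is `0` on infinite types, so this includes finiteness), with a permutation `f` of the arrows such that `f ^ 3 = 1` and `f a` starts
where `a` ends. -/
structure TriangulationQuiver (V : Type*) (E : Type*) extends ArrowQuiver V E where
  two_vertices : 2 ≤ Nat.card V
  connected : ∀ v w, Relation.EqvGen (fun x y => ∃ a, src a = x ∧ tgt a = y) v w
  two_out : ∀ v, {a | src a = v}.ncard = 2
  two_in : ∀ v, {a | tgt a = v}.ncard = 2
  f : Equiv.Perm E
  src_f : ∀ a, src (f a) = tgt a
  f_cubed : ∀ a, f (f (f a)) = a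

namespace TriangulationQuiver

variable {V : Type*} {E : Type*} (Q : TriangulationQuiver V E)

lemma exists_bar (a : E) : ∃ b, b ≠ a ∧ Q.src b = Q.src a := by
  have h : 1 < {b | Q.src b = Q.src a}.ncard := by rw [Q.two_out]; norm_num
  obtain ⟨b, hb, hne⟩ := Set.exists_ne_of_one_lt_ncard h a
  exact ⟨b, hne, hb⟩

/-- The other arrow with the same source; it is unique since the quiver is `2`-regular. -/
def bar (a : E) : E := (Q.exists_bar a).choose

/-- The permutation `g`. -/
def g (a : E) : E := Q.bar (Q.f a)

/-- The length of the `g`-cycle of an arrow. -/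
def n (a : E) : ℕ := Function.minimalPeriod Q.g a

end TriangulationQuiver

/-! ## Weighted surface algebras -/

/-- A triangulation quiver with weights and parameters. -/
structure WeightedTriangulationQuiver (K : Type*) [Field K] (V : Type*) (E : Type*)
    extends TriangulationQuiver V E where
  m : E → ℕ
  m_pos : ∀ a, 0 < m a
  m_g : ∀ a, m (toTriangulationQuiver.g a) = m a
  c : E → K
  c_ne_zero : ∀ a, c a ≠ 0
  c_g : ∀ a, c (toTriangulationQuiver.g a) = c a

namespace WeightedTriangulationQuiver

variable {K : Type*} [Field K] {V : Type*} {E : Type*} (D : WeightedTriangulationQuiver K V E)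

/-- An arrow `a` is virtual if `m a * n a = 2`. -/
def Virtual (a : E) : Prop := D.m a * D.n a = 2

/-- An arrow which starts and ends at the same vertex. -/
def IsLoop (a : E) : Prop := D.src a = D.tgt a

/-- The standing assumption on the weights of a general weighted surface algebra. -/
structure GeneralAssumption : Prop where
  two_le : ∀ a, 2 ≤ D.m a * D.n a
  three_le : ∀ a, D.Virtual (D.bar a) → ¬ D.IsLoop (D.bar a) → 3 ≤ D.m a * D.n a
  four_le : ∀ a, D.Virtual (D.bar a) → D.IsLoop (D.bar a) → 4 ≤ D.m a * D.n a

variable [Fintype V]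

/-- An arrow, in the path algebra. -/
abbrev arr (a : E) : D.toArrowQuiver.PathAlgebra K :=
  ArrowQuiver.PathAlgebra.arrow D.toArrowQuiver K a

/-- The path `a g(a) ... g^(k-1)(a)` of length `k` along the `g`-cycle of `a`. -/
def gPath (a : E) (k : ℕ) : D.toArrowQuiver.PathAlgebra K :=
  ArrowQuiver.PathAlgebra.vertex D.toArrowQuiver K (D.src a) *
    ((List.range k).map fun r => D.arr (D.g^[r] a)).prod

/-- The path `A_a` along the `g`-cycle of `a` of length `m a * n a - 1`. -/
def A (a : E) : D.toArrowQuiver.PathAlgebra K := D.gPath a (D.m a * D.n a - 1)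

/-- The defining relations of the weighted surface algebra: `Rel x y` stands for `x - y ∈ I`. -/
inductive Rel : D.toArrowQuiver.PathAlgebra K → D.toArrowQuiver.PathAlgebra K → Prop
  | triangle (a : E) : Rel (D.arr a * D.arr (D.f a)) (D.c (D.bar a) • D.A (D.bar a))
  | ffg (a : E) (h₁ : ¬ D.Virtual (D.f (D.f a)))
      (h₂ : ¬ (D.Virtual (D.f (D.bar a)) ∧ D.m (D.bar a) = 1 ∧ D.n (D.bar a) = 3)) :
      Rel (D.arr a * D.arr (D.f a) * D.arr (D.g (D.f a))) 0
  | gfg (a : E) (h₁ : ¬ D.Virtual (D.f a))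
      (h₂ : ¬ (D.Virtual (D.f (D.f a)) ∧ D.m (D.f a) = 1 ∧ D.n (D.f a) = 3)) :
      Rel (D.arr a * D.arr (D.g a) * D.arr (D.f (D.g a))) 0

/-- The weighted surface algebra: the quotient of the path algebra by the two-sided ideal
generated by the relations. -/
def Alg : Type _ := RingQuot D.Rel

instance : Ring D.Alg := inferInstanceAs (Ring (RingQuot D.Rel))

instance : Algebra K D.Alg := inferInstanceAs (Algebra K (RingQuot D.Rel))

/-- The quotient map from the path algebra. -/
def toAlg : D.toArrowQuiver.PathAlgebra K →ₐ[K] D.Alg := RingQuot.mkAlgHom K D.Rel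

/-- The idempotent of a vertex. -/
def e (v : V) : D.Alg := D.toAlg (ArrowQuiver.PathAlgebra.vertex D.toArrowQuiver K v)

/-- The indecomposable projective right module `e_v Λ`. Right modules over `Λ` are modules
over `Λᵐᵒᵖ`. -/
def P (v : V) : Submodule (D.Alg)ᵐᵒᵖ D.Alg := Submodule.span (D.Alg)ᵐᵒᵖ {D.e v}

/-- The simple right module of a vertex: the top of `e_v Λ`. -/
abbrev S (v : V) : Type _ := D.P v ⧸ Module.jacobson (D.Alg)ᵐᵒᵖ (D.P v)

/-- The canonical map from `e_v Λ` to its top; its kernel is the syzygy `Ω(S_v)`. -/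
abbrev toTop (v : V) : D.P v →ₗ[(D.Alg)ᵐᵒᵖ] D.S v :=
  (Module.jacobson (D.Alg)ᵐᵒᵖ (D.P v)).mkQ

/-- The singular triangle algebra. The triangle algebras are those with `Q` the quiver with
three vertices `i, j, k`, virtual loops `bar a` at `i` and `f (g a)` at `k`, and all other arrows
in a `g`-cycle `(a g(a) g²(a) f(a))` of weight `1`, passing through `i, j, k, j`. -/
def IsSingularTriangle : Prop :=
  ∃ a : E, D.IsLoop (D.bar a) ∧ D.Virtual (D.bar a) ∧
    D.IsLoop (D.f (D.g a)) ∧ D.Virtual (D.f (D.g a)) ∧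
    D.m a = 1 ∧ D.n a = 4 ∧
    D.c (D.bar a) * D.c a ^ 2 * D.c (D.f (D.g a)) = 1

end WeightedTriangulationQuiver

/-! ## Projective covers, injective hulls, syzygies, periodic modules -/

section Homological

universe u

variable {R : Type u} [Ring R]

/-- A superfluous (small) submodule. -/
def IsSuperfluous {M : Type*} [AddCommGroup M] [Module R M] (N : Submodule R M) : Prop :=
  ∀ L : Submodule R M, N ⊔ L = ⊤ → L = ⊤

/-- An essential (large) submodule. -/
def IsEssentialSubmodule {M : Type*} [AddCommGroup M] [Module R M] (N : Submodule R M) : Prop :=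
  ∀ L : Submodule R M, N ⊓ L = ⊥ → L = ⊥

/-- `p` is a projective cover. -/
structure IsProjectiveCover {P M : Type*} [AddCommGroup P] [Module R P] [AddCommGroup M]
    [Module R M] (p : P →ₗ[R] M) : Prop where
  projective : Module.Projective R P
  surjective : Function.Surjective p
  superfluous : IsSuperfluous (LinearMap.ker p)

/-- `u` is an injective hull. -/
structure IsInjectiveHull {M I : Type u} [AddCommGroup M] [Module R M] [AddCommGroup I]
    [Module R I] (u : M →ₗ[R] I) : Prop where
  injective_module : Module.Injective R I
  injective : Function.Injective u
  essential : IsEssentialSubmodule (LinearMap.range u)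

/-- A minimal projective resolution
`... → X 2 → X 1 → X 0 → M → 0` by finitely generated modules. -/
structure IsMinimalProjectiveResolution {M : Type*} [AddCommGroup M] [Module R M]
    (X : ℕ → Type*) [∀ n, AddCommGroup (X n)] [∀ n, Module R (X n)]
    (d : ∀ n, X (n + 1) →ₗ[R] X n) (ε : X 0 →ₗ[R] M) : Prop where
  projective : ∀ n, Module.Projective R (X n)
  finite : ∀ n, Module.Finite R (X n)
  surjective : Function.Surjective ε
  exact_zero : Function.Exact (d 0) ε
  exact_succ : ∀ n, Function.Exact (d (n + 1)) (d n)
  minimal_zero : IsSuperfluous (LinearMap.ker ε)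
  minimal_succ : ∀ n, IsSuperfluous (LinearMap.ker (d n))

/-- `N` is (isomorphic to) the syzygy `Ω(M)`, the kernel of a projective cover of `M`. -/
def IsSyzygy (M N : ModuleCat.{u} R) : Prop :=
  ∃ (P : ModuleCat.{u} R) (p : P →ₗ[R] M),
    IsProjectiveCover p ∧ Nonempty (N ≃ₗ[R] LinearMap.ker p)

/-- `N` is (isomorphic to) the iterated syzygy `Ω^k(M)`. -/
def IsIteratedSyzygy : ℕ → ModuleCat.{u} R → ModuleCat.{u} R → Prop
  | 0, M, N => Nonempty (N ≃ₗ[R] M)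
  | k + 1, M, N => ∃ L : ModuleCat.{u} R, IsSyzygy M L ∧ IsIteratedSyzygy k L N

/-- `M` is periodic of period `k`: `k` is the least positive integer with `Ω^k(M) ≅ M`. -/
def IsPeriodicOfPeriod (M : ModuleCat.{u} R) (k : ℕ) : Prop :=
  0 < k ∧ IsIteratedSyzygy k M M ∧ ∀ l, 0 < l → l < k → ¬ IsIteratedSyzygy l M M

/-- The sequence `x₀, x₁, x₂, x₃, x₀, x₁, ...`. -/
def fourPeriodic {α : Type*} (x₀ x₁ x₂ x₃ : α) : ℕ → α
  | 0 => x₀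
  | 1 => x₁
  | 2 => x₂
  | 3 => x₃
  | k + 4 => fourPeriodic x₀ x₁ x₂ x₃ k

/-- The `4`-periodic sequence of maps
`... → X₀ → X₃ → X₂ → X₁ → X₀` given by `d₀, d₁, d₂, d₃, d₀, d₁, ...` (from right to left). -/
def fourPeriodicMap {M : Type*} [AddCommGroup M] [Module R M] (X₀ X₁ X₂ X₃ : Submodule R M)
    (d₀ : X₁ →ₗ[R] X₀) (d₁ : X₂ →ₗ[R] X₁) (d₂ : X₃ →ₗ[R] X₂) (d₃ : X₀ →ₗ[R] X₃) :
    ∀ k : ℕ, (fourPeriodic X₀ X₁ X₂ X₃ (k + 1) : Submodule R M) →ₗ[R]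
      (fourPeriodic X₀ X₁ X₂ X₃ k : Submodule R M)
  | 0 => d₀
  | 1 => d₁
  | 2 => d₂
  | 3 => d₃
  | k + 4 => fourPeriodicMap X₀ X₁ X₂ X₃ d₀ d₁ d₂ d₃ k

end Homological

end

/-! Write `w` for `weight a`. The virtual loop forces `f (bar a) = a`, `f (f a) = bar a` and `g (f
a) = a`. Near `i` the triangle relations therefore say that `a · f a` is a multiple of the loop `bar
a`, that `bar a · a` is a multiple of `A a`, and that `f a · bar a` is a multiple of `A (g a)`. In
particular `bar a` lies in `aΛ`, so the radical of `P_i` is `aΛ`, a quotient of `P_j`.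

All maps are left multiplications: by `a` from `P_j` onto `Ω(S_i)`, by `mid = f a · a - c_{bar a}
c_a · (the path of length w - 2 from g a)` on `P_j`, by `f a` from `P_i` to `P_j`, and by the full
turn `soc` (a multiple of the square of `bar a`) on `P_i`. Consecutive products vanish by the
relations (`x_mul_mid`, `mid_mul_x_f`, `x_f_mul_soc`).

Exactness is a dimension count (`exists_of_finrank_le`). Filtrations by length give `dim P_i ≤ w +
2` and `dim P_j ≤ 2w`. The ranks of `a`, `mid`, `f a` and `soc` are at least `w + 1`, `w - 1`, `w +
1` and `1`, so consecutive ranks fill the module between them. Lower bounds need linear independence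
of paths, which is read off from two explicit representations (`relSystem_srcAct`,
`relSystem_tgtAct`). The parameters matter only in `exists_mid_mul_x_g`: `mid · g a` is `r` times `f
a · a · g a`, where `r = 1` unless `w = 4` and `f (g a)` is virtual. In that case `r = 1 - c_{bar a}
c_a² c_{f (g a)}`, and `r = 0` is the singular triangle algebra.

For injectivity of `P_i`, the coefficient of `soc` pairs `P_i = e_i Λ` with `Λ e_i`. Every nonzero
element of `P_i` can be multiplied into `soc`, and `dim Λ e_i ≤ w + 2` follows from the same bound
for the opposite quiver. Hence the pairing is perfect and `P_i` is dual to `Λ e_i`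
(`injective_P_of_pairing`).

Minimality holds because all kernels lie in the arrow ideal, whose elements in `P_i` and `P_j` are
nilpotent. The period is exactly 4 because arrows kill `S_i` but not the generators `a`, `mid`, `f
a` of the first three syzygies. -/

noncomputable section

/-! ### Combinatorics of `f` and `g` around a virtual loop. -/

namespace TriangulationQuiver

variable {V : Type*} {E : Type*} (Q : TriangulationQuiver V E)

lemma bar_ne (a : E) : Q.bar a ≠ a := (Q.exists_bar a).choose_spec.1

lemma src_bar (a : E) : Q.src (Q.bar a) = Q.src a := (Q.exists_bar a).choose_spec.2

lemma eq_or_eq_bar {a b : E} (h : Q.src b = Q.src a) : b = a ∨ b = Q.bar a := by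
  obtain ⟨x, y, hxy, hs⟩ := Set.ncard_eq_two.1 (Q.two_out (Q.src a))
  have h1 : a ∈ ({x, y} : Set E) := hs ▸ (rfl : Q.src a = Q.src a)
  have h2 : b ∈ ({x, y} : Set E) := hs ▸ h
  have h3 : Q.bar a ∈ ({x, y} : Set E) := hs ▸ Q.src_bar a
  have h4 := Q.bar_ne a
  simp only [Set.mem_insert_iff, Set.mem_singleton_iff] at h1 h2 h3
  grind

lemma eq_bar_of_ne {a b : E} (h : Q.src b = Q.src a) (hne : b ≠ a) : b = Q.bar a :=
  (Q.eq_or_eq_bar h).resolve_left hne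

@[simp] lemma bar_bar (a : E) : Q.bar (Q.bar a) = a :=
  (Q.eq_bar_of_ne (Q.src_bar a).symm (Q.bar_ne a).symm).symm

lemma bar_injective : Function.Injective Q.bar :=
  Function.LeftInverse.injective Q.bar_bar

lemma g_injective : Function.Injective Q.g := Q.bar_injective.comp Q.f.injective

@[simp] lemma g_inj {a b : E} : Q.g a = Q.g b ↔ a = b := Q.g_injective.eq_iff

lemma bar_g (a : E) : Q.bar (Q.g a) = Q.f a := Q.bar_bar _

lemma bar_f (a : E) : Q.bar (Q.f a) = Q.g a := rfl

lemma src_g (a : E) : Q.src (Q.g a) = Q.tgt a := (Q.src_bar _).trans (Q.src_f a)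

lemma f_ne_g (a : E) : Q.f a ≠ Q.g a := (Q.bar_ne _).symm

/-- The predecessor of an arrow in its `g`-cycle composed with `f`. -/
lemma f_eq_bar_of_g_eq {y x : E} (h : Q.g y = x) : Q.f y = Q.bar x := by
  rw [← h, bar_g]

lemma g_iterate (k : ℕ) (a : E) : Q.g (Q.g^[k] a) = Q.g^[k + 1] a :=
  (Function.iterate_succ_apply' Q.g k a).symm

lemma iterate_g (k : ℕ) (a : E) : Q.g^[k] (Q.g a) = Q.g^[k + 1] a := rfl

lemma n_g (a : E) : Q.n (Q.g a) = Q.n a := by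
  unfold n
  refine Function.minimalPeriod_eq_minimalPeriod_iff.2 fun k => ?_
  constructor
  · intro h
    have : Q.g (Q.g^[k] a) = Q.g a := by
      rw [g_iterate, ← iterate_g]; exact h
    exact Q.g_injective this
  · intro h
    change Q.g^[k] (Q.g a) = Q.g a
    rw [iterate_g, ← g_iterate]
    exact congrArg _ h

end TriangulationQuiver

namespace WeightedTriangulationQuiver

variable {K : Type*} [Field K] {V : Type*} {E : Type*} (D : WeightedTriangulationQuiver K V E)

/-- The length `m a * n a` of the closed walk `A a` followed by its last arrow. -/
def weight (b : E) : ℕ := D.m b * D.n b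

lemma weight_g (b : E) : D.weight (D.g b) = D.weight b := by
  simp only [weight, D.m_g, D.n_g]

lemma iterate_weight (b : E) : D.g^[D.weight b] b = b := by
  have : Function.IsPeriodicPt D.g (D.weight b) b :=
    (Function.isPeriodicPt_minimalPeriod D.g b).const_mul _
  exact this

lemma weight_iterate (b : E) (k : ℕ) : D.weight (D.g^[k] b) = D.weight b := by
  induction k with
  | zero => rfl
  | succ k ih => rw [Function.iterate_succ_apply', weight_g, ih]

lemma c_iterate (b : E) (k : ℕ) : D.c (D.g^[k] b) = D.c b := by
  induction k with
  | zero => rfl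
  | succ k ih => rw [Function.iterate_succ_apply', D.c_g, ih]

lemma virtual_iff {b : E} : D.Virtual b ↔ D.weight b = 2 := Iff.rfl

lemma Virtual.g_g {D : WeightedTriangulationQuiver K V E} {v : E} (h : D.Virtual v) :
    D.g (D.g v) = v := by
  have := D.iterate_weight v
  rw [D.virtual_iff.1 h] at this
  exact this

section Cycle

variable {D} {x y : E}

/-- Two arrows in different `g`-cycles on both sides of a `g`-cycle are not both virtual. -/
lemma not_virtual_f_and_virtual_f_g (hgg : D.g (D.g y) ≠ y)
    (h1 : D.Virtual (D.f y)) (h2 : D.Virtual (D.f (D.g y))) : False := by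
  have h1' := h1.g_g
  have h2' := h2.g_g
  have e1 : D.f y = D.bar (D.g y) := (D.bar_g y).symm
  set x := D.g y with hx
  have hwx : D.weight x = D.weight y := D.weight_g y
  set u := D.f x with hu
  -- `f (g (f y)) = x`
  have a1 : D.f (D.g (D.f y)) = x := by
    have := D.f_eq_bar_of_g_eq h1'
    rw [this, e1, D.bar_bar]
  have a2 : D.f u = D.g (D.f y) := by
    have := D.f_cubed (D.g (D.f y))
    rw [a1] at this
    exact this
  have a3 : D.g u = D.f (D.f y) := by
    rw [← D.bar_f, a2, D.bar_g]
  have a4 : D.g (D.g u) = D.bar y := by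
    rw [a3, ← D.bar_f, D.f_cubed]
  -- Virtuality of `u` turns `g (g u)` into `u`, so `u = bar y` and hence `g (g y) = y`, which is
  -- excluded.
  rw [h2'] at a4
  have a5 : D.g x = y := by
    rw [← D.bar_f, ← hu, a4, D.bar_bar]
  exact hgg a5

/-- From `f³ = 1` one has `g (f (f x)) = bar x`, so virtuality makes `f (f x)` and `bar x` the whole
`g`-cycle. -/
lemma virtual_f_f_three_aux (h : D.Virtual (D.f (D.f x))) :
    D.bar x = D.g (D.f (D.f x)) ∧ D.f (D.bar x) = D.g (D.f x) := by
  have h1 : D.g (D.f (D.f x)) = D.bar x := by rw [← D.bar_f, D.f_cubed]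
  refine ⟨h1.symm, ?_⟩
  have := D.f_eq_bar_of_g_eq (y := D.g (D.f (D.f x))) h.g_g
  rw [h1] at this
  rw [this, D.bar_f]

lemma virtual_bar_of_virtual_f_f (h : D.Virtual (D.f (D.f x))) : D.Virtual (D.bar x) := by
  rw [(virtual_f_f_three_aux h).1, virtual_iff, D.weight_g]
  exact h

/-- The `g`-cycle of `f y` is `f y`, `g (f y)`, `bar z` with `g z = y`. Virtuality of `u = f (g y)`
forces `g u = z`, so `y` lies on the `g`-cycle of `u` and has weight two. -/
lemma not_virtual_f_g_and_virtual_f_f (hw : 4 ≤ D.weight y)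
    (h1 : D.Virtual (D.f (D.g y))) (h2 : D.Virtual (D.f (D.f y)))
    (hn : D.n (D.f y) = 3) : False := by
  have hper : D.g (D.g (D.g (D.f y))) = D.f y := by
    have := Function.iterate_minimalPeriod (f := D.g) (x := D.f y)
    have hn' : Function.minimalPeriod D.g (D.f y) = 3 := hn
    rw [hn'] at this
    exact this
  obtain ⟨b1, b2⟩ := virtual_f_f_three_aux h2
  set z := D.f (D.bar (D.f (D.f y))) with hz
  -- `g z = y`
  have c1 : D.f (D.f (D.bar y)) = z := by
    rw [b2, hz, ← D.bar_f]
  have c2 : D.f z = D.bar y := by rw [← c1, D.f_cubed]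
  have c3 : D.g z = y := by rw [← D.bar_f, c2, D.bar_bar]
  have c4 : D.g (D.g (D.f y)) = D.bar z := by
    rw [← D.bar_f (D.g (D.f y)), ← D.bar_f (D.f y)]
  set u := D.f (D.g y) with hu
  have d1 : D.f (D.g u) = D.bar u := D.f_eq_bar_of_g_eq h1.g_g
  have d2 : D.f (D.f u) = D.g y := by rw [hu, D.f_cubed]
  have d3 : D.f u = D.bar (D.g u) := by rw [← D.bar_f, D.bar_bar]
  have d4 : D.g (D.bar (D.g u)) = D.f y := by
    rw [← D.bar_f, ← d3, d2, D.bar_g]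
  have d5 : D.bar (D.g u) = D.bar z := by
    rw [← c4]; exact D.g_injective (d4.trans hper.symm)
  have d6 : D.g u = z := D.bar_injective d5
  have : D.weight y = 2 := by
    rw [← c3, ← d6, D.weight_g, D.weight_g]; exact h1
  omega

end Cycle

/-- The local situation at an arrow `a` for which `bar a` is a virtual loop. -/
structure NearVirtualLoop (a : E) : Prop where
  two_le : ∀ b, 2 ≤ D.weight b
  f_bar : D.f (D.bar a) = a
  virtual : D.Virtual (D.bar a)
  four_le : 4 ≤ D.weight a

namespace NearVirtualLoop

variable {D} {a : E} (h : D.NearVirtualLoop a)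
include h

lemma f_f : D.f (D.f a) = D.bar a := by
  conv_lhs => rw [← h.f_bar]
  exact D.f_cubed _

lemma g_bar : D.g (D.bar a) = D.bar a := by rw [← D.bar_f, h.f_bar]

lemma g_f : D.g (D.f a) = a := by rw [← D.bar_f, h.f_f, D.bar_bar]

lemma weight_f : D.weight (D.f a) = D.weight a := by rw [← D.weight_g, h.g_f]

lemma c_f : D.c (D.f a) = D.c a := by rw [← D.c_g, h.g_f]

lemma g_ne : D.g a ≠ a := by
  intro h1
  have h2 := D.f_eq_bar_of_g_eq h1
  have h3 := h.f_f
  rw [h2, h.f_bar] at h3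
  exact D.bar_ne a h3.symm

lemma g_g_ne : D.g (D.g a) ≠ a := by
  intro h1
  have h2 : D.g a = D.f a := D.g_injective (h1.trans h.g_f.symm)
  exact D.f_ne_g a h2.symm

lemma iterate_g_ne (k : ℕ) : D.g (D.g^[k] a) ≠ D.g^[k] a := by
  intro h1
  rw [D.g_iterate, ← D.iterate_g] at h1
  exact h.g_ne (D.g_injective.iterate k h1)

lemma iterate_g_g_ne (k : ℕ) : D.g (D.g (D.g^[k] a)) ≠ D.g^[k] a := by
  intro h1
  rw [D.g_iterate, D.g_iterate, ← D.iterate_g, ← D.iterate_g] at h1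
  exact h.g_g_ne (D.g_injective.iterate k h1)

lemma iterate_pred : D.g^[D.weight a - 1] a = D.f a := by
  have h4 := h.four_le
  apply D.g_injective
  rw [D.g_iterate, h.g_f,
    show D.weight a - 1 + 1 = D.weight a by omega, D.iterate_weight]

lemma f_iterate_pred_pred : D.f (D.g^[D.weight a - 2] a) = D.g a := by
  have h4 := h.four_le
  have : D.g (D.g^[D.weight a - 2] a) = D.f a := by
    rw [D.g_iterate, ← h.iterate_pred]
    congr 1
    omega
  rw [D.f_eq_bar_of_g_eq this, D.bar_f]

lemma f_f_g : D.f (D.f (D.g a)) = D.g^[D.weight a - 2] a := by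
  rw [← h.f_iterate_pred_pred, D.f_cubed]

lemma not_virtual_iterate (k : ℕ) : ¬ D.Virtual (D.g^[k] a) := by
  rw [virtual_iff, D.weight_iterate]
  have := h.four_le
  omega

lemma not_virtual : ¬ D.Virtual a := h.not_virtual_iterate 0

lemma not_virtual_f : ¬ D.Virtual (D.f a) := by
  rw [virtual_iff, h.weight_f]
  have := h.four_le
  omega

lemma bar_ne_iterate (k : ℕ) : D.bar a ≠ D.g^[k] a := by
  intro h1
  exact h.not_virtual_iterate k (h1 ▸ h.virtual)

end NearVirtualLoop

/-- Since `bar a` is a loop, `f (bar a)` starts at the source of `a`. If it were `bar a`, then `g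
(bar a) = a` would make `a` virtual, against weight at least four. -/
lemma GeneralAssumption.nearVirtualLoop {D : WeightedTriangulationQuiver K V E}
    (hD : D.GeneralAssumption) {a : E} (hloop : D.IsLoop (D.bar a)) (hvirt : D.Virtual (D.bar a))
     : D.NearVirtualLoop a where
  two_le := hD.two_le
  virtual := hvirt
  four_le := hD.four_le a hvirt hloop
  f_bar := by
    have h1 : D.src (D.f (D.bar a)) = D.src a := by
      rw [D.src_f, ← D.src_bar]; exact hloop.symm
    refine (D.eq_or_eq_bar h1).resolve_right fun h2 => ?_
    have hg : D.g (D.bar a) = a := by rw [← D.bar_f, h2, D.bar_bar]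
    have h3 : D.weight a = 2 := by
      rw [← hg, D.weight_g]; exact hvirt
    have := hD.four_le a hvirt hloop
    unfold weight at h3
    omega

end WeightedTriangulationQuiver

/-! ### Systems of elements satisfying the relations, and the universal property of the algebra. -/

namespace WeightedTriangulationQuiver

variable {K : Type*} [Field K] {V : Type*} {E : Type*} (D : WeightedTriangulationQuiver K V E)

section PathProd

variable {R : Type*} [Ring R] (X : E → R)

/-- The product of the elements `X b`, `X (g b)`, ..., `X (g^(k-1) b)`. -/
def pathProd (b : E) (k : ℕ) : R := ((List.range k).map fun r => X (D.g^[r] b)).prod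

@[simp] lemma pathProd_zero (b : E) : D.pathProd X b 0 = 1 := rfl

lemma pathProd_succ (b : E) (k : ℕ) :
    D.pathProd X b (k + 1) = D.pathProd X b k * X (D.g^[k] b) := by
  simp [pathProd, List.range_succ]

@[simp] lemma pathProd_one (b : E) : D.pathProd X b 1 = X b := by
  simp [pathProd_succ]

lemma pathProd_add (b : E) (k l : ℕ) :
    D.pathProd X b (k + l) = D.pathProd X b k * D.pathProd X (D.g^[k] b) l := by
  induction l with
  | zero => simp
  | succ l ih =>
    rw [← add_assoc, pathProd_succ, ih, pathProd_succ, mul_assoc, ← Function.iterate_add_apply,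
      add_comm k l]

lemma pathProd_succ' (b : E) (k : ℕ) :
    D.pathProd X b (k + 1) = X b * D.pathProd X (D.g b) k := by
  rw [add_comm, pathProd_add, pathProd_one, Function.iterate_one]

end PathProd

open ArrowQuiver PathAlgebra

lemma ofPath_mul_ofPath (p q : D.toArrowQuiver.Path) (h : p.finish = q.start) :
    ofPath D.toArrowQuiver K p * ofPath D.toArrowQuiver K q =
      ofPath D.toArrowQuiver K (p.comp q h) := by
  rw [mul_def, mulHom_ofPath, mulPath, dif_pos h]

variable [Fintype V] {R : Type*} [Ring R] [Algebra K R]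

/-- Elements of an algebra which satisfy the defining relations of the weighted surface
algebra. -/
structure RelSystem (ε : V → R) (X : E → R) : Prop where
  idem : ∀ v, ε v * ε v = ε v
  orth : ∀ v w, v ≠ w → ε v * ε w = 0
  sum_eq_one : ∑ v, ε v = 1
  src_mul : ∀ b, ε (D.src b) * X b = X b
  mul_tgt : ∀ b, X b * ε (D.tgt b) = X b
  triangle : ∀ b, X b * X (D.f b) =
    D.c (D.bar b) • D.pathProd X (D.bar b) (D.weight (D.bar b) - 1)
  ffg : ∀ b, ¬ D.Virtual (D.f (D.f b)) →
    ¬ (D.Virtual (D.f (D.bar b)) ∧ D.m (D.bar b) = 1 ∧ D.n (D.bar b) = 3) →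
      X b * X (D.f b) * X (D.g (D.f b)) = 0
  gfg : ∀ b, ¬ D.Virtual (D.f b) →
    ¬ (D.Virtual (D.f (D.f b)) ∧ D.m (D.f b) = 1 ∧ D.n (D.f b) = 3) →
      X b * X (D.g b) * X (D.f (D.g b)) = 0

namespace RelSystem

variable {D} {ε : V → R} {X : E → R} (h : D.RelSystem ε X)
include h

lemma mul_src_of_ne {b : E} {v : V} (hv : v ≠ D.src b) : ε v * X b = 0 := by
  rw [← h.src_mul b, ← mul_assoc, h.orth _ _ hv, zero_mul]

lemma mul_tgt_of_ne {b : E} {v : V} (hv : D.tgt b ≠ v) : X b * ε v = 0 := by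
  rw [← h.mul_tgt b, mul_assoc, h.orth _ _ hv, mul_zero]

lemma mul_of_ne {b b' : E} (hv : D.tgt b ≠ D.src b') : X b * X b' = 0 := by
  rw [← h.mul_tgt b, mul_assoc, h.mul_src_of_ne hv, mul_zero]

lemma src_mul_pathProd (b : E) (k : ℕ) :
    ε (D.src b) * D.pathProd X b (k + 1) = D.pathProd X b (k + 1) := by
  rw [pathProd_succ', ← mul_assoc, h.src_mul]

end RelSystem

/-- The linear map sending a path to the corresponding product. -/
def evalPath (ε : V → R) (X : E → R) : D.toArrowQuiver.PathAlgebra K →ₗ[K] R :=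
  Finsupp.linearCombination K
    (fun p : D.toArrowQuiver.Path => ε p.start * (p.arrows.map X).prod)

lemma evalPath_ofPath (ε : V → R) (X : E → R) (p : D.toArrowQuiver.Path) :
    D.evalPath ε X (ofPath D.toArrowQuiver K p) = ε p.start * (p.arrows.map X).prod :=
  (Finsupp.linearCombination_single _ _ _).trans (one_smul _ _)

/-- The homomorphism from the path algebra given by elements satisfying the relations. -/
def RelSystem.pathHom {D : WeightedTriangulationQuiver K V E} {ε : V → R} {X : E → R}
    (h : D.RelSystem ε X) : D.toArrowQuiver.PathAlgebra K →ₐ[K] R := by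
  refine AlgHom.ofLinearMap (D.evalPath ε X) ?_ ?_
  · rw [← h.sum_eq_one, one_def, map_sum]
    refine Finset.sum_congr rfl fun v _ => ?_
    rw [evalPath_ofPath]
    simp [Path.nil]
  -- Right multiplication by an idempotent detects the end point of a walk, which is what makes the
  -- evaluation multiplicative on paths.
  · have key (v w : V) (l : List E) (hl : D.toArrowQuiver.IsWalk v l) :
        ε v * (l.map X).prod * ε w =
          open Classical in if D.toArrowQuiver.walkEnd v l = w then ε v * (l.map X).prod else 0 := by
      classical
      induction l generalizing v with
      | nil =>
        by_cases hvw : v = w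
        · subst hvw; simp [ArrowQuiver.walkEnd, h.idem]
        · simp [ArrowQuiver.walkEnd, hvw, h.orth]
      | cons b l ih =>
        obtain ⟨rfl, hl⟩ := hl
        have := ih _ hl
        simp only [List.map_cons, List.prod_cons, ArrowQuiver.walkEnd]
        rw [← mul_assoc, h.src_mul, ← h.mul_tgt, mul_assoc (X b), mul_assoc (X b), this]
        split_ifs <;> simp
    have : (mulHom D.toArrowQuiver K).compr₂ (D.evalPath ε X) = (LinearMap.mul K R).compl₁₂ (D.evalPath ε X) (D.evalPath ε X) := by
      refine hom_ext fun p => hom_ext fun q => ?_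
      simp only [LinearMap.compr₂_apply, LinearMap.compl₁₂_apply, LinearMap.mul_apply',
        mulHom_ofPath, evalPath_ofPath]
      have hk := key p.start q.start p.arrows p.isWalk
      rw [← mul_assoc, hk, mulPath]
      split_ifs with h1 h2 h2
      · rw [evalPath_ofPath]
        simp [Path.comp, mul_assoc]
      · exact absurd h1 h2
      · exact absurd h2 h1
      · simp
    intro x y
    exact LinearMap.congr_fun (LinearMap.congr_fun this x) y

lemma RelSystem.pathHom_vertex {D : WeightedTriangulationQuiver K V E} {ε : V → R} {X : E → R}
    (h : D.RelSystem ε X) (v : V) : h.pathHom (vertex D.toArrowQuiver K v) = ε v := by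
  refine (D.evalPath_ofPath ε X _).trans ?_
  simp [Path.nil]

lemma RelSystem.pathHom_arr {D : WeightedTriangulationQuiver K V E} {ε : V → R} {X : E → R}
    (h : D.RelSystem ε X) (b : E) : h.pathHom (D.arr b) = X b := by
  refine (D.evalPath_ofPath ε X _).trans ?_
  simp [Path.single, h.src_mul]

lemma map_gPath {S : Type*} [Ring S] [Algebra K S] (φ : D.toArrowQuiver.PathAlgebra K →ₐ[K] S)
    (b : E) (k : ℕ) : φ (D.gPath b k) =
      φ (vertex D.toArrowQuiver K (D.src b)) * D.pathProd (fun b => φ (D.arr b)) b k := by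
  rw [gPath, map_mul, map_list_prod, pathProd, List.map_map]
  rfl

/-- The homomorphism from the weighted surface algebra given by elements satisfying the
relations. -/
def RelSystem.lift {D : WeightedTriangulationQuiver K V E} (hD : ∀ b, 2 ≤ D.weight b)
    {ε : V → R} {X : E → R} (h : D.RelSystem ε X) : D.Alg →ₐ[K] R :=
  RingQuot.liftAlgHom K ⟨h.pathHom, by
    intro x y hxy
    induction hxy with
    | triangle b =>
      -- Weight at least two gives the path `A (bar b)` positive length, so the vertex at the front
      -- of `gPath` is absorbed by the first arrow.
      obtain ⟨k, hk⟩ : ∃ k, D.m (D.bar b) * D.n (D.bar b) - 1 = k + 1 :=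
        ⟨D.weight (D.bar b) - 2, by have := hD (D.bar b); unfold weight at *; omega⟩
      rw [map_mul, map_smul, A, map_gPath]
      simp only [h.pathHom_arr, h.pathHom_vertex]
      rw [h.triangle, weight, hk, h.src_mul_pathProd]
    | ffg b h₁ h₂ => simp only [map_mul, map_zero, h.pathHom_arr, h.ffg b h₁ h₂]
    | gfg b h₁ h₂ => simp only [map_mul, map_zero, h.pathHom_arr, h.gfg b h₁ h₂]⟩

/-- An arrow, in the weighted surface algebra. -/
def x (b : E) : D.Alg := D.toAlg (D.arr b)

lemma RelSystem.lift_e {D : WeightedTriangulationQuiver K V E} (hD : ∀ b, 2 ≤ D.weight b)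
    {ε : V → R} {X : E → R} (h : D.RelSystem ε X) (v : V) : h.lift hD (D.e v) = ε v := by
  rw [← h.pathHom_vertex v]
  exact RingQuot.liftAlgHom_mkAlgHom_apply _ _ _ _

lemma RelSystem.lift_x {D : WeightedTriangulationQuiver K V E} (hD : ∀ b, 2 ≤ D.weight b)
    {ε : V → R} {X : E → R} (h : D.RelSystem ε X) (b : E) : h.lift hD (D.x b) = X b := by
  rw [← h.pathHom_arr b]
  exact RingQuot.liftAlgHom_mkAlgHom_apply _ _ _ _

lemma toAlg_eq_of_rel {y z : D.toArrowQuiver.PathAlgebra K} (h : D.Rel y z) :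
    D.toAlg y = D.toAlg z :=
  RingQuot.mkAlgHom_rel K h

lemma vertex_mul_vertex (v w : V) :
    vertex D.toArrowQuiver K v * vertex D.toArrowQuiver K w =
      open Classical in if v = w then vertex D.toArrowQuiver K v else 0 := by
  rw [vertex, vertex, mul_def, mulHom_ofPath, mulPath]
  split_ifs with h1 h2 h2
  · rfl
  · exact absurd h1 h2
  · exact absurd h2 h1
  · rfl

omit [Fintype V] in
lemma vertex_mul_arr (b : E) : vertex D.toArrowQuiver K (D.src b) * D.arr b = D.arr b := by
  exact D.ofPath_mul_ofPath _ _ rfl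

omit [Fintype V] in
lemma arr_mul_vertex (b : E) : D.arr b * vertex D.toArrowQuiver K (D.tgt b) = D.arr b := by
  exact D.ofPath_mul_ofPath _ _ rfl

lemma ofPath_eq (p : D.toArrowQuiver.Path) :
    ofPath D.toArrowQuiver K p =
      vertex D.toArrowQuiver K p.start * (p.arrows.map D.arr).prod := by
  obtain ⟨v, l, hl⟩ := p
  induction l generalizing v with
  | nil => simp [vertex, Path.nil]
  | cons b l ih =>
    obtain ⟨rfl, hl⟩ := hl
    have := ih _ hl
    simp only [List.map_cons, List.prod_cons] at this ⊢
    rw [← mul_assoc, vertex_mul_arr, ← arr_mul_vertex, mul_assoc, ← this]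
    exact (D.ofPath_mul_ofPath (Path.single _ b) ⟨D.tgt b, l, hl⟩ rfl).symm

lemma relSystem_alg (hD : ∀ b, 2 ≤ D.weight b) : D.RelSystem D.e D.x where
  idem v := by
    rw [e, ← map_mul, vertex_mul_vertex, if_pos rfl]
  orth v w hvw := by
    rw [e, e, ← map_mul, vertex_mul_vertex, if_neg hvw, map_zero]
  sum_eq_one := by
    rw [← map_one D.toAlg, one_def, map_sum]
    rfl
  src_mul b := by rw [e, x, ← map_mul, vertex_mul_arr]
  mul_tgt b := by rw [e, x, ← map_mul, arr_mul_vertex]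
  triangle b := by
    have h1 := D.toAlg_eq_of_rel (Rel.triangle b)
    rw [map_mul, map_smul, A, map_gPath] at h1
    obtain ⟨k, hk⟩ : ∃ k, D.m (D.bar b) * D.n (D.bar b) - 1 = k + 1 :=
      ⟨D.weight (D.bar b) - 2, by have := hD (D.bar b); unfold weight at *; omega⟩
    rw [x, x, h1, weight, hk, pathProd_succ', pathProd_succ', ← mul_assoc, ← map_mul,
      vertex_mul_arr]
    rfl
  ffg b h₁ h₂ := by
    rw [x, x, x, ← map_mul, ← map_mul, D.toAlg_eq_of_rel (Rel.ffg b h₁ h₂), map_zero]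
  gfg b h₁ h₂ := by
    rw [x, x, x, ← map_mul, ← map_mul, D.toAlg_eq_of_rel (Rel.gfg b h₁ h₂), map_zero]

/-- This reduces closure of a subspace under right multiplication to vertices and arrows. -/
lemma adjoin_alg : Algebra.adjoin K (Set.range D.e ∪ Set.range D.x) = ⊤ := by
  rw [eq_top_iff]
  rintro y -
  obtain ⟨y, rfl⟩ := RingQuot.mkAlgHom_surjective K D.Rel y
  change D.toAlg y ∈ _
  set S := Subalgebra.toSubmodule (Algebra.adjoin K (Set.range D.e ∪ Set.range D.x))
  have : S.mkQ ∘ₗ D.toAlg.toLinearMap = 0 := by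
    refine hom_ext fun p => ?_
    rw [LinearMap.comp_apply, LinearMap.zero_apply, Submodule.mkQ_apply,
      Submodule.Quotient.mk_eq_zero, AlgHom.toLinearMap_apply, ofPath_eq, map_mul, map_list_prod]
    refine mul_mem (S := Subalgebra K D.Alg)
      (Algebra.subset_adjoin (Or.inl ⟨_, rfl⟩)) (list_prod_mem ?_)
    simp only [List.map_map, List.mem_map]
    rintro _ ⟨b, -, rfl⟩
    exact Algebra.subset_adjoin (Or.inr ⟨b, rfl⟩)
  exact (Submodule.Quotient.mk_eq_zero S).1 (LinearMap.congr_fun this y)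

end WeightedTriangulationQuiver

/-! ### Consequences of the relations for paths around the virtual loop. -/

namespace WeightedTriangulationQuiver

variable {K : Type*} [Field K] {V : Type*} {E : Type*} {D : WeightedTriangulationQuiver K V E}
  [Fintype V] {R : Type*} [Ring R] [Algebra K R]

omit [Fintype V] [Algebra K R] in
lemma pathProd_three (X : E → R) (y : E) :
    D.pathProd X y 3 = X y * X (D.g y) * X (D.g (D.g y)) := by
  rw [pathProd_succ, pathProd_succ, pathProd_one]
  rfl

namespace RelSystem

variable {ε : V → R} {X : E → R} (h : D.RelSystem ε X)
include h

/-- This is the first exception in the relations `gfg`: `A (f x)` is the single arrow `f x`, so two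
triangle relations apply in succession. -/
lemma mul_g_mul_f_of_virtual {x : E} (hx : D.Virtual (D.f x)) :
    X x * X (D.g x) * X (D.f (D.g x)) =
      (D.c (D.f x) * D.c (D.bar x)) • D.pathProd X (D.bar x) (D.weight (D.bar x) - 1) := by
  rw [mul_assoc, h.triangle, D.bar_g, D.virtual_iff.1 hx, pathProd_one, mul_smul_comm, h.triangle,
    smul_smul]

/-- This is the second exception in `gfg`. Here `A (f x)` has two arrows, `A (bar x)` is the arrow
`bar x`, and `g (f x) = f (bar x)`, so three triangle relations lead back to `A x`. -/
lemma mul_g_mul_f_of_virtual_f_f {x : E}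
    (hx : D.Virtual (D.f (D.f x))) (hm : D.weight (D.f x) = 3) :
    ∃ C : K, X x * X (D.g x) * X (D.f (D.g x)) = C • D.pathProd X x (D.weight x - 1) := by
  have hv := virtual_bar_of_virtual_f_f hx
  rw [mul_assoc, h.triangle, D.bar_g, hm, pathProd_succ', pathProd_one, mul_smul_comm,
    ← mul_assoc, h.triangle, D.virtual_iff.1 hv, pathProd_one, smul_mul_assoc,
    ← (virtual_f_f_three_aux hx).2, h.triangle, D.bar_bar, smul_smul, smul_smul]
  exact ⟨_, rfl⟩

/-- One more arrow in front removes the first exception: a virtual `f (g y)` reduces the product to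
`y · g y · f (g y)`, which vanishes because neither exception can hold there. Only the second
exception remains. -/
lemma four_term {y : E} (hw : 4 ≤ D.weight y)
    (hgg : D.g (D.g y) ≠ y) :
    X y * (X (D.g y) * X (D.g (D.g y)) * X (D.f (D.g (D.g y)))) = 0 ∨
      D.Virtual (D.f (D.f (D.g y))) ∧ D.weight (D.f (D.g y)) = 3 := by
  by_cases hA : D.Virtual (D.f (D.g y))
  · left
    rw [mul_assoc, h.triangle, D.bar_g, D.virtual_iff.1 hA, pathProd_one, mul_smul_comm,
      mul_smul_comm, ← mul_assoc, h.gfg, smul_zero]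
    · exact fun h1 => not_virtual_f_and_virtual_f_g hgg h1 hA
    · exact fun ⟨h1, h2, h3⟩ => not_virtual_f_g_and_virtual_f_f hw hA h1 h3
  · by_cases hB : D.Virtual (D.f (D.f (D.g y))) ∧ D.m (D.f (D.g y)) = 1 ∧ D.n (D.f (D.g y)) = 3
    · right
      refine ⟨hB.1, ?_⟩
      rw [weight, hB.2.1, hB.2.2]
    · left
      rw [h.gfg _ hA hB, mul_zero]

variable {a : E} (H : D.NearVirtualLoop a)
include H

lemma mul_f_a : X a * X (D.f a) = D.c (D.bar a) • X (D.bar a) := by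
  rw [h.triangle, D.virtual_iff.1 H.virtual, pathProd_one]

lemma loop_mul_a : X (D.bar a) * X a = D.c a • D.pathProd X a (D.weight a - 1) := by
  have := h.triangle (D.bar a)
  rwa [H.f_bar, D.bar_bar] at this

lemma f_mul_loop : X (D.f a) * X (D.bar a) = D.c a • D.pathProd X (D.g a) (D.weight a - 1) := by
  have := h.triangle (D.f a)
  rwa [H.f_f, D.bar_f, D.c_g, D.weight_g] at this

lemma loop_mul_a_mul_g : X (D.bar a) * X a * X (D.g a) = 0 := by
  have := h.ffg (D.bar a)
  rw [H.f_bar, D.bar_bar] at this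
  exact this H.not_virtual_f fun h1 => H.not_virtual_f h1.1

lemma f_mul_loop_mul_loop : X (D.f a) * X (D.bar a) * X (D.bar a) = 0 := by
  have := h.ffg (D.f a)
  rw [D.f_cubed, H.f_f, H.g_bar] at this
  refine this H.not_virtual ?_
  rintro ⟨-, h1, h2⟩
  have h3 : D.weight (D.bar (D.f a)) = 3 := by rw [weight, h1, h2]
  rw [D.bar_f, D.weight_g] at h3
  have := H.four_le
  omega

lemma loop_mul_loop_mul_a : X (D.bar a) * X (D.bar a) * X a = 0 := by
  have := h.gfg (D.bar a)
  rw [H.g_bar, H.f_bar] at this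
  exact this H.not_virtual fun h1 => H.not_virtual_f h1.1

lemma a_mul_g_mul_f_g : X a * X (D.g a) * X (D.f (D.g a)) = 0 := by
  refine h.gfg a H.not_virtual_f ?_
  rintro ⟨-, h1, h2⟩
  have h3 : D.weight (D.f a) = 3 := by rw [weight, h1, h2]
  have := H.four_le
  rw [H.weight_f] at h3
  omega

/-- `A a` is a multiple of `bar a · a`, and its next arrow `f a` turns the factor `a` into a
multiple of `bar a`. -/
lemma pathProd_weight : D.pathProd X a (D.weight a) =
    ((D.c a)⁻¹ * D.c (D.bar a)) • (X (D.bar a) * X (D.bar a)) := by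
  have h4 := H.four_le
  have h1 : D.pathProd X a (D.weight a) = D.pathProd X a (D.weight a - 1) * X (D.f a) := by
    rw [← H.iterate_pred, ← pathProd_succ]
    congr 1
    omega
  have h2 : D.pathProd X a (D.weight a - 1) = (D.c a)⁻¹ • (X (D.bar a) * X a) := by
    rw [h.loop_mul_a H, inv_smul_smul₀ (D.c_ne_zero a)]
  rw [h1, h2, smul_mul_assoc, mul_assoc, h.mul_f_a H, mul_smul_comm, smul_smul]

/-- A full turn is a multiple of the square of `bar a`, which is killed by the next arrow `a`. -/
lemma pathProd_eq_zero {k : ℕ} (hk : D.weight a < k) : D.pathProd X a k = 0 := by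
  obtain ⟨l, rfl⟩ := Nat.exists_eq_add_of_le (Nat.succ_le_of_lt hk)
  rw [pathProd_add, Nat.succ_eq_add_one, pathProd_succ, D.iterate_weight, h.pathProd_weight H,
    smul_mul_assoc, h.loop_mul_loop_mul_a H, smul_zero, zero_mul]

/-- Leaving the `g`-cycle after at least two arrows gives zero. In the exceptional case of
`four_term` the product is a multiple of the path of length `w + k`, which is too long unless `k =
0`; then `f a` would be virtual. -/
lemma pathProd_mul_f (k : ℕ) :
    D.pathProd X a (k + 2) * X (D.f (D.g^[k + 1] a)) = 0 := by
  cases k with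
  | zero =>
    rw [pathProd_succ, pathProd_one]
    exact h.a_mul_g_mul_f_g H
  | succ k =>
    have hw := H.four_le
    have e : D.pathProd X a (k + 1 + 2) * X (D.f (D.g^[k + 1 + 1] a)) =
        D.pathProd X a k * (X (D.g^[k] a) * (X (D.g (D.g^[k] a)) * X (D.g (D.g (D.g^[k] a))) *
          X (D.f (D.g (D.g (D.g^[k] a)))))) := by
      rw [show k + 1 + 2 = k + 3 from rfl, pathProd_add]
      simp only [pathProd_three, D.g_iterate, mul_assoc]
    rw [e]
    rcases h.four_term (y := D.g^[k] a) (by rwa [D.weight_iterate])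
      (H.iterate_g_g_ne k) with h1 | ⟨h1, h2⟩
    · rw [h1, mul_zero]
    · obtain ⟨C, hC⟩ := h.mul_g_mul_f_of_virtual_f_f h1 h2
      rw [hC, mul_smul_comm, mul_smul_comm, ← mul_assoc, ← pathProd_succ, D.weight_g,
        D.weight_iterate, D.g_iterate, ← pathProd_add]
      cases k with
      | zero =>
        have := virtual_bar_of_virtual_f_f h1
        exact absurd ((D.bar_g a) ▸ this) H.not_virtual_f
      | succ k => rw [h.pathProd_eq_zero H (by omega), smul_zero]

/-! ### Paths starting at the end point of `a` -/

/-- Both full turns at the end point of `a` are, up to the same scalar, `f a · bar a · a`. -/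
lemma pathProd_f_weight :
    D.pathProd X (D.f a) (D.weight a) = D.pathProd X (D.g a) (D.weight a) := by
  have h4 := H.four_le
  obtain ⟨k, hk⟩ : ∃ k, D.weight a = k + 1 := ⟨D.weight a - 1, by omega⟩
  have h1 := h.loop_mul_a H
  have h2 := h.f_mul_loop H
  have h3 : D.g^[k] (D.g a) = a := by
    rw [D.iterate_g, ← hk, D.iterate_weight]
  rw [hk, Nat.add_sub_cancel] at h1 h2
  rw [hk, pathProd_succ', pathProd_succ, h3, H.g_f]
  refine (smul_right_injective R (D.c_ne_zero a)) ?_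
  change D.c a • _ = D.c a • _
  rw [← mul_smul_comm, ← h1, ← smul_mul_assoc, ← h2, mul_assoc]

lemma pathProd_f_eq_zero {k : ℕ} (hk : D.weight a < k) : D.pathProd X (D.f a) k = 0 := by
  obtain ⟨l, rfl⟩ := Nat.exists_eq_add_of_le (Nat.succ_le_of_lt hk)
  rw [pathProd_add, Nat.succ_eq_add_one, pathProd_succ', H.g_f, h.pathProd_weight H,
    mul_smul_comm, ← mul_assoc, h.f_mul_loop_mul_loop H, smul_zero, zero_mul]

lemma pathProd_g_eq_zero {k : ℕ} (hk : D.weight a < k) : D.pathProd X (D.g a) k = 0 := by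
  have h4 := H.four_le
  obtain ⟨l, rfl⟩ := Nat.exists_eq_add_of_le (Nat.succ_le_of_lt hk)
  have h1 : D.g^[D.weight a] (D.g a) = D.g a := by
    rw [← D.weight_g, D.iterate_weight]
  have h2 : D.pathProd X (D.g a) (D.weight a) =
      X (D.f a) * ((D.c a)⁻¹ • (X (D.bar a) * X a)) := by
    obtain ⟨k, hk⟩ : ∃ k, D.weight a = k + 1 := ⟨D.weight a - 1, by omega⟩
    rw [← h.pathProd_f_weight H, h.loop_mul_a H, inv_smul_smul₀ (D.c_ne_zero a), hk,
      Nat.add_sub_cancel, pathProd_succ', H.g_f]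
  rw [pathProd_add, Nat.succ_eq_add_one, pathProd_succ, h1, h2, mul_smul_comm, smul_mul_assoc,
    mul_assoc, h.loop_mul_a_mul_g H, mul_zero, smul_zero, zero_mul]

lemma g_mul_f_g : X (D.g a) * X (D.f (D.g a)) =
    D.c a • D.pathProd X (D.f a) (D.weight a - 1) := by
  rw [h.triangle, D.bar_g, H.c_f, H.weight_f]

-- This product survives exactly through the first exception, and its coefficient is the source of
-- the singular triangle condition.
open Classical in
lemma pathProd_g_two_mul_f : X (D.g a) * X (D.g (D.g a)) * X (D.f (D.g (D.g a))) =
    (if D.Virtual (D.f (D.g a)) then D.c (D.f (D.g a)) * D.c a else 0) •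
      D.pathProd X (D.f a) (D.weight a - 1) := by
  split_ifs with hA
  · rw [h.mul_g_mul_f_of_virtual hA, D.bar_g, H.c_f, H.weight_f]
  · rw [h.gfg _ hA, zero_smul]
    rintro ⟨h1, -⟩
    have := virtual_bar_of_virtual_f_f h1
    rw [D.bar_g] at this
    exact H.not_virtual_f this

/-- The argument is that of `pathProd_mul_f`. In the exceptional case with `k = 0`, the arrow `f (g
(g a))` would lie on the `g`-cycle of `a`, so its weight could not be three. -/
lemma pathProd_g_mul_f (k : ℕ) :
    D.pathProd X (D.g a) (k + 3) * X (D.f (D.g^[k + 3] a)) = 0 := by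
  have hw := H.four_le
  have e : D.pathProd X (D.g a) (k + 3) * X (D.f (D.g^[k + 3] a)) =
      D.pathProd X (D.g a) k * (X (D.g^[k + 1] a) * (X (D.g (D.g^[k + 1] a)) *
        X (D.g (D.g (D.g^[k + 1] a))) * X (D.f (D.g (D.g (D.g^[k + 1] a)))))) := by
    rw [pathProd_add]
    simp only [pathProd_three, D.g_iterate, D.iterate_g, mul_assoc]
  rw [e]
  rcases h.four_term (y := D.g^[k + 1] a) (by rwa [D.weight_iterate])
    (H.iterate_g_g_ne _) with h1 | ⟨h1, h2⟩
  · rw [h1, mul_zero]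
  · obtain ⟨C, hC⟩ := h.mul_g_mul_f_of_virtual_f_f h1 h2
    rw [hC, mul_smul_comm, mul_smul_comm, ← mul_assoc, ← D.iterate_g k a, ← pathProd_succ,
      D.weight_g, D.iterate_g k a, D.weight_iterate, D.g_iterate]
    cases k with
    | zero =>
      exfalso
      have h3 := (virtual_f_f_three_aux h1).2
      rw [D.bar_g] at h3
      change D.f (D.f (D.g a)) = _ at h3
      rw [H.f_f_g] at h3
      rw [← D.weight_g, ← h3, D.weight_iterate] at h2
      omega
    | succ k =>
      rw [← D.iterate_g (k + 1 + 1) a, ← pathProd_add, h.pathProd_g_eq_zero H (by omega),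
        smul_zero]

lemma pathProd_f_two_mul_f : X (D.f a) * X a * X (D.f a) =
    (D.c (D.bar a) * D.c a) • D.pathProd X (D.g a) (D.weight a - 1) := by
  rw [mul_assoc, h.mul_f_a H, mul_smul_comm, h.f_mul_loop H, smul_smul]

lemma pathProd_f_mul_f (k : ℕ) :
    D.pathProd X (D.f a) (k + 3) * X (D.f (D.g^[k + 1] a)) = 0 := by
  rw [pathProd_succ', H.g_f, mul_assoc, h.pathProd_mul_f H, mul_zero]

end RelSystem

end WeightedTriangulationQuiver

/-! ### The opposite quiver and the opposite relations. -/

namespace TriangulationQuiver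

variable {V : Type*} {E : Type*} (Q : TriangulationQuiver V E)

lemma g_surjective : Function.Surjective Q.g := fun b =>
  ⟨Q.f.symm (Q.bar b), by rw [← Q.bar_f, Equiv.apply_symm_apply, Q.bar_bar]⟩

/-- The opposite triangulation quiver. -/
def op : TriangulationQuiver V E where
  src := Q.tgt
  tgt := Q.src
  two_vertices := Q.two_vertices
  connected v w := by
    induction Q.connected v w with
    | rel x y h =>
      obtain ⟨b, hb⟩ := h
      exact .symm _ _ (.rel _ _ ⟨b, hb.2, hb.1⟩)
    | refl x => exact .refl x
    | symm x y _ ih => exact .symm _ _ ih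
    | trans x y z _ _ ih ih' => exact .trans _ _ _ ih ih'
  two_out := Q.two_in
  two_in := Q.two_out
  f := Q.f.symm
  src_f b := by rw [← Q.src_f, Equiv.apply_symm_apply]
  f_cubed b := by
    simp only [Equiv.symm_apply_eq]
    rw [Q.f_cubed]

lemma op_g_g (b : E) : Q.op.g (Q.g b) = b := by
  change Q.op.bar (Q.f.symm (Q.g b)) = b
  refine (Q.op.eq_bar_of_ne ?_ ?_).symm
  · change Q.tgt b = Q.tgt (Q.f.symm (Q.g b))
    rw [← Q.src_f (Q.f.symm _), Equiv.apply_symm_apply, src_g]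
  · intro h
    refine Q.f_ne_g b ?_
    conv_lhs => rw [h]
    exact Equiv.apply_symm_apply _ _

lemma g_op_g (b : E) : Q.g (Q.op.g b) = b := by
  obtain ⟨b, rfl⟩ := Q.g_surjective b
  rw [op_g_g]

lemma op_n (b : E) : Q.op.n b = Q.n b := by
  refine Function.minimalPeriod_eq_minimalPeriod_iff.2 fun k => ?_
  have h1 : Function.LeftInverse Q.op.g^[k] Q.g^[k] := Function.LeftInverse.iterate Q.op_g_g k
  have h2 : Function.LeftInverse Q.g^[k] Q.op.g^[k] := Function.LeftInverse.iterate Q.g_op_g k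
  exact ⟨fun h => (congrArg _ (id h : _ = _)).symm.trans (h2 b),
    fun h => (congrArg _ (id h : _ = _)).symm.trans (h1 b)⟩

/-- An arrow two steps before `bar b` on its `g`-cycle is the last arrow of `A (bar b)`, hence the
first arrow of the reversed path. -/
lemma op_bar_f {y b : E} (h : Q.g (Q.g y) = Q.bar b) : Q.op.bar (Q.f b) = y := by
  have h1 : Q.f (Q.g y) = b := by
    rw [Q.f_eq_bar_of_g_eq h, Q.bar_bar]
  have h2 : Q.g y = Q.f (Q.f b) := by rw [← h1, Q.f_cubed]
  refine (Q.op.eq_bar_of_ne ?_ ?_).symm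
  · change Q.tgt y = Q.tgt (Q.f b)
    rw [← Q.src_g, h2, Q.src_f]
  · rintro rfl
    exact Q.f_ne_g _ h2.symm

lemma g_f_symm_g (b : E) : Q.g (Q.f.symm (Q.g b)) = Q.f b := by
  rw [← bar_f, Equiv.apply_symm_apply, bar_g]

lemma g_f_f (b : E) : Q.g (Q.f (Q.f b)) = Q.bar b := by
  rw [← bar_f, Q.f_cubed]

lemma g_g_g_of_n_eq {b : E} (h : Q.n b = 3) : Q.g (Q.g (Q.g b)) = b := by
  have := Function.iterate_minimalPeriod (f := Q.g) (x := b)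
  rw [show Function.minimalPeriod Q.g b = 3 from h] at this
  exact this

end TriangulationQuiver

namespace WeightedTriangulationQuiver

variable {K : Type*} [Field K] {V : Type*} {E : Type*} (D : WeightedTriangulationQuiver K V E)

/-- The opposite weighted triangulation quiver. -/
def op : WeightedTriangulationQuiver K V E where
  toTriangulationQuiver := D.toTriangulationQuiver.op
  m := D.m
  m_pos := D.m_pos
  m_g b := by rw [← D.m_g, D.g_op_g]
  c := D.c
  c_ne_zero := D.c_ne_zero
  c_g b := by rw [← D.c_g, D.g_op_g]

lemma op_weight (b : E) : D.op.weight b = D.weight b :=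
  congrArg (D.m b * ·) (D.op_n b)

lemma op_virtual {b : E} : D.op.Virtual b ↔ D.Virtual b := by
  rw [virtual_iff, op_weight, virtual_iff]

variable {D}

lemma virtual_of_g_eq {b b' : E} (h : D.g b = b') : D.Virtual b ↔ D.Virtual b' := by
  rw [← h, virtual_iff, virtual_iff, D.weight_g]

lemma NearVirtualLoop.op {a : E} (H : D.NearVirtualLoop a) : D.op.NearVirtualLoop (D.f a) := by
  have hb : D.op.bar (D.f a) = D.bar a := by
    refine D.op_bar_f ?_
    rw [H.g_bar, H.g_bar]
  refine ⟨fun b => ?_, ?_, ?_, ?_⟩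
  · rw [op_weight]; exact H.two_le b
  · rw [hb]
    change D.f.symm _ = _
    rw [← H.f_f, Equiv.symm_apply_apply]
  · rw [hb, op_virtual]; exact H.virtual
  · rw [op_weight, H.weight_f]; exact H.four_le

lemma op_pathProd {R : Type*} [Ring R] (X : E → R) (b : E) (k : ℕ) :
    D.op.pathProd (fun b => MulOpposite.op (X b)) (D.g^[k] b) (k + 1) =
      MulOpposite.op (D.pathProd X b (k + 1)) := by
  induction k with
  | zero => rw [pathProd_one, pathProd_one]; rfl
  | succ k ih =>
    have : D.op.g (D.g^[k + 1] b) = D.g^[k] b := by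
      rw [← D.g_iterate]
      exact D.op_g_g _
    rw [pathProd_succ', this, ih, ← MulOpposite.op_mul, ← pathProd_succ]

variable [Fintype V] {R : Type*} [Ring R] [Algebra K R]

/-- Reversal sends triangle relations to triangle relations and interchanges the families `ffg` and
`gfg`. The exceptions correspond because weights and virtuality are constant on `g`-cycles. -/
lemma RelSystem.op (two_le : ∀ b, 2 ≤ D.weight b) {ε : V → R} {X : E → R}
    (h : D.RelSystem ε X) :
    D.op.RelSystem (fun v => MulOpposite.op (ε v)) (fun b => MulOpposite.op (X b)) where
  idem v := by rw [← MulOpposite.op_mul, h.idem]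
  orth v w hvw := by rw [← MulOpposite.op_mul, h.orth _ _ hvw.symm, MulOpposite.op_zero]
  sum_eq_one := by rw [← Finset.op_sum, h.sum_eq_one, MulOpposite.op_one]
  src_mul b := by
    rw [← MulOpposite.op_mul]
    exact congrArg _ (h.mul_tgt b)
  mul_tgt b := by
    rw [← MulOpposite.op_mul]
    exact congrArg _ (h.src_mul b)
  triangle b := by
    obtain ⟨d, rfl⟩ := D.f.surjective b
    obtain ⟨k, hk⟩ : ∃ k, D.weight (D.bar d) = k + 2 :=
      ⟨D.weight (D.bar d) - 2, by have := two_le (D.bar d); omega⟩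
    have hy : D.op.bar (D.f d) = D.g^[k] (D.bar d) := by
      refine D.op_bar_f ?_
      have := D.iterate_weight (D.bar d)
      rw [hk] at this
      rwa [D.g_iterate, D.g_iterate]
    have hf : D.op.f (D.f d) = d := D.f.symm_apply_apply d
    have hc : D.op.c (D.g^[k] (D.bar d)) = D.c (D.bar d) := D.c_iterate _ _
    rw [hy, hf, op_weight, D.weight_iterate, hk, hc, ← MulOpposite.op_mul, h.triangle, hk,
      MulOpposite.op_smul]
    exact congrArg _ (op_pathProd X (D.bar d) k).symm
  ffg b h₁ h₂ := by
    obtain ⟨d, rfl⟩ := D.f.surjective b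
    obtain ⟨z, rfl⟩ := D.g_surjective d
    have hf : D.op.f (D.f (D.g z)) = D.g z := D.f.symm_apply_apply _
    have hg : D.op.g (D.g z) = z := D.op_g_g z
    rw [hf, hg, ← MulOpposite.op_mul, ← MulOpposite.op_mul, ← mul_assoc, h.gfg,
      MulOpposite.op_zero]
    · rw [hf, op_virtual] at h₁
      refine fun h3 => h₁ ?_
      exact (virtual_of_g_eq (D.g_f_symm_g z)).2 h3
    -- Cycle length three identifies the opposite `bar` of `f (g z)` with `g (f z)`.
    · rintro ⟨h3, h4, h5⟩
      have hy : D.op.bar (D.f (D.g z)) = D.g (D.f z) :=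
        D.op_bar_f (by rw [D.g_g_g_of_n_eq h5, D.bar_g])
      rw [hy, op_virtual] at h₂
      refine h₂ ⟨(virtual_of_g_eq (D.g_f_symm_g _)).2 h3, (D.m_g _).trans h4, ?_⟩
      exact (D.op_n _).trans ((D.n_g _).trans h5)
  gfg b h₁ h₂ := by
    obtain ⟨d, rfl⟩ := D.g_surjective b
    obtain ⟨z, rfl⟩ := D.f.surjective d
    have hf : D.op.f (D.f z) = z := D.f.symm_apply_apply _
    have hg : D.op.g (D.g (D.f z)) = D.f z := D.op_g_g _
    have h6 := D.g_f_symm_g (D.f z)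
    rw [hg, hf, ← MulOpposite.op_mul, ← MulOpposite.op_mul, ← mul_assoc, h.ffg,
      MulOpposite.op_zero]
    · rw [op_virtual] at h₁
      exact fun h3 => h₁ ((virtual_of_g_eq h6).2 h3)
    · rintro ⟨h3, h4, h5⟩
      have h7 : D.g (D.g (D.f.symm (D.g (D.f z)))) = D.bar z := by rw [h6, D.g_f_f]
      have h8 : D.f.symm (D.g (D.f z)) = D.g (D.bar z) := by
        apply D.g_injective
        apply D.g_injective
        rw [h7, D.g_g_g_of_n_eq h5]
      have h9 : D.op.f (D.g (D.f z)) = D.g (D.bar z) := h8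
      rw [op_virtual, h9] at h₂
      refine h₂ ⟨(virtual_of_g_eq (D.g_f_symm_g _)).2 h3, (D.m_g _).trans h4, ?_⟩
      exact (D.op_n _).trans ((D.n_g _).trans h5)

end WeightedTriangulationQuiver

/-! ### Filtrations by length and upper bounds for dimensions. -/

namespace WeightedTriangulationQuiver

variable {K : Type*} [Field K] {V : Type*} {E : Type*} {D : WeightedTriangulationQuiver K V E}
  [Fintype V] {R : Type*} [Ring R] [Algebra K R]

omit [Fintype V] in
lemma tgt_bar_a {a : E} (H : D.NearVirtualLoop a) : D.tgt (D.bar a) = D.src a := by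
  rw [← D.src_f, H.f_bar]

/-- A filtration of `ε v * R` which increases under multiplication by arrows and is finally
zero. -/
structure ArrowFiltration (D : WeightedTriangulationQuiver K V E) (ε : V → R) (X : E → R)
    (v : V) (N : ℕ) (G : ℕ → Submodule K R) : Prop where
  mem_zero : ε v ∈ G 0
  mul_vertex : ∀ k y u, y ∈ G k → y * ε u ∈ G k
  mul_arrow : ∀ k y b, y ∈ G k → y * X b ∈ G (k + 1)
  succ_le : ∀ k, G (k + 1) ≤ G k
  eq_bot : G N = ⊥

namespace ArrowFiltration

variable {ε : V → R} {X : E → R} {v : V} {N : ℕ} {G : ℕ → Submodule K R}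
  (F : D.ArrowFiltration ε X v N G)
include F

omit [Fintype V] in
lemma mul_mem (hadj : Algebra.adjoin K (Set.range ε ∪ Set.range X) = ⊤) {k : ℕ} {y : R}
    (hy : y ∈ G k) (r : R) : y * r ∈ G k := by
  have hr : r ∈ Algebra.adjoin K (Set.range ε ∪ Set.range X) := hadj ▸ Algebra.mem_top
  induction hr using Algebra.adjoin_induction generalizing y with
  | mem x hx =>
    rcases hx with ⟨u, rfl⟩ | ⟨b, rfl⟩
    · exact F.mul_vertex _ _ _ hy
    · exact F.succ_le _ (F.mul_arrow _ _ _ hy)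
  | algebraMap c =>
    rw [← Algebra.commutes, ← Algebra.smul_def]
    exact Submodule.smul_mem _ _ hy
  | add r s _ _ hr hs => rw [mul_add]; exact add_mem (hr hy) (hs hy)
  | mul r s _ _ hr hs => rw [← mul_assoc]; exact hs (hr hy)

omit [Fintype V] in
lemma vertex_mul_mem (hadj : Algebra.adjoin K (Set.range ε ∪ Set.range X) = ⊤) (r : R) :
    ε v * r ∈ G 0 := F.mul_mem hadj F.mem_zero r

end ArrowFiltration

namespace RelSystem

variable {ε : V → R} {X : E → R} (h : D.RelSystem ε X) 
include h

lemma vertex_mul_arr_cases (b b' : E) :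
    ε (D.src b) * X b' = 0 ∨ b' = b ∨ b' = D.bar b := by
  by_cases hb : D.src b' = D.src b
  · exact Or.inr (D.eq_or_eq_bar hb)
  · exact Or.inl (h.mul_src_of_ne (Ne.symm hb))

lemma arr_mul_arr_cases (b b' : E) : X b * X b' = 0 ∨ b' = D.f b ∨ b' = D.g b := by
  by_cases hb : D.src b' = D.tgt b
  · rw [← D.src_f] at hb
    exact Or.inr (D.eq_or_eq_bar hb)
  · exact Or.inl (h.mul_of_ne (Ne.symm hb))

lemma pathProd_succ_mul_cases (b b' : E) (k : ℕ) : D.pathProd X b (k + 1) * X b' = 0 ∨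
    b' = D.f (D.g^[k] b) ∨ b' = D.g^[k + 1] b := by
  rw [pathProd_succ, mul_assoc, ← D.g_iterate]
  rcases h.arr_mul_arr_cases (D.g^[k] b) b' with h1 | h1
  · exact Or.inl (by rw [h1, mul_zero])
  · exact Or.inr h1

lemma arr_mul_vertex_cases (b : E) (u : V) : X b * ε u = 0 ∨ X b * ε u = X b := by
  by_cases hb : D.tgt b = u
  · exact Or.inr (hb ▸ h.mul_tgt b)
  · exact Or.inl (h.mul_tgt_of_ne hb)

lemma pathProd_mul_vertex_cases (v u : V) (b : E) (k : ℕ) :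
    ε v * D.pathProd X b k * ε u = 0 ∨
      ε v * D.pathProd X b k * ε u = ε v * D.pathProd X b k := by
  cases k with
  | zero =>
    rw [pathProd_zero, mul_one]
    by_cases hu : v = u
    · exact Or.inr (hu ▸ h.idem v)
    · exact Or.inl (h.orth _ _ hu)
  | succ k =>
    rw [pathProd_succ, mul_assoc, mul_assoc]
    rcases h.arr_mul_vertex_cases (D.g^[k] b) u with h1 | h1
    · exact Or.inl (by rw [h1, mul_zero, mul_zero])
    · exact Or.inr (by rw [h1])

variable {a : E} (H : D.NearVirtualLoop a) 

/-- The filtration by length of the right ideal generated by the vertex of the virtual loop. -/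
def srcFiltration (_ : D.RelSystem ε X) (a : E) (k : ℕ) : Submodule K R :=
  Submodule.span K ({y | ∃ l, k ≤ l ∧ y = ε (D.src a) * D.pathProd X a l} ∪
    -- The virtual loop is a multiple of the path `a · f a`, hence it has degree two.
    {y | k ≤ 2 ∧ y = X (D.bar a)})

lemma mem_srcFiltration {k l : ℕ} (hkl : k ≤ l) :
    ε (D.src a) * D.pathProd X a l ∈ h.srcFiltration a k :=
  Submodule.subset_span (Or.inl ⟨l, hkl, rfl⟩)

lemma mem_srcFiltration_succ {k l : ℕ} (hkl : k ≤ l + 1) :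
    D.pathProd X a (l + 1) ∈ h.srcFiltration a k := by
  rw [← h.src_mul_pathProd]
  exact h.mem_srcFiltration hkl

lemma bar_mem_srcFiltration {k : ℕ} (hk : k ≤ 2) : X (D.bar a) ∈ h.srcFiltration a k :=
  Submodule.subset_span (Or.inr ⟨hk, rfl⟩)

include H

/-- An arrow either continues the `g`-cycle or gives a multiple of `bar a`, of a path of length at
least `w - 1`, or zero. The bound `w ≥ 4` makes the degree of `bar a · a` exceed that of `bar a`. -/
lemma arrowFiltration_src :
    D.ArrowFiltration ε X (D.src a) (D.weight a + 1) (h.srcFiltration a) where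
  mem_zero := by simpa using h.mem_srcFiltration (a := a) (le_refl 0)
  mul_vertex k y u hy := by
    suffices h.srcFiltration a k ≤ (h.srcFiltration a k).comap (LinearMap.mulRight K (ε u)) from
      this hy
    refine Submodule.span_le.2 ?_
    rintro _ (⟨l, hl, rfl⟩ | ⟨hk, rfl⟩) <;>
      simp only [Submodule.comap_coe, Set.mem_preimage, LinearMap.mulRight_apply, SetLike.mem_coe]
    · rcases h.pathProd_mul_vertex_cases (D.src a) u a l with h1 | h1 <;> rw [h1]
      · exact zero_mem _
      · exact h.mem_srcFiltration hl
    · rcases h.arr_mul_vertex_cases (D.bar a) u with h1 | h1 <;> rw [h1]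
      · exact zero_mem _
      · exact h.bar_mem_srcFiltration hk
  mul_arrow k y b hy := by
    have h4 := H.four_le
    suffices h.srcFiltration a k ≤
        (h.srcFiltration a (k + 1)).comap (LinearMap.mulRight K (X b)) from this hy
    refine Submodule.span_le.2 ?_
    rintro _ (⟨l, hl, rfl⟩ | ⟨hk, rfl⟩) <;>
      simp only [Submodule.comap_coe, Set.mem_preimage, LinearMap.mulRight_apply, SetLike.mem_coe]
    · match l with
      | 0 =>
        rw [pathProd_zero, mul_one]
        rcases h.vertex_mul_arr_cases a b with h1 | rfl | rfl
        · rw [h1]; exact zero_mem _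
        · rw [h.src_mul, ← D.pathProd_one X b]
          exact h.mem_srcFiltration_succ (by omega)
        · rw [← D.src_bar, h.src_mul]
          exact h.bar_mem_srcFiltration (by omega)
      | l + 1 =>
        rw [h.src_mul_pathProd]
        rcases h.pathProd_succ_mul_cases a b l with h1 | rfl | rfl
        · rw [h1]; exact zero_mem _
        · match l with
          | 0 =>
            rw [pathProd_one]
            change X a * X (D.f a) ∈ _
            rw [h.mul_f_a H]
            exact Submodule.smul_mem _ _ (h.bar_mem_srcFiltration (by omega))
          | l + 1 => rw [h.pathProd_mul_f H]; exact zero_mem _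
        · rw [← pathProd_succ]
          exact h.mem_srcFiltration_succ (by omega)
    · rcases h.arr_mul_arr_cases (D.bar a) b with h1 | h1 | h1
      · rw [h1]; exact zero_mem _
      · rw [h1, H.f_bar, h.loop_mul_a H]
        obtain ⟨l, hl⟩ : ∃ l, D.weight a - 1 = l + 1 := ⟨D.weight a - 2, by omega⟩
        rw [hl]
        exact Submodule.smul_mem _ _ (h.mem_srcFiltration_succ (by omega))
      · have h2 : X (D.bar a) * X (D.bar a) =
            ((D.c a)⁻¹ * D.c (D.bar a))⁻¹ • D.pathProd X a (D.weight a) := by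
          rw [h.pathProd_weight H, inv_smul_smul₀]
          exact mul_ne_zero (inv_ne_zero (D.c_ne_zero _)) (D.c_ne_zero _)
        obtain ⟨l, hl⟩ : ∃ l, D.weight a = l + 1 := ⟨D.weight a - 1, by omega⟩
        rw [h1, H.g_bar, h2, hl]
        exact Submodule.smul_mem _ _ (h.mem_srcFiltration_succ (by omega))
  succ_le k := by
    refine Submodule.span_mono ?_
    rintro _ (⟨l, hl, rfl⟩ | ⟨hk, rfl⟩)
    · exact Or.inl ⟨l, by omega, rfl⟩
    · exact Or.inr ⟨by omega, rfl⟩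
  eq_bot := by
    have h4 := H.four_le
    refine Submodule.span_eq_bot.2 ?_
    rintro _ (⟨l, hl, rfl⟩ | ⟨hk, rfl⟩)
    · rw [h.pathProd_eq_zero H (by omega), mul_zero]
    · omega

lemma srcFiltration_zero_le : h.srcFiltration a 0 ≤
    open Classical in
    Submodule.span K ((insert (X (D.bar a)) ((Finset.range (D.weight a + 1)).image
      fun l => ε (D.src a) * D.pathProd X a l) : Finset R) : Set R) := by
  classical
  refine Submodule.span_le.2 ?_
  rintro _ (⟨l, hl, rfl⟩ | ⟨hk, rfl⟩)
  · by_cases hl : l < D.weight a + 1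
    · refine Submodule.subset_span ?_
      rw [Finset.mem_coe]
      exact Finset.mem_insert_of_mem (Finset.mem_image.2 ⟨l, Finset.mem_range.2 hl, rfl⟩)
    · rw [h.pathProd_eq_zero H (by omega), mul_zero]; exact zero_mem _
  · exact Submodule.subset_span (Finset.mem_coe.2 (Finset.mem_insert_self _ _))

lemma finiteDimensional_srcFiltration : FiniteDimensional K (h.srcFiltration a 0) := by
  classical
  have := FiniteDimensional.span_finset K (insert (X (D.bar a))
    ((Finset.range (D.weight a + 1)).image fun l => ε (D.src a) * D.pathProd X a l))
  exact Submodule.finiteDimensional_of_le (h.srcFiltration_zero_le H)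

lemma finrank_srcFiltration_le :
    Module.finrank K (h.srcFiltration a 0) ≤ D.weight a + 2 := by
  classical
  have := FiniteDimensional.span_finset K (insert (X (D.bar a))
    ((Finset.range (D.weight a + 1)).image fun l => ε (D.src a) * D.pathProd X a l))
  refine (Submodule.finrank_mono (h.srcFiltration_zero_le H)).trans ?_
  refine (finrank_span_finset_le_card _).trans ?_
  refine (Finset.card_insert_le _ _).trans (Nat.succ_le_succ ?_)
  exact Finset.card_image_le.trans (by simp)

omit H

/-- The filtration by length of the right ideal generated by the end point of `a`. -/
def tgtFiltration (_ : D.RelSystem ε X) (a : E) (k : ℕ) : Submodule K R :=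
  Submodule.span K ({y | ∃ l, k ≤ l ∧ y = ε (D.tgt a) * D.pathProd X (D.g a) l} ∪
    {y | ∃ l, k ≤ l ∧ y = ε (D.tgt a) * D.pathProd X (D.f a) l})

lemma g_mem_tgtFiltration {k l : ℕ} (hkl : k ≤ l) :
    ε (D.tgt a) * D.pathProd X (D.g a) l ∈ h.tgtFiltration a k :=
  Submodule.subset_span (Or.inl ⟨l, hkl, rfl⟩)

lemma f_mem_tgtFiltration {k l : ℕ} (hkl : k ≤ l) :
    ε (D.tgt a) * D.pathProd X (D.f a) l ∈ h.tgtFiltration a k :=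
  Submodule.subset_span (Or.inr ⟨l, hkl, rfl⟩)

lemma tgt_mul_pathProd_g (k : ℕ) :
    ε (D.tgt a) * D.pathProd X (D.g a) (k + 1) = D.pathProd X (D.g a) (k + 1) := by
  rw [← D.src_g, h.src_mul_pathProd]

lemma tgt_mul_pathProd_f (k : ℕ) :
    ε (D.tgt a) * D.pathProd X (D.f a) (k + 1) = D.pathProd X (D.f a) (k + 1) := by
  rw [← D.src_f, h.src_mul_pathProd]

lemma g_mem_tgtFiltration_succ {k l : ℕ} (hkl : k ≤ l + 1) :
    D.pathProd X (D.g a) (l + 1) ∈ h.tgtFiltration a k := by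
  rw [← h.tgt_mul_pathProd_g]
  exact h.g_mem_tgtFiltration hkl

lemma f_mem_tgtFiltration_succ {k l : ℕ} (hkl : k ≤ l + 1) :
    D.pathProd X (D.f a) (l + 1) ∈ h.tgtFiltration a k := by
  rw [← h.tgt_mul_pathProd_f]
  exact h.f_mem_tgtFiltration hkl

lemma g_mem_tgtFiltration_pred {k l : ℕ} (hl : 2 ≤ l) (hkl : k + 1 ≤ l) :
    D.pathProd X (D.g a) (l - 1) ∈ h.tgtFiltration a k := by
  obtain ⟨l, rfl⟩ : ∃ l', l = l' + 2 := ⟨l - 2, by omega⟩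
  exact h.g_mem_tgtFiltration_succ (by omega)

lemma f_mem_tgtFiltration_pred {k l : ℕ} (hl : 2 ≤ l) (hkl : k + 1 ≤ l) :
    D.pathProd X (D.f a) (l - 1) ∈ h.tgtFiltration a k := by
  obtain ⟨l, rfl⟩ : ∃ l', l = l' + 2 := ⟨l - 2, by omega⟩
  exact h.f_mem_tgtFiltration_succ (by omega)

include H

/-- Leaving one `g`-cycle after one or two arrows produces a multiple of a path of length `w - 1` on
the other, and `w ≥ 4` makes this raise the degree. Leaving it later gives zero. -/
lemma arrowFiltration_tgt :
    D.ArrowFiltration ε X (D.tgt a) (D.weight a + 1) (h.tgtFiltration a) where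
  mem_zero := by simpa using h.g_mem_tgtFiltration (a := a) (le_refl 0)
  mul_vertex k y u hy := by
    suffices h.tgtFiltration a k ≤ (h.tgtFiltration a k).comap (LinearMap.mulRight K (ε u)) from
      this hy
    refine Submodule.span_le.2 ?_
    rintro _ (⟨l, hl, rfl⟩ | ⟨l, hl, rfl⟩) <;>
      simp only [Submodule.comap_coe, Set.mem_preimage, LinearMap.mulRight_apply, SetLike.mem_coe]
    · rcases h.pathProd_mul_vertex_cases (D.tgt a) u (D.g a) l with h1 | h1 <;> rw [h1]
      · exact zero_mem _
      · exact h.g_mem_tgtFiltration hl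
    · rcases h.pathProd_mul_vertex_cases (D.tgt a) u (D.f a) l with h1 | h1 <;> rw [h1]
      · exact zero_mem _
      · exact h.f_mem_tgtFiltration hl
  mul_arrow k y b hy := by
    have h4 := H.four_le
    have hvert : k = 0 → ε (D.tgt a) * X b ∈ h.tgtFiltration a (k + 1) := by
      rintro rfl
      rw [← D.src_g]
      rcases h.vertex_mul_arr_cases (D.g a) b with h1 | rfl | rfl
      · rw [h1]; exact zero_mem _
      · rw [h.src_mul, ← D.pathProd_one X (D.g a)]
        exact h.g_mem_tgtFiltration_succ (by omega)
      · rw [← D.src_bar, h.src_mul, D.bar_g, ← D.pathProd_one X (D.f a)]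
        exact h.f_mem_tgtFiltration_succ (by omega)
    suffices h.tgtFiltration a k ≤
        (h.tgtFiltration a (k + 1)).comap (LinearMap.mulRight K (X b)) from this hy
    refine Submodule.span_le.2 ?_
    rintro _ (⟨l, hl, rfl⟩ | ⟨l, hl, rfl⟩) <;>
      simp only [Submodule.comap_coe, Set.mem_preimage, LinearMap.mulRight_apply, SetLike.mem_coe]
    · match l with
      | 0 =>
        rw [pathProd_zero, mul_one]
        exact hvert (by omega)
      | l + 1 =>
        rw [h.tgt_mul_pathProd_g]
        rcases h.pathProd_succ_mul_cases (D.g a) b l with h1 | rfl | rfl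
        · rw [h1]; exact zero_mem _
        · match l with
          | 0 =>
            rw [pathProd_one]
            change X (D.g a) * X (D.f (D.g a)) ∈ _
            rw [h.g_mul_f_g H]
            exact Submodule.smul_mem _ _ (h.f_mem_tgtFiltration_pred (by omega) (by omega))
          | 1 =>
            rw [pathProd_succ, pathProd_one]
            change X (D.g a) * X (D.g (D.g a)) * X (D.f (D.g (D.g a))) ∈ _
            rw [h.pathProd_g_two_mul_f H]
            exact Submodule.smul_mem _ _ (h.f_mem_tgtFiltration_pred (by omega) (by omega))
          | l + 2 =>
            rw [D.iterate_g, h.pathProd_g_mul_f H]; exact zero_mem _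
        · rw [← pathProd_succ]
          exact h.g_mem_tgtFiltration_succ (by omega)
    · match l with
      | 0 =>
        rw [pathProd_zero, mul_one]
        exact hvert (by omega)
      | l + 1 =>
        rw [h.tgt_mul_pathProd_f]
        rcases h.pathProd_succ_mul_cases (D.f a) b l with h1 | rfl | rfl
        · rw [h1]; exact zero_mem _
        · match l with
          | 0 =>
            rw [pathProd_one]
            change X (D.f a) * X (D.f (D.f a)) ∈ _
            rw [H.f_f, h.f_mul_loop H]
            exact Submodule.smul_mem _ _ (h.g_mem_tgtFiltration_pred (by omega) (by omega))
          | 1 =>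
            rw [pathProd_succ, pathProd_one]
            change X (D.f a) * X (D.g (D.f a)) * X (D.f (D.g (D.f a))) ∈ _
            rw [H.g_f, h.pathProd_f_two_mul_f H]
            exact Submodule.smul_mem _ _ (h.g_mem_tgtFiltration_pred (by omega) (by omega))
          | l + 2 =>
            rw [← D.iterate_g (l + 1), H.g_f, h.pathProd_f_mul_f H]; exact zero_mem _
        · rw [← pathProd_succ]
          exact h.f_mem_tgtFiltration_succ (by omega)
  succ_le k := by
    refine Submodule.span_mono ?_
    rintro _ (⟨l, hl, rfl⟩ | ⟨l, hl, rfl⟩)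
    · exact Or.inl ⟨l, by omega, rfl⟩
    · exact Or.inr ⟨l, by omega, rfl⟩
  eq_bot := by
    refine Submodule.span_eq_bot.2 ?_
    rintro _ (⟨l, hl, rfl⟩ | ⟨l, hl, rfl⟩)
    · rw [h.pathProd_g_eq_zero H (by omega), mul_zero]
    · rw [h.pathProd_f_eq_zero H (by omega), mul_zero]

/-- The two families share their members of length `0` and `w`, which leaves `(w + 1) + (w - 1) =
2w` spanning elements. -/
lemma tgtFiltration_zero_le : h.tgtFiltration a 0 ≤
    open Classical in
    Submodule.span K (((Finset.range (D.weight a + 1)).image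
        (fun l => ε (D.tgt a) * D.pathProd X (D.g a) l) ∪
      (Finset.range (D.weight a - 1)).image (fun l => D.pathProd X (D.f a) (l + 1)) :
        Finset R) : Set R) := by
  classical
  have h4 := H.four_le
  refine Submodule.span_le.2 ?_
  rintro _ (⟨l, hl, rfl⟩ | ⟨l, hl, rfl⟩)
  · by_cases hl : l < D.weight a + 1
    · refine Submodule.subset_span ?_
      rw [Finset.mem_coe]
      exact Finset.mem_union_left _ (Finset.mem_image.2 ⟨l, Finset.mem_range.2 hl, rfl⟩)
    · rw [h.pathProd_g_eq_zero H (by omega), mul_zero]; exact zero_mem _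
  · match l with
    | 0 =>
      refine Submodule.subset_span (Finset.mem_coe.2 (Finset.mem_union_left _ ?_))
      exact Finset.mem_image.2 ⟨0, Finset.mem_range.2 (by omega), rfl⟩
    | l + 1 =>
      rcases lt_trichotomy (l + 1) (D.weight a) with hl | hl | hl
      · refine Submodule.subset_span (Finset.mem_coe.2 (Finset.mem_union_right _ ?_))
        rw [h.tgt_mul_pathProd_f]
        exact Finset.mem_image.2 ⟨l, Finset.mem_range.2 (by omega), rfl⟩
      · refine Submodule.subset_span (Finset.mem_coe.2 (Finset.mem_union_left _ ?_))
        rw [hl, h.pathProd_f_weight H]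
        exact Finset.mem_image.2 ⟨D.weight a, Finset.mem_range.2 (by omega), rfl⟩
      · rw [h.pathProd_f_eq_zero H hl, mul_zero]; exact zero_mem _

lemma finiteDimensional_tgtFiltration : FiniteDimensional K (h.tgtFiltration a 0) := by
  classical
  have := FiniteDimensional.span_finset K ((Finset.range (D.weight a + 1)).image
        (fun l => ε (D.tgt a) * D.pathProd X (D.g a) l) ∪
      (Finset.range (D.weight a - 1)).image (fun l => D.pathProd X (D.f a) (l + 1)))
  exact Submodule.finiteDimensional_of_le (h.tgtFiltration_zero_le H)

lemma finrank_tgtFiltration_le :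
    Module.finrank K (h.tgtFiltration a 0) ≤ 2 * D.weight a := by
  classical
  have h4 := H.four_le
  have := FiniteDimensional.span_finset K ((Finset.range (D.weight a + 1)).image
        (fun l => ε (D.tgt a) * D.pathProd X (D.g a) l) ∪
      (Finset.range (D.weight a - 1)).image (fun l => D.pathProd X (D.f a) (l + 1)))
  refine (Submodule.finrank_mono (h.tgtFiltration_zero_le H)).trans ?_
  refine (finrank_span_finset_le_card _).trans ?_
  refine (Finset.card_union_le _ _).trans ?_
  refine (add_le_add Finset.card_image_le Finset.card_image_le).trans ?_
  rw [Finset.card_range, Finset.card_range]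
  omega

end RelSystem

end WeightedTriangulationQuiver

/-! ### Two explicit representations, which provide the linear independence of paths. -/

namespace WeightedTriangulationQuiver

variable {K : Type*} [Field K] {V : Type*} {E : Type*} (D : WeightedTriangulationQuiver K V E)

section Action

variable {I : Type*} (vtx : I → V) (act : E → I → (I →₀ K))

/-- The linear extension of an action of the arrows on basis vectors. -/
def actLin (b : E) : (I →₀ K) →ₗ[K] (I →₀ K) := Finsupp.linearCombination K (act b)

variable {act} in
@[simp] lemma actLin_single (b : E) (y : I) (r : K) :
    actLin act b (Finsupp.single y r) = r • act b y :=
  Finsupp.linearCombination_single _ _ _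

open Classical in
/-- The projection to the span of the basis vectors at a vertex. -/
def vtxProj (v : V) : (I →₀ K) →ₗ[K] (I →₀ K) :=
  Finsupp.linearCombination K fun y => if vtx y = v then Finsupp.single y 1 else 0

lemma vtxProj_single_of_eq {v : V} {y : I} (h : vtx y = v) (r : K) :
    vtxProj vtx v (Finsupp.single y r) = Finsupp.single y r := by
  simp [vtxProj, Finsupp.linearCombination_single, h]

lemma vtxProj_single_of_ne {v : V} {y : I} (h : vtx y ≠ v) (r : K) :
    vtxProj vtx v (Finsupp.single y r) = 0 := by
  simp [vtxProj, Finsupp.linearCombination_single, h]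

/-- The action of the path of length `k` along the `g`-cycle of an arrow. -/
def pathAct (act : E → I → (I →₀ K)) : E → ℕ → (I →₀ K) →ₗ[K] (I →₀ K)
  | _, 0 => LinearMap.id
  | b, k + 1 => pathAct act (D.g b) k ∘ₗ actLin act b

variable {act} in
lemma pathAct_succ_single (b : E) (k : ℕ) (y : I) :
    D.pathAct act b (k + 1) (Finsupp.single y 1) = D.pathAct act (D.g b) k (act b y) := by
  simp [pathAct]

variable {act} in
lemma pathAct_eq_zero {b : E} {k : ℕ} (hk : 1 ≤ k) {y : I} (h : act b y = 0) :
    D.pathAct act b k (Finsupp.single y 1) = 0 := by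
  obtain ⟨k, rfl⟩ := Nat.exists_eq_add_of_le' hk
  rw [pathAct_succ_single, h, map_zero]

/-- Endomorphisms compose from right to left and paths from left to right, so right modules
correspond to systems in the opposite endomorphism ring. -/
lemma pathProd_op_actLin (b : E) (k : ℕ) :
    D.pathProd (fun b => MulOpposite.op (actLin act b : Module.End K (I →₀ K))) b k =
      MulOpposite.op (D.pathAct act b k : Module.End K (I →₀ K)) := by
  induction k generalizing b with
  | zero => rfl
  | succ k ih => rw [pathProd_succ', ih]; rfl

variable {vtx act} in
-- It suffices to check relations on basis vectors at the source of the first arrow. The zero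
-- relations are required in a stronger form, with only the first exception, which both
-- representations below satisfy.
lemma relSystem_of_action [Fintype V] (two_le : ∀ b, 2 ≤ D.weight b)
    (hsrc : ∀ b y, D.src b ≠ vtx y → act b y = 0)
    (htgt : ∀ b y, vtxProj vtx (D.tgt b) (act b y) = act b y)
    (triangle : ∀ b y, D.src b = vtx y → actLin act (D.f b) (act b y) =
      D.c (D.bar b) • D.pathAct act (D.bar b) (D.weight (D.bar b) - 1) (Finsupp.single y 1))
    (ffg : ∀ b y, D.src b = vtx y → ¬ D.Virtual (D.f (D.f b)) →
      actLin act (D.g (D.f b)) (actLin act (D.f b) (act b y)) = 0)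
    (gfg : ∀ b y, D.src b = vtx y → ¬ D.Virtual (D.f b) →
      actLin act (D.f (D.g b)) (actLin act (D.g b) (act b y)) = 0) :
    D.RelSystem (fun v => MulOpposite.op (vtxProj vtx v : Module.End K (I →₀ K)))
      (fun b => MulOpposite.op (actLin act b : Module.End K (I →₀ K))) := by
  have ext {φ ψ : Module.End K (I →₀ K)}
      (h : ∀ y, φ (Finsupp.single y 1) = ψ (Finsupp.single y 1)) : φ = ψ :=
    Finsupp.lhom_ext' fun y => LinearMap.ext_ring (h y)
  constructor
  · intro v
    rw [← MulOpposite.op_mul]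
    refine congrArg _ (ext fun y => ?_)
    by_cases hy : vtx y = v
    · simp only [Module.End.mul_apply, vtxProj_single_of_eq vtx hy]
    · simp only [Module.End.mul_apply, vtxProj_single_of_ne vtx hy, map_zero]
  · intro v w hvw
    rw [← MulOpposite.op_mul, ← MulOpposite.op_zero]
    refine congrArg _ (ext fun y => ?_)
    by_cases hy : vtx y = v
    · simp only [Module.End.mul_apply, vtxProj_single_of_eq vtx hy,
        vtxProj_single_of_ne vtx (hy.trans_ne hvw), LinearMap.zero_apply]
    · simp only [Module.End.mul_apply, vtxProj_single_of_ne vtx hy, map_zero,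
        LinearMap.zero_apply]
  · rw [← Finset.op_sum, ← MulOpposite.op_one]
    refine congrArg _ (ext fun y => ?_)
    rw [LinearMap.sum_apply, Finset.sum_eq_single (vtx y), vtxProj_single_of_eq vtx rfl]
    · rfl
    · intro v _ hv
      exact vtxProj_single_of_ne vtx hv.symm _
    · simp
  · intro b
    rw [← MulOpposite.op_mul]
    refine congrArg _ (ext fun y => ?_)
    by_cases hy : vtx y = D.src b
    · simp only [Module.End.mul_apply, vtxProj_single_of_eq vtx hy]
    · simp only [Module.End.mul_apply, vtxProj_single_of_ne vtx hy, map_zero, actLin_single,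
        hsrc b y (Ne.symm hy), smul_zero]
  · intro b
    rw [← MulOpposite.op_mul]
    refine congrArg _ (ext fun y => ?_)
    simp only [Module.End.mul_apply, actLin_single, map_smul, htgt]
  · intro b
    rw [← MulOpposite.op_mul, pathProd_op_actLin, ← MulOpposite.op_smul]
    refine congrArg _ (ext fun y => ?_)
    simp only [Module.End.mul_apply, actLin_single, one_smul, LinearMap.smul_apply]
    by_cases hy : D.src b = vtx y
    · exact triangle b y hy
    · rw [hsrc b y hy, D.pathAct_eq_zero, map_zero, smul_zero]
      · have := two_le (D.bar b); omega
      · exact hsrc _ _ (by rwa [D.src_bar])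
  · intro b h1 _
    rw [← MulOpposite.op_mul, ← MulOpposite.op_mul, ← MulOpposite.op_zero]
    refine congrArg _ (ext fun y => ?_)
    simp only [Module.End.mul_apply, actLin_single, one_smul, LinearMap.zero_apply]
    by_cases hy : D.src b = vtx y
    · exact ffg b y hy h1
    · rw [hsrc b y hy, map_zero, map_zero]
  · intro b h1 _
    rw [← MulOpposite.op_mul, ← MulOpposite.op_mul, ← MulOpposite.op_zero]
    refine congrArg _ (ext fun y => ?_)
    simp only [Module.End.mul_apply, actLin_single, one_smul, LinearMap.zero_apply]
    by_cases hy : D.src b = vtx y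
    · exact gfg b y hy h1
    · rw [hsrc b y hy, map_zero, map_zero]

end Action

/-! ### The projective module at the vertex of the virtual loop -/

/-- The basis vector of the path of length `k` starting with `a`. -/
abbrev srcVec (K : Type*) [Field K] (k : ℕ) : Option ℕ →₀ K := Finsupp.single (some k) 1

/-- The basis vector of the virtual loop. -/
abbrev loopVec (K : Type*) [Field K] : Option ℕ →₀ K := Finsupp.single none 1

/-- The end points of the basis paths. -/
def srcVtx (a : E) : Option ℕ → V
  | some k => D.src (D.g^[k] a)
  | none => D.src a

open Classical in
/-- The action of the arrows on the basis of the projective module at the virtual loop. -/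
def srcAct (a b : E) : Option ℕ → (Option ℕ →₀ K)
  | some k =>
    -- The index set is infinite for convenience: vectors of index at least `w` are killed by all
    -- arrows, and indices above `w` are not reached from index zero.
    if k < D.weight a ∧ b = D.g^[k] a then srcVec K (k + 1)
    else if k = 0 ∧ b = D.bar a then loopVec K
    else if k = 1 ∧ b = D.f a then D.c (D.bar a) • loopVec K
    else 0
  | none =>
    if b = a then D.c a • srcVec K (D.weight a - 1)
    -- The coefficient is the one forced by `pathProd_weight`.
    else if b = D.bar a then ((D.c (D.bar a))⁻¹ * D.c a) • srcVec K (D.weight a)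
    else 0

section SrcAct

variable {D} {a : E} (H : D.NearVirtualLoop a)

lemma srcAct_iterate {k : ℕ} (hk : k < D.weight a) :
    D.srcAct a (D.g^[k] a) (some k) = srcVec K (k + 1) := by
  simp [srcAct, hk]

lemma srcAct_of_ne {b : E} {k : ℕ} (hk : 2 ≤ k) (hb : b ≠ D.g^[k] a) :
    D.srcAct a b (some k) = 0 := by
  simp only [srcAct, hb, and_false, if_false]
  rw [if_neg (by omega), if_neg (by omega)]

lemma srcAct_loop_a : D.srcAct a a none = D.c a • srcVec K (D.weight a - 1) := by
  simp [srcAct]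

lemma srcAct_loop_loop :
    D.srcAct a (D.bar a) none = ((D.c (D.bar a))⁻¹ * D.c a) • srcVec K (D.weight a) := by
  simp [srcAct, D.bar_ne a]

lemma srcAct_zero_loop : D.srcAct a (D.bar a) (some 0) = loopVec K := by
  simp [srcAct, D.bar_ne a]

lemma srcAct_one_f : D.srcAct a (D.f a) (some 1) = D.c (D.bar a) • loopVec K := by
  simp [srcAct, D.f_ne_g a]

include H

lemma srcAct_of_weight_le (b : E) {k : ℕ} (hk : D.weight a ≤ k) :
    D.srcAct a b (some k) = 0 := by
  have h4 := H.four_le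
  simp only [srcAct]
  rw [if_neg (by omega), if_neg (by omega), if_neg (by omega)]

lemma pathAct_srcAct {k l : ℕ} (hkl : k + l ≤ D.weight a) :
    D.pathAct (D.srcAct a) (D.g^[k] a) l (srcVec K k) = srcVec K (k + l) := by
  induction l generalizing k with
  | zero => rfl
  | succ l ih =>
    rw [pathAct_succ_single, srcAct_iterate (by omega), D.g_iterate, ih (by omega),
      show k + 1 + l = k + (l + 1) by omega]

lemma pathAct_srcAct_eq_zero {k l : ℕ} (hkl : D.weight a < k + l) (hl : 1 ≤ l) :
    D.pathAct (D.srcAct a) (D.g^[k] a) l (srcVec K k) = 0 := by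
  induction l generalizing k with
  | zero => omega
  | succ l ih =>
    by_cases hk : D.weight a ≤ k
    · rw [pathAct_succ_single, srcAct_of_weight_le H _ hk, map_zero]
    · rw [pathAct_succ_single, srcAct_iterate (by omega), D.g_iterate, ih (by omega) (by omega)]

lemma srcAct_pred_g : D.srcAct a (D.g a) (some (D.weight a - 1)) = 0 := by
  have h4 := H.four_le
  refine srcAct_of_ne (by omega) ?_
  rw [H.iterate_pred]
  exact (D.f_ne_g a).symm

lemma srcAct_pred_f : D.srcAct a (D.f a) (some (D.weight a - 1)) = srcVec K (D.weight a) := by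
  have h4 := H.four_le
  have := srcAct_iterate (a := a) (k := D.weight a - 1) (D := D) (by omega)
  rw [H.iterate_pred] at this
  rw [this]
  congr 2
  omega

omit H in
lemma srcAct_succ_f {k : ℕ} (hk : 1 ≤ k) : D.srcAct a (D.f (D.g^[k] a)) (some (k + 1)) = 0 := by
  refine srcAct_of_ne (by omega) ?_
  rw [← D.g_iterate]
  exact D.f_ne_g _

lemma srcAct_src (b : E) (y : Option ℕ) (h : D.src b ≠ D.srcVtx a y) : D.srcAct a b y = 0 := by
  match y with
  | some k =>
    change D.src b ≠ D.src (D.g^[k] a) at h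
    simp only [srcAct]
    rw [if_neg, if_neg, if_neg]
    · rintro ⟨rfl, rfl⟩
      exact h ((D.src_f a).trans (D.src_g a).symm)
    · rintro ⟨rfl, rfl⟩
      exact h (D.src_bar a)
    · rintro ⟨-, rfl⟩
      exact h rfl
  | none =>
    change D.src b ≠ D.src a at h
    simp only [srcAct]
    rw [if_neg, if_neg]
    · rintro rfl
      exact h (D.src_bar a)
    · rintro rfl
      exact h rfl

lemma srcAct_tgt (b : E) (y : Option ℕ) :
    vtxProj (D.srcVtx a) (D.tgt b) (D.srcAct a b y) = D.srcAct a b y := by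
  have h4 := H.four_le
  match y with
  | some k =>
    simp only [srcAct]
    split_ifs with h1 h2 h3
    · refine vtxProj_single_of_eq _ ?_ _
      rw [h1.2, ← D.src_g, D.g_iterate]
      rfl
    · refine vtxProj_single_of_eq _ ?_ _
      rw [h2.2, ← D.src_f, H.f_bar]
      rfl
    · rw [map_smul, vtxProj_single_of_eq]
      rw [h3.2, ← D.src_f, H.f_f, D.src_bar]
      rfl
    · exact map_zero _
  | none =>
    simp only [srcAct]
    split_ifs with h1 h2
    · rw [map_smul, vtxProj_single_of_eq]
      rw [h1, ← D.src_f, ← H.iterate_pred]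
      rfl
    · rw [map_smul, vtxProj_single_of_eq]
      rw [h2, ← D.src_f, H.f_bar]
      change D.src (D.g^[D.weight a] a) = _
      rw [D.iterate_weight]
    · exact map_zero _

omit H in
lemma srcVtx_some_cases {b : E} {k : ℕ} (h : D.src b = D.srcVtx a (some k)) :
    b = D.g^[k] a ∨ b = D.bar (D.g^[k] a) := D.eq_or_eq_bar h

/-- From index two on, only the continuing arrow of the `g`-cycle acts nontrivially on `some k`. The
genuine computations therefore concern the loop vector and the indices zero and one. -/
lemma relSystem_srcAct [Fintype V] :
    D.RelSystem
      (fun v => MulOpposite.op (vtxProj (D.srcVtx a) v : Module.End K (Option ℕ →₀ K)))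
      (fun b => MulOpposite.op (actLin (D.srcAct a) b : Module.End K (Option ℕ →₀ K))) := by
  have h4 := H.four_le
  have hN : D.c (D.bar a) * ((D.c (D.bar a))⁻¹ * D.c a) = D.c a := by
    rw [← mul_assoc, mul_inv_cancel₀ (D.c_ne_zero _), one_mul]
  -- two arrows which kill every basis vector of length at least two
  have hf (k : ℕ) : actLin (D.srcAct a) (D.f (D.g^[k + 1] a))
      (D.srcAct a (D.g^[k + 1] a) (some (k + 1))) = 0 := by
    by_cases hk : k + 1 < D.weight a
    · rw [srcAct_iterate hk, actLin_single, srcAct_succ_f (by omega), smul_zero]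
    · rw [srcAct_of_weight_le H _ (by omega), map_zero]
  have hb (k : ℕ) : D.srcAct a (D.bar (D.g^[k + 2] a)) (some (k + 2)) = 0 :=
    srcAct_of_ne (by omega) (D.bar_ne _)
  have hloop (b : E) : actLin (D.srcAct a) b (D.srcAct a (D.bar a) none) = 0 := by
    rw [srcAct_loop_loop, map_smul, actLin_single, srcAct_of_weight_le H _ le_rfl, smul_zero,
      smul_zero]
  refine D.relSystem_of_action H.two_le (srcAct_src H) (srcAct_tgt H) ?_ ?_ ?_
  · rintro b (_ | k) hy
    · rcases D.eq_or_eq_bar hy with rfl | rfl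
      · rw [srcAct_loop_a, D.virtual_iff.1 H.virtual, pathAct_succ_single, srcAct_loop_loop,
          map_smul, actLin_single, srcAct_pred_f H, one_smul]
        simp only [pathAct, LinearMap.id_apply]
        rw [smul_smul, hN]
      · obtain ⟨l, hl⟩ : ∃ l, D.weight a - 1 = l + 1 := ⟨D.weight a - 2, by omega⟩
        rw [hloop, D.bar_bar, hl, pathAct_succ_single, srcAct_loop_a, map_smul,
          D.pathAct_eq_zero (by omega) (srcAct_pred_g H), smul_zero, smul_zero]
    · rcases srcVtx_some_cases hy with rfl | rfl <;> match k with
      | 0 => ?_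
      | 1 => ?_
      | k + 2 => ?_
      · rw [srcAct_iterate (by omega), actLin_single, one_smul]
        change D.srcAct a (D.f a) (some 1) =
          D.c (D.bar a) • D.pathAct _ (D.bar a) (D.weight (D.bar a) - 1) _
        rw [srcAct_one_f, D.virtual_iff.1 H.virtual, pathAct_succ_single, srcAct_zero_loop]
        rfl
      · rw [hf]
        change _ = D.c (D.bar (D.g a)) • D.pathAct _ (D.bar (D.g a)) (D.weight (D.bar (D.g a)) - 1) _
        obtain ⟨l, hl⟩ : ∃ l, D.weight a - 1 = l + 1 + 1 := ⟨D.weight a - 3, by omega⟩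
        rw [D.bar_g, H.weight_f, hl, pathAct_succ_single, srcAct_one_f, H.g_f, map_smul,
          pathAct_succ_single, srcAct_loop_a, map_smul,
          D.pathAct_eq_zero (by omega) (srcAct_pred_g H), smul_zero, smul_zero, smul_zero]
      · rw [hf, D.pathAct_eq_zero _ (hb k), smul_zero]
        have := H.two_le (D.bar (D.g^[k + 2] a))
        omega
      · change actLin _ (D.f (D.bar a)) (D.srcAct a (D.bar a) (some 0)) =
          D.c (D.bar (D.bar a)) •
            D.pathAct _ (D.bar (D.bar a)) (D.weight (D.bar (D.bar a)) - 1) (srcVec K 0)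
        have := pathAct_srcAct H (k := 0) (l := D.weight a - 1) (by omega)
        rw [zero_add] at this
        rw [srcAct_zero_loop, H.f_bar, actLin_single, srcAct_loop_a, one_smul, D.bar_bar, ← this]
        rfl
      · change actLin _ (D.f (D.bar (D.g a))) (D.srcAct a (D.bar (D.g a)) (some 1)) =
          D.c (D.bar (D.bar (D.g a))) •
            D.pathAct _ (D.bar (D.bar (D.g a))) (D.weight (D.bar (D.bar (D.g a))) - 1) (srcVec K 1)
        have := pathAct_srcAct H (k := 1) (l := D.weight a - 1) (by omega)
        rw [show 1 + (D.weight a - 1) = D.weight a by omega] at this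
        rw [D.bar_bar, D.bar_g, srcAct_one_f, map_smul, H.f_f, actLin_single, one_smul,
          srcAct_loop_loop, smul_smul, hN, D.c_g, D.weight_g, ← this]
        rfl
      · rw [hb, map_zero, D.bar_bar, D.weight_iterate,
          pathAct_srcAct_eq_zero H (by omega) (by omega), smul_zero]
  · rintro b (_ | k) hy hv
    · rcases D.eq_or_eq_bar hy with rfl | rfl
      · exact absurd (H.f_f ▸ H.virtual) hv
      · rw [hloop, map_zero]
    · rcases srcVtx_some_cases hy with rfl | rfl <;> match k with
      | 0 => ?_
      | k + 1 => ?_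
      · exact absurd (H.f_f ▸ H.virtual) hv
      · rw [hf, map_zero]
      · change actLin _ (D.g (D.f (D.bar a))) (actLin _ (D.f (D.bar a))
          (D.srcAct a (D.bar a) (some 0))) = 0
        rw [srcAct_zero_loop, H.f_bar, actLin_single, srcAct_loop_a, one_smul, map_smul,
          actLin_single, srcAct_pred_g H, smul_zero, smul_zero]
      · match k with
        | 0 =>
          change actLin _ (D.g (D.f (D.bar (D.g a)))) (actLin _ (D.f (D.bar (D.g a)))
            (D.srcAct a (D.bar (D.g a)) (some 1))) = 0
          rw [D.bar_g, srcAct_one_f, H.f_f, map_smul, actLin_single, one_smul, map_smul, hloop,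
            smul_zero]
        | k + 1 => rw [hb, map_zero, map_zero]
  · rintro b (_ | k) hy hv
    · rcases D.eq_or_eq_bar hy with rfl | rfl
      · rw [srcAct_loop_a, map_smul, actLin_single, srcAct_pred_g H, smul_zero, smul_zero, map_zero]
      · rw [H.g_bar, hloop, map_zero]
    · rcases srcVtx_some_cases hy with rfl | rfl
      · by_cases hk : k < D.weight a
        · have := hf k
          rw [srcAct_iterate hk, actLin_single, one_smul, D.g_iterate, this]
        · rw [srcAct_of_weight_le H _ (by omega), map_zero, map_zero]
      · match k with
        | 0 =>
          change actLin _ (D.f (D.g (D.bar a))) (actLin _ (D.g (D.bar a))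
            (D.srcAct a (D.bar a) (some 0))) = 0
          rw [srcAct_zero_loop, H.g_bar, H.f_bar, actLin_single, one_smul, hloop]
        | 1 =>
          refine absurd ?_ hv
          change D.Virtual (D.f (D.bar (D.g a)))
          rw [D.bar_g, H.f_f]
          exact H.virtual
        | k + 2 => rw [hb, map_zero, map_zero]

end SrcAct

end WeightedTriangulationQuiver

lemma TriangulationQuiver.f_iterate_ne {V E : Type*} (Q : TriangulationQuiver V E) (a : E)
    (k : ℕ) : Q.f (Q.g^[k] a) ≠ Q.g^[k + 1] a := by
  rw [← Q.g_iterate]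
  exact Q.f_ne_g _

namespace WeightedTriangulationQuiver

variable {K : Type*} [Field K] {V : Type*} {E : Type*} (D : WeightedTriangulationQuiver K V E)

/-! ### The projective module at the end point of `a` -/

/-- The basis vector of the path of length `k` starting with `g a`. -/
abbrev gVec (K : Type*) [Field K] (k : ℕ) : ℕ ⊕ ℕ →₀ K := Finsupp.single (Sum.inl k) 1

/-- The basis vector of the path of length `k` starting with `f a`. -/
abbrev fVec (K : Type*) [Field K] (k : ℕ) : ℕ ⊕ ℕ →₀ K := Finsupp.single (Sum.inr k) 1

/-- The end points of the basis paths. -/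
def tgtVtx (a : E) : ℕ ⊕ ℕ → V
  | Sum.inl k => D.src (D.g^[k + 1] a)
  | Sum.inr 0 => D.src a
  | Sum.inr (k + 1) => D.src (D.g^[k] a)

open Classical in
/-- The action of the arrows on the basis of the projective module at the end point of `a`. -/
def tgtAct (a b : E) : ℕ ⊕ ℕ → (ℕ ⊕ ℕ →₀ K)
  | Sum.inl k =>
    if k < D.weight a ∧ b = D.g^[k + 1] a then gVec K (k + 1)
    else if k = 0 ∧ b = D.f a then fVec K 1
    -- The index `weight a - 2 + 1` stands for `weight a - 1`, in the successor form used by the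
    -- clauses for `Sum.inr`.
    else if k = 1 ∧ b = D.f (D.g a) then D.c a • fVec K (D.weight a - 2 + 1)
    else if k = 2 ∧ b = D.f (D.g (D.g a)) ∧ D.Virtual (D.f (D.g a)) then
      (D.c (D.f (D.g a)) * D.c a) • fVec K (D.weight a - 2 + 1)
    else 0
  -- A spare index: the path of length zero is `Sum.inl 0`.
  | Sum.inr 0 => 0
  | Sum.inr (k + 1) =>
    if k + 2 < D.weight a ∧ b = D.g^[k] a then fVec K (k + 2)
    -- The two full turns are identified, as `pathProd_f_weight` demands.
    else if k + 2 = D.weight a ∧ b = D.g^[k] a then gVec K (D.weight a)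
    else if k = 0 ∧ b = D.bar a then D.c a • gVec K (D.weight a - 1)
    else if k = 1 ∧ b = D.f a then (D.c (D.bar a) * D.c a) • gVec K (D.weight a - 1)
    else 0

variable {D} {a : E} (H : D.NearVirtualLoop a)

lemma tgtAct_g {k : ℕ} (hk : k < D.weight a) :
    D.tgtAct a (D.g^[k + 1] a) (Sum.inl k) = gVec K (k + 1) := by
  simp [tgtAct, hk]

lemma tgtAct_g_of_ne {b : E} {k : ℕ} (hk : 3 ≤ k) (hb : b ≠ D.g^[k + 1] a) :
    D.tgtAct a b (Sum.inl k) = 0 := by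
  simp only [tgtAct, hb, and_false, if_false]
  rw [if_neg (by omega), if_neg (by omega), if_neg (by omega)]

lemma tgtAct_zero_f : D.tgtAct a (D.f a) (Sum.inl 0) = fVec K 1 := by
  simp [tgtAct, D.f_ne_g a]

lemma tgtAct_one_f : D.tgtAct a (D.f (D.g a)) (Sum.inl 1) =
    D.c a • fVec K (D.weight a - 2 + 1) := by
  have : D.f (D.g a) ≠ D.g (D.g a) := D.f_ne_g (D.g a)
  simp [tgtAct, this]

open Classical in
lemma tgtAct_two_f : D.tgtAct a (D.f (D.g (D.g a))) (Sum.inl 2) =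
    (if D.Virtual (D.f (D.g a)) then D.c (D.f (D.g a)) * D.c a else 0) •
      fVec K (D.weight a - 2 + 1) := by
  have : D.f (D.g (D.g a)) ≠ D.g (D.g (D.g a)) := D.f_ne_g (D.g (D.g a))
  by_cases hv : D.Virtual (D.f (D.g a)) <;> simp [tgtAct, this, hv]

lemma tgtAct_f {k : ℕ} (hk : k + 2 < D.weight a) :
    D.tgtAct a (D.g^[k] a) (Sum.inr (k + 1)) = fVec K (k + 2) := by
  simp [tgtAct, hk]

lemma tgtAct_f_of_eq {k : ℕ} (hk : k + 2 = D.weight a) :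
    D.tgtAct a (D.g^[k] a) (Sum.inr (k + 1)) = gVec K (D.weight a) := by
  simp [tgtAct, hk]

lemma tgtAct_f_of_ne {b : E} {k : ℕ} (hk : 2 ≤ k) (hb : b ≠ D.g^[k] a) :
    D.tgtAct a b (Sum.inr (k + 1)) = 0 := by
  simp only [tgtAct, hb, and_false, if_false]
  rw [if_neg (by omega), if_neg (by omega)]

lemma tgtAct_one_loop : D.tgtAct a (D.bar a) (Sum.inr 1) = D.c a • gVec K (D.weight a - 1) := by
  simp [tgtAct, D.bar_ne a]

lemma tgtAct_f_two_f : D.tgtAct a (D.f a) (Sum.inr 2) =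
    (D.c (D.bar a) * D.c a) • gVec K (D.weight a - 1) := by
  simp [tgtAct, D.f_ne_g a]

lemma g_f_of_virtual (hv : D.Virtual (D.f (D.g a))) :
    D.f (D.f (D.g (D.g a))) = D.g (D.f (D.g a)) := by
  have h1 : D.f (D.g (D.f (D.g a))) = D.g (D.g a) := by
    rw [D.f_eq_bar_of_g_eq hv.g_g, D.bar_f]
  rw [← h1, D.f_cubed]

include H

lemma tgtAct_g_of_weight_le (b : E) {k : ℕ} (hk : D.weight a ≤ k) :
    D.tgtAct a b (Sum.inl k) = 0 := by
  have h4 := H.four_le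
  simp only [tgtAct]
  rw [if_neg (by omega), if_neg (by omega), if_neg (by omega), if_neg (by omega)]

lemma tgtAct_f_of_weight_le (b : E) {k : ℕ} (hk : D.weight a ≤ k) :
    D.tgtAct a b (Sum.inr k) = 0 := by
  have h4 := H.four_le
  match k with
  | 0 => rfl
  | k + 1 =>
    simp only [tgtAct]
    rw [if_neg (by omega), if_neg (by omega), if_neg (by omega), if_neg (by omega)]

lemma tgtAct_f_last : D.tgtAct a (D.g^[D.weight a - 2] a) (Sum.inr (D.weight a - 2 + 1)) =
    gVec K (D.weight a) := by
  have h4 := H.four_le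
  exact tgtAct_f_of_eq (by omega)

lemma tgtAct_f_last_of_ne {b : E} (hb : b ≠ D.g^[D.weight a - 2] a) :
    D.tgtAct a b (Sum.inr (D.weight a - 2 + 1)) = 0 := by
  have h4 := H.four_le
  exact tgtAct_f_of_ne (by omega) hb

lemma actLin_gVec_weight (b : E) : actLin (D.tgtAct a) b (gVec K (D.weight a)) = 0 := by
  rw [actLin_single, tgtAct_g_of_weight_le H _ le_rfl, smul_zero]

lemma actLin_tgtAct_f_last (b b' : E) :
    actLin (D.tgtAct a) b' (D.tgtAct a b (Sum.inr (D.weight a - 2 + 1))) = 0 := by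
  by_cases hb : b = D.g^[D.weight a - 2] a
  · rw [hb, tgtAct_f_last H, actLin_gVec_weight H]
  · rw [tgtAct_f_last_of_ne H hb, map_zero]

lemma tgtAct_pred_loop : D.tgtAct a (D.bar a) (Sum.inl (D.weight a - 1)) = 0 := by
  have h4 := H.four_le
  exact tgtAct_g_of_ne (by omega) (H.bar_ne_iterate _)

lemma tgtAct_pred_a : D.tgtAct a a (Sum.inl (D.weight a - 1)) = gVec K (D.weight a) := by
  have h4 := H.four_le
  have h1 : D.weight a - 1 + 1 = D.weight a := by omega
  have := tgtAct_g (a := a) (k := D.weight a - 1) (D := D) (by omega)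
  rwa [h1, D.iterate_weight] at this

omit H in
lemma pathAct_gVec {k l : ℕ} (hkl : k + l ≤ D.weight a) :
    D.pathAct (D.tgtAct a) (D.g^[k + 1] a) l (gVec K k) = gVec K (k + l) := by
  induction l generalizing k with
  | zero => rfl
  | succ l ih =>
    rw [pathAct_succ_single, tgtAct_g (by omega), D.g_iterate, ih (by omega),
      show k + 1 + l = k + (l + 1) by omega]

lemma pathAct_gVec_eq_zero {k l : ℕ} (hkl : D.weight a < k + l) (hl : 1 ≤ l) :
    D.pathAct (D.tgtAct a) (D.g^[k + 1] a) l (gVec K k) = 0 := by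
  induction l generalizing k with
  | zero => omega
  | succ l ih =>
    by_cases hk : D.weight a ≤ k
    · rw [pathAct_succ_single, tgtAct_g_of_weight_le H _ hk, map_zero]
    · rw [pathAct_succ_single, tgtAct_g (by omega), D.g_iterate, ih (by omega) (by omega)]

omit H in
lemma pathAct_fVec {k l : ℕ} (hkl : k + 1 + l < D.weight a) :
    D.pathAct (D.tgtAct a) (D.g^[k] a) l (fVec K (k + 1)) = fVec K (k + 1 + l) := by
  induction l generalizing k with
  | zero => rfl
  | succ l ih =>
    rw [pathAct_succ_single, tgtAct_f (by omega), D.g_iterate, ih (by omega),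
      show k + 1 + 1 + l = k + 1 + (l + 1) by omega]

omit H in
lemma pathAct_fVec_of_eq {k l : ℕ} (hkl : k + 1 + l = D.weight a) (hl : 1 ≤ l) :
    D.pathAct (D.tgtAct a) (D.g^[k] a) l (fVec K (k + 1)) = gVec K (D.weight a) := by
  induction l generalizing k with
  | zero => omega
  | succ l ih =>
    by_cases hl : l = 0
    · subst hl
      rw [pathAct_succ_single, tgtAct_f_of_eq (by omega)]
      rfl
    · rw [pathAct_succ_single, tgtAct_f (by omega), D.g_iterate, ih (by omega) (by omega)]

lemma pathAct_fVec_eq_zero {k l : ℕ} (hkl : D.weight a < k + 1 + l) (hl : 1 ≤ l) :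
    D.pathAct (D.tgtAct a) (D.g^[k] a) l (fVec K (k + 1)) = 0 := by
  induction l generalizing k with
  | zero => omega
  | succ l ih =>
    rcases lt_trichotomy (k + 2) (D.weight a) with hk | hk | hk
    · rw [pathAct_succ_single, tgtAct_f (by omega), D.g_iterate, ih (by omega) (by omega)]
    · rw [pathAct_succ_single, tgtAct_f_of_eq (by omega)]
      exact D.pathAct_eq_zero (by omega) (tgtAct_g_of_weight_le H _ le_rfl)
    · rw [pathAct_succ_single, tgtAct_f_of_weight_le H _ (by omega), map_zero]

omit H in
lemma tgtAct_src (b : E) (y : ℕ ⊕ ℕ) (h : D.src b ≠ D.tgtVtx a y) : D.tgtAct a b y = 0 := by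
  match y with
  | Sum.inl k =>
    change D.src b ≠ D.src (D.g^[k + 1] a) at h
    rw [← D.g_iterate, D.src_g] at h
    simp only [tgtAct]
    rw [if_neg, if_neg, if_neg, if_neg]
    · rintro ⟨rfl, rfl, -⟩
      exact h (D.src_f _)
    · rintro ⟨rfl, rfl⟩
      exact h (D.src_f _)
    · rintro ⟨rfl, rfl⟩
      exact h (D.src_f _)
    · rintro ⟨-, rfl⟩
      rw [← D.g_iterate] at h
      exact h (D.src_g _)
  | Sum.inr 0 => rfl
  | Sum.inr (k + 1) =>
    change D.src b ≠ D.src (D.g^[k] a) at h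
    simp only [tgtAct]
    rw [if_neg, if_neg, if_neg, if_neg]
    · rintro ⟨rfl, rfl⟩
      exact h ((D.src_f a).trans (D.src_g a).symm)
    · rintro ⟨rfl, rfl⟩
      exact h (D.src_bar a)
    · rintro ⟨-, rfl⟩
      exact h rfl
    · rintro ⟨-, rfl⟩
      exact h rfl

lemma tgtAct_tgt (b : E) (y : ℕ ⊕ ℕ) :
    vtxProj (D.tgtVtx a) (D.tgt b) (D.tgtAct a b y) = D.tgtAct a b y := by
  have h4 := H.four_le
  have hlast : D.tgtVtx a (Sum.inl (D.weight a - 1)) = D.src a := by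
    change D.src (D.g^[D.weight a - 1 + 1] a) = _
    rw [show D.weight a - 1 + 1 = D.weight a by omega, D.iterate_weight]
  match y with
  | Sum.inl k =>
    simp only [tgtAct]
    split_ifs with h1 h2 h3 h5
    · refine vtxProj_single_of_eq _ ?_ _
      rw [h1.2, ← D.src_g, D.g_iterate]
      rfl
    · refine vtxProj_single_of_eq _ ?_ _
      rw [h2.2, ← D.src_f, H.f_f, D.src_bar]
      rfl
    · rw [map_smul, vtxProj_single_of_eq]
      rw [h3.2, ← D.src_f, H.f_f_g]
      rfl
    · rw [map_smul, vtxProj_single_of_eq]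
      rw [h5.2.1, ← D.src_f, g_f_of_virtual h5.2.2, D.src_g, ← D.src_f, H.f_f_g]
      rfl
    · exact map_zero _
  | Sum.inr 0 => exact map_zero _
  | Sum.inr (k + 1) =>
    simp only [tgtAct]
    split_ifs with h1 h2 h3 h5
    · refine vtxProj_single_of_eq _ ?_ _
      rw [h1.2, ← D.src_g, D.g_iterate]
      rfl
    · refine vtxProj_single_of_eq _ ?_ _
      obtain rfl : k = D.weight a - 2 := by omega
      rw [h2.2, ← D.src_f, H.f_iterate_pred_pred]
      change D.src (D.g^[D.weight a + 1] a) = _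
      rw [← D.g_iterate, D.iterate_weight]
    · rw [map_smul, vtxProj_single_of_eq]
      rw [h3.2, ← D.src_f, H.f_bar, hlast]
    · rw [map_smul, vtxProj_single_of_eq]
      rw [h5.2, ← D.src_f, H.f_f, hlast, D.src_bar]
    · exact map_zero _

omit H in
lemma tgtVtx_inl_cases {b : E} {k : ℕ} (h : D.src b = D.tgtVtx a (Sum.inl k)) :
    b = D.g^[k + 1] a ∨ b = D.f (D.g^[k] a) := by
  have := D.eq_or_eq_bar h
  rwa [← D.g_iterate, D.bar_g, D.g_iterate] at this

omit H in
lemma tgtVtx_inr_cases {b : E} {k : ℕ} (h : D.src b = D.tgtVtx a (Sum.inr (k + 1))) :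
    b = D.g^[k] a ∨ b = D.bar (D.g^[k] a) := D.eq_or_eq_bar h

lemma actLin_f_tgtAct_g (k : ℕ) : actLin (D.tgtAct a) (D.f (D.g^[k + 3] a))
    (D.tgtAct a (D.g^[k + 3] a) (Sum.inl (k + 2))) = 0 := by
  by_cases hk : k + 2 < D.weight a
  · rw [tgtAct_g hk, actLin_single, tgtAct_g_of_ne (by omega), smul_zero]
    exact D.f_iterate_ne _ _
  · rw [tgtAct_g_of_weight_le H _ (by omega), map_zero]

lemma actLin_f_tgtAct_f (k : ℕ) : actLin (D.tgtAct a) (D.f (D.g^[k + 1] a))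
    (D.tgtAct a (D.g^[k + 1] a) (Sum.inr (k + 2))) = 0 := by
  rcases lt_trichotomy (k + 3) (D.weight a) with hk | hk | hk
  · rw [tgtAct_f hk, actLin_single, tgtAct_f_of_ne (by omega), smul_zero]
    exact D.f_iterate_ne _ _
  · rw [tgtAct_f_of_eq hk, actLin_gVec_weight H]
  · rw [tgtAct_f_of_weight_le H _ (by omega), map_zero]

omit H in
lemma tgtAct_f_mul_f (k : ℕ) :
    D.tgtAct a (D.f (D.g^[k + 3] a)) (Sum.inl (k + 3)) = 0 := by
  refine tgtAct_g_of_ne (by omega) ?_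
  exact D.f_iterate_ne _ _

lemma actLin_f_f_tgtAct_two : actLin (D.tgtAct a) (D.f (D.f (D.g (D.g a))))
    (D.tgtAct a (D.f (D.g (D.g a))) (Sum.inl 2)) = 0 := by
  rw [tgtAct_two_f, map_smul, actLin_single, tgtAct_f_last_of_ne H, smul_zero, smul_zero]
  rw [← H.f_f_g]
  intro h1
  exact H.iterate_g_ne 1 (D.f.injective (D.f.injective h1))

lemma g_f_g_ne : D.g (D.f (D.g a)) ≠ D.g^[D.weight a - 2] a := by
  rw [← H.f_f_g]
  exact (D.f_ne_g _).symm

/-- From index three on, only the continuing arrow acts nontrivially, so both sides vanish. The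
small indices are where the prescribed coefficients are tested. -/
lemma tgtAct_triangle_inl (b : E) (k : ℕ) (hy : D.src b = D.tgtVtx a (Sum.inl k)) :
    actLin (D.tgtAct a) (D.f b) (D.tgtAct a b (Sum.inl k)) = D.c (D.bar b) •
      D.pathAct (D.tgtAct a) (D.bar b) (D.weight (D.bar b) - 1) (gVec K k) := by
  have h4 := H.four_le
  rcases tgtVtx_inl_cases hy with rfl | rfl
  · have hbar : D.bar (D.g^[k + 1] a) = D.f (D.g^[k] a) := by rw [← D.g_iterate, D.bar_g]
    rw [hbar]
    match k with
    | 0 =>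
      change actLin _ (D.f (D.g a)) _ =
        D.c (D.f a) • D.pathAct _ (D.f a) (D.weight (D.f a) - 1) (gVec K 0)
      obtain ⟨l, hl⟩ : ∃ l, D.weight a = l + 2 := ⟨D.weight a - 2, by omega⟩
      rw [tgtAct_g (by omega), actLin_single, tgtAct_one_f, one_smul, H.c_f, H.weight_f,
        show D.weight a - 1 = l + 1 by omega, pathAct_succ_single, tgtAct_zero_f, H.g_f]
      have := pathAct_fVec (D := D) (a := a) (k := 0) (l := l) (by omega)
      rw [show D.g^[0] a = a from rfl] at this
      rw [this, show D.weight a - 2 + 1 = 0 + 1 + l by omega]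
    | 1 =>
      change actLin _ (D.f (D.g (D.g a))) _ = D.c (D.f (D.g a)) •
        D.pathAct _ (D.f (D.g a)) (D.weight (D.f (D.g a)) - 1) (gVec K 1)
      rw [tgtAct_g (by omega), actLin_single, tgtAct_two_f, one_smul]
      -- If `f (g a)` is virtual, then `A (f (g a))` is one arrow and produces exactly the
      -- prescribed coefficient; otherwise its second arrow already gives zero.
      split_ifs with hv
      · rw [D.virtual_iff.1 hv, pathAct_succ_single, tgtAct_one_f, ← smul_smul]
        rfl
      · obtain ⟨l, hl⟩ : ∃ l, D.weight (D.f (D.g a)) - 1 = l + 1 + 1 := by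
          have h1 := H.two_le (D.f (D.g a))
          rw [D.virtual_iff] at hv
          exact ⟨D.weight (D.f (D.g a)) - 3, by omega⟩
        rw [hl, pathAct_succ_single, tgtAct_one_f, map_smul, pathAct_succ_single,
          tgtAct_f_last_of_ne H (g_f_g_ne H), map_zero, smul_zero, smul_zero, zero_smul]
    | 2 =>
      rw [actLin_f_tgtAct_g H 0]
      change _ = D.c (D.f (D.g (D.g a))) •
        D.pathAct _ (D.f (D.g (D.g a))) (D.weight (D.f (D.g (D.g a))) - 1) (gVec K 2)
      -- If `f (g a)` is virtual, then `f (g (g a))` lies on the `g`-cycle of `a`. Two arrows of the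
      -- path reach the last basis vector, and a third one kills it because `w - 1 ≥ 3`.
      by_cases hv : D.Virtual (D.f (D.g a))
      · have h1 : D.g (D.f (D.g (D.g a))) = D.g^[D.weight a - 2] a := by
          rw [← H.f_f_g, ← D.bar_f, g_f_of_virtual hv, D.bar_g]
        have h2 : D.weight (D.f (D.g (D.g a))) = D.weight a := by
          rw [← D.weight_g, h1, D.weight_iterate]
        obtain ⟨l, hl⟩ : ∃ l, D.weight a - 1 = l + 1 + 1 + 1 := ⟨D.weight a - 4, by omega⟩
        rw [h2, hl, pathAct_succ_single, tgtAct_two_f, map_smul, h1, pathAct_succ_single,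
          tgtAct_f_last H, D.pathAct_eq_zero (by omega) (tgtAct_g_of_weight_le H _ le_rfl),
          smul_zero, smul_zero]
      · rw [D.pathAct_eq_zero, smul_zero]
        · have := H.two_le (D.f (D.g (D.g a)))
          omega
        · rw [tgtAct_two_f, if_neg hv, zero_smul]
    | k + 3 =>
      rw [actLin_f_tgtAct_g H (k + 1), D.pathAct_eq_zero _ (tgtAct_f_mul_f k), smul_zero]
      have := H.two_le (D.f (D.g^[k + 3] a))
      omega
  · have hbar : D.bar (D.f (D.g^[k] a)) = D.g^[k + 1] a := by rw [D.bar_f, ← D.g_iterate]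
    rw [hbar, D.weight_iterate, D.c_iterate]
    match k with
    | 0 =>
      change actLin _ (D.f (D.f a)) (D.tgtAct a (D.f a) (Sum.inl 0)) = _
      rw [tgtAct_zero_f, H.f_f, actLin_single, tgtAct_one_loop, pathAct_gVec (by omega),
        one_smul, zero_add]
    | 1 =>
      change actLin _ (D.f (D.f (D.g a))) (D.tgtAct a (D.f (D.g a)) (Sum.inl 1)) = _
      rw [tgtAct_one_f, H.f_f_g, map_smul, actLin_single, tgtAct_f_last H,
        pathAct_gVec (by omega), one_smul, show 1 + (D.weight a - 1) = D.weight a by omega]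
    | 2 =>
      rw [pathAct_gVec_eq_zero H (by omega) (by omega), smul_zero]
      exact actLin_f_f_tgtAct_two H
    | k + 3 =>
      rw [tgtAct_f_mul_f, map_zero, pathAct_gVec_eq_zero H (by omega) (by omega), smul_zero]

lemma tgtAct_triangle_inr (b : E) (k : ℕ) (hy : D.src b = D.tgtVtx a (Sum.inr k)) :
    actLin (D.tgtAct a) (D.f b) (D.tgtAct a b (Sum.inr k)) = D.c (D.bar b) •
      D.pathAct (D.tgtAct a) (D.bar b) (D.weight (D.bar b) - 1) (fVec K k) := by
  have h4 := H.four_le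
  match k with
  | 0 =>
    rw [D.pathAct_eq_zero _ rfl, smul_zero]
    · exact map_zero _
    · have := H.two_le (D.bar b)
      omega
  | k + 1 =>
    rcases tgtVtx_inr_cases hy with rfl | rfl
    · match k with
      | 0 =>
        change actLin _ (D.f a) (D.tgtAct a a (Sum.inr 1)) =
          D.c (D.bar a) • D.pathAct _ (D.bar a) (D.weight (D.bar a) - 1) (fVec K 1)
        have := tgtAct_f (a := a) (D := D) (k := 0) (by omega)
        rw [show D.g^[0] a = a from rfl, zero_add, zero_add] at this
        rw [this, actLin_single, tgtAct_f_two_f, D.virtual_iff.1 H.virtual, pathAct_succ_single,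
          tgtAct_one_loop, one_smul, mul_smul]
        rfl
      | 1 =>
        rw [actLin_f_tgtAct_f H 0]
        change _ = D.c (D.bar (D.g a)) •
          D.pathAct _ (D.bar (D.g a)) (D.weight (D.bar (D.g a)) - 1) (fVec K 2)
        obtain ⟨l, hl⟩ : ∃ l, D.weight a - 1 = l + 1 + 1 + 1 := ⟨D.weight a - 4, by omega⟩
        rw [D.bar_g, H.weight_f, hl, pathAct_succ_single, tgtAct_f_two_f, map_smul, H.g_f,
          pathAct_succ_single, tgtAct_pred_a H,
          D.pathAct_eq_zero (by omega) (tgtAct_g_of_weight_le H _ le_rfl), smul_zero, smul_zero]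
      | k + 2 =>
        rw [actLin_f_tgtAct_f H, D.pathAct_eq_zero, smul_zero]
        · have := H.two_le (D.bar (D.g^[k + 2] a))
          omega
        · exact tgtAct_f_of_ne (by omega) (D.bar_ne _)
    · rw [D.bar_bar, D.weight_iterate, D.c_iterate]
      match k with
      | 0 =>
        rw [pathAct_fVec_of_eq (by omega) (by omega)]
        change actLin _ (D.f (D.bar a)) (D.tgtAct a (D.bar a) (Sum.inr 1)) = _
        rw [tgtAct_one_loop, H.f_bar, map_smul, actLin_single, tgtAct_pred_a H, one_smul]
      | 1 =>
        rw [pathAct_fVec_eq_zero H (by omega) (by omega)]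
        change actLin _ (D.f (D.bar (D.g a))) (D.tgtAct a (D.bar (D.g a)) (Sum.inr 2)) = _
        rw [D.bar_g, tgtAct_f_two_f, H.f_f, map_smul, actLin_single, tgtAct_pred_loop H, smul_zero,
          smul_zero, smul_zero]
      | k + 2 =>
        rw [tgtAct_f_of_ne (by omega) (D.bar_ne _), map_zero,
          pathAct_fVec_eq_zero H (by omega) (by omega), smul_zero]

lemma actLin_tgtAct_one_loop (b : E) (hb : b = a ∨ b = D.bar a) (b' : E) :
    actLin (D.tgtAct a) b' (actLin (D.tgtAct a) b (gVec K (D.weight a - 1))) = 0 := by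
  rcases hb with rfl | rfl
  · rw [actLin_single, tgtAct_pred_a H, map_smul, actLin_gVec_weight H, smul_zero]
  · rw [actLin_single, tgtAct_pred_loop H, smul_zero, map_zero]

lemma relSystem_tgtAct [Fintype V] :
    D.RelSystem
      (fun v => MulOpposite.op (vtxProj (D.tgtVtx a) v : Module.End K (ℕ ⊕ ℕ →₀ K)))
      (fun b => MulOpposite.op (actLin (D.tgtAct a) b : Module.End K (ℕ ⊕ ℕ →₀ K))) := by
  have h4 := H.four_le
  refine D.relSystem_of_action H.two_le tgtAct_src (tgtAct_tgt H) ?_ ?_ ?_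
  · rintro b (k | k) hy
    · exact tgtAct_triangle_inl H b k hy
    · exact tgtAct_triangle_inr H b k hy
  · rintro b (k | k) hy hv
    · rcases tgtVtx_inl_cases hy with rfl | rfl
      · match k with
        | 0 =>
          change actLin _ (D.g (D.f (D.g a))) (actLin _ (D.f (D.g a)) _) = 0
          rw [tgtAct_g (by omega), actLin_single, tgtAct_one_f, one_smul, map_smul, actLin_single,
            tgtAct_f_last_of_ne H (g_f_g_ne H), smul_zero, smul_zero]
        | 1 =>
          change ¬ D.Virtual (D.f (D.f (D.g (D.g a)))) at hv
          change actLin _ (D.g (D.f (D.g (D.g a)))) (actLin _ (D.f (D.g (D.g a))) _) = 0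
          rw [tgtAct_g (by omega), actLin_single, tgtAct_two_f, if_neg, zero_smul, smul_zero,
            map_zero]
          intro h1
          rw [g_f_of_virtual h1] at hv
          exact hv ((virtual_of_g_eq rfl).1 h1)
        | k + 2 => rw [actLin_f_tgtAct_g H, map_zero]
      · match k with
        | 0 =>
          change actLin _ (D.g (D.f (D.f a))) (actLin _ (D.f (D.f a))
            (D.tgtAct a (D.f a) (Sum.inl 0))) = 0
          rw [tgtAct_zero_f, H.f_f, H.g_bar, actLin_single, tgtAct_one_loop, one_smul, map_smul,
            actLin_single, tgtAct_pred_loop H, smul_zero, smul_zero]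
        | 1 =>
          change actLin _ (D.g (D.f (D.f (D.g a)))) (actLin _ (D.f (D.f (D.g a)))
            (D.tgtAct a (D.f (D.g a)) (Sum.inl 1))) = 0
          rw [tgtAct_one_f, map_smul, actLin_single, one_smul, map_smul, actLin_tgtAct_f_last H,
            smul_zero]
        | 2 =>
          change actLin _ _ (actLin _ (D.f (D.f (D.g (D.g a))))
            (D.tgtAct a (D.f (D.g (D.g a))) (Sum.inl 2))) = 0
          rw [actLin_f_f_tgtAct_two H, map_zero]
        | k + 3 => rw [tgtAct_f_mul_f, map_zero, map_zero]
    · match k with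
      | 0 =>
        change actLin _ _ (actLin _ _ 0) = 0
        rw [map_zero, map_zero]
      | k + 1 =>
        rcases tgtVtx_inr_cases hy with rfl | rfl
        · match k with
          | 0 => exact absurd (H.f_f ▸ H.virtual) hv
          | k + 1 => rw [actLin_f_tgtAct_f H, map_zero]
        · match k with
          | 0 =>
            change actLin _ _ (actLin _ (D.f (D.bar a)) (D.tgtAct a (D.bar a) (Sum.inr 1))) = 0
            rw [H.f_bar, tgtAct_one_loop, map_smul, map_smul,
              actLin_tgtAct_one_loop H _ (Or.inl rfl), smul_zero]
          | 1 =>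
            change actLin _ _ (actLin _ (D.f (D.bar (D.g a)))
              (D.tgtAct a (D.bar (D.g a)) (Sum.inr 2))) = 0
            rw [D.bar_g, H.f_f, tgtAct_f_two_f, map_smul, map_smul,
              actLin_tgtAct_one_loop H _ (Or.inr rfl), smul_zero]
          | k + 2 => rw [tgtAct_f_of_ne (by omega) (D.bar_ne _), map_zero, map_zero]
  · rintro b (k | k) hy hv
    · rcases tgtVtx_inl_cases hy with rfl | rfl
      · match k with
        | 0 =>
          change ¬ D.Virtual (D.f (D.g a)) at hv
          rw [tgtAct_g (by omega)]
          change actLin _ (D.f (D.g (D.g a))) (actLin _ (D.g^[1 + 1] a) (gVec K 1)) = 0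
          rw [actLin_single, tgtAct_g (by omega), one_smul, actLin_single, tgtAct_two_f, if_neg hv,
            zero_smul, smul_zero]
        | k + 1 =>
          by_cases hk : k + 1 < D.weight a
          · rw [tgtAct_g hk, actLin_single, one_smul, D.g_iterate, actLin_f_tgtAct_g H]
          · rw [tgtAct_g_of_weight_le H _ (by omega), map_zero, map_zero]
      · match k with
        | 0 => exact absurd (H.f_f ▸ H.virtual) hv
        | 1 =>
          change actLin _ (D.f (D.g (D.f (D.g a)))) (actLin _ (D.g (D.f (D.g a)))
            (D.tgtAct a (D.f (D.g a)) (Sum.inl 1))) = 0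
          rw [tgtAct_one_f, map_smul, actLin_single, one_smul, map_smul, actLin_tgtAct_f_last H,
            smul_zero]
        | 2 =>
          change actLin _ _ (actLin _ _ (D.tgtAct a (D.f (D.g (D.g a))) (Sum.inl 2))) = 0
          rw [tgtAct_two_f, map_smul, actLin_single, one_smul, map_smul, actLin_tgtAct_f_last H,
            smul_zero]
        | k + 3 => rw [tgtAct_f_mul_f, map_zero, map_zero]
    · match k with
      | 0 =>
        change actLin _ _ (actLin _ _ 0) = 0
        rw [map_zero, map_zero]
      | k + 1 =>
        rcases tgtVtx_inr_cases hy with rfl | rfl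
        · rcases lt_trichotomy (k + 2) (D.weight a) with hk | hk | hk
          · rw [tgtAct_f hk, actLin_single, one_smul, D.g_iterate, actLin_f_tgtAct_f H]
          · rw [tgtAct_f_of_eq hk, actLin_gVec_weight H, map_zero]
          · rw [tgtAct_f_of_weight_le H _ (by omega), map_zero, map_zero]
        · match k with
          | 0 =>
            change actLin _ _ (actLin _ (D.g (D.bar a)) (D.tgtAct a (D.bar a) (Sum.inr 1))) = 0
            rw [H.g_bar, tgtAct_one_loop, map_smul, map_smul,
              actLin_tgtAct_one_loop H _ (Or.inr rfl), smul_zero]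
          | 1 =>
            change actLin _ _ (actLin _ (D.g (D.bar (D.g a)))
              (D.tgtAct a (D.bar (D.g a)) (Sum.inr 2))) = 0
            rw [D.bar_g, H.g_f, tgtAct_f_two_f, map_smul, map_smul,
              actLin_tgtAct_one_loop H _ (Or.inl rfl), smul_zero]
          | k + 2 => rw [tgtAct_f_of_ne (by omega) (D.bar_ne _), map_zero, map_zero]

end WeightedTriangulationQuiver

/-! ### Uniqueness of syzygies, and resolutions of period four. -/

section Homological

universe u

variable {R : Type u} [Ring R]

/-- A lift between the covers is onto since the target kernel is superfluous, so it splits. The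
section is onto since the source kernel is superfluous, so the lift is bijective. -/
lemma IsProjectiveCover.nonempty_equiv {P P' M M' : Type*} [AddCommGroup P] [Module R P]
    [AddCommGroup P'] [Module R P'] [AddCommGroup M] [Module R M] [AddCommGroup M'] [Module R M']
    {p : P →ₗ[R] M} {p' : P' →ₗ[R] M'} (hp : IsProjectiveCover p) (hp' : IsProjectiveCover p')
    (e : M ≃ₗ[R] M') : Nonempty (LinearMap.ker p ≃ₗ[R] LinearMap.ker p') := by
  have := hp.projective
  have := hp'.projective
  obtain ⟨φ, hφ⟩ := Module.projective_lifting_property p' (e.toLinearMap ∘ₗ p) hp'.surjective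
  have hφ' (x : P) : p' (φ x) = e (p x) := LinearMap.congr_fun hφ x
  have hsurj : LinearMap.range φ = ⊤ := by
    refine hp'.superfluous _ (eq_top_iff.2 fun y _ => ?_)
    obtain ⟨x, hx⟩ := hp.surjective (e.symm (p' y))
    have hy : y - φ x ∈ LinearMap.ker p' := by
      rw [LinearMap.mem_ker, map_sub, hφ', hx, e.apply_symm_apply, sub_self]
    rw [← sub_add_cancel y (φ x)]
    exact Submodule.add_mem_sup hy ⟨x, rfl⟩
  obtain ⟨s, hs⟩ := Module.projective_lifting_property φ LinearMap.id
    (LinearMap.range_eq_top.1 hsurj)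
  have hs' (y : P') : φ (s y) = y := LinearMap.congr_fun hs y
  have hrange : LinearMap.range s = ⊤ := by
    refine hp.superfluous _ (eq_top_iff.2 fun x _ => ?_)
    have hx : x - s (φ x) ∈ LinearMap.ker p := by
      rw [LinearMap.mem_ker, ← e.map_eq_zero_iff, ← hφ', map_sub, hs', sub_self, map_zero]
    rw [← sub_add_cancel x (s (φ x))]
    exact Submodule.add_mem_sup hx ⟨_, rfl⟩
  have hinj : Function.Injective φ := by
    refine (injective_iff_map_eq_zero φ).2 fun x hx => ?_
    obtain ⟨y, rfl⟩ := LinearMap.range_eq_top.1 hrange x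
    rw [hs'] at hx
    rw [hx, map_zero]
  let E := LinearEquiv.ofBijective φ ⟨hinj, LinearMap.range_eq_top.1 hsurj⟩
  refine ⟨E.ofSubmodules _ _ ?_⟩
  ext y
  rw [Submodule.mem_map, LinearMap.mem_ker]
  constructor
  · rintro ⟨x, hx, rfl⟩
    change p' (φ x) = 0
    rw [hφ', LinearMap.mem_ker.1 hx, map_zero]
  · intro hy
    refine ⟨s y, ?_, hs' y⟩
    rw [LinearMap.mem_ker, ← e.map_eq_zero_iff, ← hφ', hs', hy]

lemma IsProjectiveCover.comp_equiv {P M M' : Type*} [AddCommGroup P] [Module R P]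
    [AddCommGroup M] [Module R M] [AddCommGroup M'] [Module R M'] {p : P →ₗ[R] M}
    (hp : IsProjectiveCover p) (e : M ≃ₗ[R] M') : IsProjectiveCover (e.toLinearMap ∘ₗ p) where
  projective := hp.projective
  surjective := e.surjective.comp hp.surjective
  superfluous := by
    rw [LinearEquiv.ker_comp]
    exact hp.superfluous

lemma IsSyzygy.congr {M M' L : ModuleCat.{u} R} (h : IsSyzygy M L) (e : M ≃ₗ[R] M') :
    IsSyzygy M' L := by
  obtain ⟨P, p, hp, ⟨φ⟩⟩ := h
  refine ⟨P, e.toLinearMap ∘ₗ p, hp.comp_equiv e, ⟨φ.trans (LinearEquiv.ofEq _ _ ?_)⟩⟩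
  rw [LinearEquiv.ker_comp]

lemma IsSyzygy.nonempty_equiv {M L L' : ModuleCat.{u} R} (h : IsSyzygy M L)
    (h' : IsSyzygy M L') : Nonempty (L ≃ₗ[R] L') := by
  obtain ⟨P, p, hp, ⟨φ⟩⟩ := h
  obtain ⟨P', p', hp', ⟨φ'⟩⟩ := h'
  obtain ⟨e⟩ := hp.nonempty_equiv hp' (LinearEquiv.refl R M)
  exact ⟨φ.trans (e.trans φ'.symm)⟩

lemma IsIteratedSyzygy.congr {k : ℕ} {M M' N : ModuleCat.{u} R} (h : IsIteratedSyzygy k M N)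
    (e : M ≃ₗ[R] M') : IsIteratedSyzygy k M' N := by
  cases k with
  | zero =>
    obtain ⟨φ⟩ := h
    exact ⟨φ.trans e⟩
  | succ k =>
    obtain ⟨L, h1, h2⟩ := h
    exact ⟨L, h1.congr e, h2⟩

lemma IsIteratedSyzygy.of_isSyzygy {k : ℕ} {M L N : ModuleCat.{u} R}
    (h : IsIteratedSyzygy (k + 1) M N) (hL : IsSyzygy M L) : IsIteratedSyzygy k L N := by
  obtain ⟨L', h1, h2⟩ := h
  obtain ⟨e⟩ := h1.nonempty_equiv hL
  exact h2.congr e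

/-- Iterated syzygies allow any choice of projective covers; uniqueness reduces the exclusion of `l
= 1, 2, 3` to the given modules. -/
lemma isPeriodicOfPeriod_four {M₀ M₁ M₂ M₃ : ModuleCat.{u} R} (h₀ : IsSyzygy M₀ M₁)
    (h₁ : IsSyzygy M₁ M₂) (h₂ : IsSyzygy M₂ M₃) (h₃ : IsSyzygy M₃ M₀)
    (n₁ : ¬ Nonempty (M₀ ≃ₗ[R] M₁)) (n₂ : ¬ Nonempty (M₀ ≃ₗ[R] M₂))
    (n₃ : ¬ Nonempty (M₀ ≃ₗ[R] M₃)) : IsPeriodicOfPeriod M₀ 4 := by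
  refine ⟨by norm_num, ⟨M₁, h₀, M₂, h₁, M₃, h₂, M₀, h₃, ⟨LinearEquiv.refl R M₀⟩⟩, ?_⟩
  intro l hl hl4 h
  interval_cases l
  · exact n₁ (h.of_isSyzygy h₀)
  · exact n₂ ((h.of_isSyzygy h₀).of_isSyzygy h₁)
  · exact n₃ (((h.of_isSyzygy h₀).of_isSyzygy h₁).of_isSyzygy h₂)

lemma isMinimalProjectiveResolution_four {M N : Type*} [AddCommGroup M] [Module R M]
    [AddCommGroup N] [Module R N] {X₀ X₁ X₂ X₃ : Submodule R M}
    {d₀ : X₁ →ₗ[R] X₀} {d₁ : X₂ →ₗ[R] X₁} {d₂ : X₃ →ₗ[R] X₂} {d₃ : X₀ →ₗ[R] X₃}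
    {ε : X₀ →ₗ[R] N}
    (p₀ : Module.Projective R X₀) (p₁ : Module.Projective R X₁)
    (p₂ : Module.Projective R X₂) (p₃ : Module.Projective R X₃)
    (f₀ : Module.Finite R X₀) (f₁ : Module.Finite R X₁)
    (f₂ : Module.Finite R X₂) (f₃ : Module.Finite R X₃)
    (surj : Function.Surjective ε) (e₀ : Function.Exact d₀ ε) (e₁ : Function.Exact d₁ d₀)
    (e₂ : Function.Exact d₂ d₁) (e₃ : Function.Exact d₃ d₂) (e₄ : Function.Exact d₀ d₃)
    (s : IsSuperfluous (LinearMap.ker ε)) (s₀ : IsSuperfluous (LinearMap.ker d₀))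
    (s₁ : IsSuperfluous (LinearMap.ker d₁)) (s₂ : IsSuperfluous (LinearMap.ker d₂))
    (s₃ : IsSuperfluous (LinearMap.ker d₃)) :
    IsMinimalProjectiveResolution
      (fun k => (fourPeriodic X₀ X₁ X₂ X₃ k : Submodule R M))
      (fourPeriodicMap X₀ X₁ X₂ X₃ d₀ d₁ d₂ d₃) ε where
  projective n := by
    induction n using fourPeriodic.induct with
    | case1 => exact p₀
    | case2 => exact p₁
    | case3 => exact p₂
    | case4 => exact p₃
    | case5 k ih => exact ih
  finite n := by
    induction n using fourPeriodic.induct with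
    | case1 => exact f₀
    | case2 => exact f₁
    | case3 => exact f₂
    | case4 => exact f₃
    | case5 k ih => exact ih
  surjective := surj
  exact_zero := e₀
  exact_succ n := by
    induction n using fourPeriodic.induct with
    | case1 => exact e₁
    | case2 => exact e₂
    | case3 => exact e₃
    | case4 => exact e₄
    | case5 k ih => exact ih
  minimal_zero := s
  minimal_succ n := by
    induction n using fourPeriodic.induct with
    | case1 => exact s₀
    | case2 => exact s₁
    | case3 => exact s₂
    | case4 => exact s₃
    | case5 k ih => exact ih

end Homological

/-! ### Dimensions -/

section Dimension

variable {K A : Type*} [Field K] [AddCommGroup A] [Module K A]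

lemma card_le_finrank_of_dual {W : Submodule K A} [FiniteDimensional K W] {ι : Type*} [Fintype ι]
    (v : ι → A) (hv : ∀ t, v t ∈ W) (θ : ι → A →ₗ[K] K) (hne : ∀ s t, s ≠ t → θ s (v t) = 0)
    (hself : ∀ t, θ t (v t) ≠ 0) : Fintype.card ι ≤ Module.finrank K W := by
  have hli : LinearIndependent K v := by
    refine Fintype.linearIndependent_iff.2 fun r hr s => ?_
    have := congrArg (θ s) hr
    rw [map_sum, map_zero, Finset.sum_eq_single s] at this
    · rw [map_smul, smul_eq_mul] at this
      exact (mul_eq_zero.1 this).resolve_right (hself s)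
    · intro t _ hts
      rw [map_smul, hne s t hts.symm, smul_zero]
    · simp
  have hli' : LinearIndependent K fun t => (⟨v t, hv t⟩ : W) :=
    LinearIndependent.of_comp W.subtype hli
  exact hli'.fintype_card_le_finrank

/-- The kernel of `ψ` on `W` has dimension at most `r` and contains the image of `φ`, of dimension
at least `r`; hence they agree. -/
lemma exists_of_finrank_le {U W : Submodule K A} [FiniteDimensional K W] (φ ψ : A →ₗ[K] A)
    {r s : ℕ} (hφ : ∀ x ∈ U, φ x ∈ W) (hcomp : ∀ x ∈ U, ψ (φ x) = 0)
    (hW : Module.finrank K W ≤ r + s) (hr : r ≤ Module.finrank K (U.map φ))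
    (hs : s ≤ Module.finrank K (W.map ψ)) {y : A} (hy : y ∈ W) (hy0 : ψ y = 0) :
    ∃ x ∈ U, φ x = y := by
  have h1 := (ψ.domRestrict W).finrank_range_add_finrank_ker
  have h2 : LinearMap.range (ψ.domRestrict W) = W.map ψ := by
    rw [LinearMap.range_domRestrict]
  have h3 : U.map φ ≤ (LinearMap.ker (ψ.domRestrict W)).map W.subtype := by
    rintro _ ⟨x, hx, rfl⟩
    exact ⟨⟨φ x, hφ x hx⟩, hcomp x hx, rfl⟩
  have h4 : Module.finrank K ((LinearMap.ker (ψ.domRestrict W)).map W.subtype) =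
      Module.finrank K (LinearMap.ker (ψ.domRestrict W)) :=
    (Submodule.equivMapOfInjective W.subtype W.subtype_injective _).finrank_eq.symm
  have h5 := Submodule.eq_of_le_of_finrank_le h3 (by rw [h2] at h1; omega)
  have h6 : y ∈ U.map φ := by
    rw [h5]
    exact ⟨⟨y, hy⟩, hy0, rfl⟩
  exact h6

end Dimension

namespace WeightedTriangulationQuiver

variable {K : Type*} [Field K] {V : Type*} {E : Type*} {D : WeightedTriangulationQuiver K V E}
  [Fintype V]

/-! ### Indecomposable projective modules of the weighted surface algebra -/

variable (D) in
lemma adjoin_op_alg : Algebra.adjoin K (Set.range (fun v => MulOpposite.op (D.e v)) ∪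
    Set.range (fun b => MulOpposite.op (D.x b))) = ⊤ := by
  have h1 : (MulOpposite.unop ⁻¹' (Set.range D.e ∪ Set.range D.x) : Set D.Algᵐᵒᵖ) =
      Set.range (fun v => MulOpposite.op (D.e v)) ∪
        Set.range (fun b => MulOpposite.op (D.x b)) := by
    ext y
    simp only [Set.mem_preimage, Set.mem_union, Set.mem_range]
    refine or_congr (exists_congr fun v => ?_) (exists_congr fun b => ?_) <;>
    exact ⟨fun h => by rw [h]; rfl, fun h => by rw [← h]; rfl⟩
  rw [← h1, ← Subalgebra.op_adjoin, adjoin_alg, Subalgebra.op_top]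

variable (two_le : ∀ b, 2 ≤ D.weight b)

section
include two_le

lemma mem_P {v : V} {y : D.Alg} : y ∈ D.P v ↔ D.e v * y = y := by
  rw [P, Submodule.mem_span_singleton]
  constructor
  · rintro ⟨r, rfl⟩
    rw [← MulOpposite.op_unop r, op_smul_eq_mul, ← mul_assoc, (D.relSystem_alg two_le).idem]
  · intro h
    exact ⟨MulOpposite.op y, by rw [op_smul_eq_mul, h]⟩

lemma e_mem_P (v : V) : D.e v ∈ D.P v :=
  (mem_P two_le).2 ((D.relSystem_alg two_le).idem v)

/-- Left multiplication by an element of `e_u Λ` as a map between projective modules. -/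
def leftMul (u v : V) (y : D.Alg) (hy : D.e u * y = y) : D.P v →ₗ[D.Algᵐᵒᵖ] D.P u where
  toFun z := ⟨y * z, (mem_P two_le).2 (by rw [← mul_assoc, hy])⟩
  map_add' z w := Subtype.ext (mul_add y _ _)
  map_smul' r z := Subtype.ext (by
    change y * (r • (z : D.Alg)) = r • (y * (z : D.Alg))
    rw [← MulOpposite.op_unop r, op_smul_eq_mul, op_smul_eq_mul, mul_assoc])

lemma eq_top_of_e_mem {v : V} {L : Submodule D.Algᵐᵒᵖ (D.P v)}
    (h : (⟨D.e v, e_mem_P two_le v⟩ : D.P v) ∈ L) : L = ⊤ := by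
  refine eq_top_iff.2 fun z _ => ?_
  have : z = MulOpposite.op (z : D.Alg) • (⟨D.e v, e_mem_P two_le v⟩ : D.P v) := by
    refine Subtype.ext ?_
    change (z : D.Alg) = MulOpposite.op (z : D.Alg) • D.e v
    rw [op_smul_eq_mul, (mem_P two_le).1 z.2]
  rw [this]
  exact L.smul_mem _ h

/-- A preimage `y` of the generator determines the lift `z ↦ y · z`, because `e_v · z = z` on `P_v`.
-/
lemma projective_P (v : V) : Module.Projective D.Algᵐᵒᵖ (D.P v) := by
  refine Module.Projective.of_lifting_property'' fun φ hφ => ?_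
  obtain ⟨y, hy⟩ := hφ ⟨D.e v, e_mem_P two_le v⟩
  refine ⟨⟨⟨fun z => MulOpposite.op (z : D.Alg) • y, fun z w => ?_⟩, fun r z => ?_⟩, ?_⟩
  · change MulOpposite.op ((z : D.Alg) + w) • y = _
    rw [MulOpposite.op_add, add_smul]
  · change MulOpposite.op (r • (z : D.Alg)) • y = r • MulOpposite.op (z : D.Alg) • y
    rw [smul_smul]
    rfl
  · ext z
    change ((φ (MulOpposite.op (z : D.Alg) • y) : D.P v) : D.Alg) = z
    rw [map_smul, hy]
    change MulOpposite.op (z : D.Alg) • D.e v = _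
    rw [op_smul_eq_mul, (mem_P two_le).1 z.2]

omit two_le in
lemma finite_P (v : V) : Module.Finite D.Algᵐᵒᵖ (D.P v) :=
  Module.Finite.span_singleton _ _

end

variable (D) in
/-- The right ideal generated by the arrows. -/
def arrowIdeal : Submodule D.Algᵐᵒᵖ D.Alg := Submodule.span _ (Set.range D.x)

lemma mul_mem_arrowIdeal {y : D.Alg} (hy : y ∈ D.arrowIdeal) (z : D.Alg) :
    y * z ∈ D.arrowIdeal := D.arrowIdeal.smul_mem (MulOpposite.op z) hy

lemma x_mem_arrowIdeal (b : E) : D.x b ∈ D.arrowIdeal := Submodule.subset_span ⟨b, rfl⟩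

lemma smul_mem_arrowIdeal {y : D.Alg} (hy : y ∈ D.arrowIdeal) (r : K) :
    r • y ∈ D.arrowIdeal := by
  rw [Algebra.smul_def, Algebra.commutes]
  exact mul_mem_arrowIdeal hy _

lemma pathProd_mem_arrowIdeal (b : E) (k : ℕ) : D.pathProd D.x b (k + 1) ∈ D.arrowIdeal := by
  rw [pathProd_succ']
  exact mul_mem_arrowIdeal (x_mem_arrowIdeal b) _

section
include two_le

lemma e_mul_mem_arrowIdeal (v : V) {y : D.Alg} (hy : y ∈ D.arrowIdeal) :
    D.e v * y ∈ D.arrowIdeal := by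
  induction hy using Submodule.span_induction with
  | mem y hy =>
    obtain ⟨b, rfl⟩ := hy
    by_cases hb : v = D.src b
    · rw [hb, (D.relSystem_alg two_le).src_mul]
      exact x_mem_arrowIdeal b
    · rw [(D.relSystem_alg two_le).mul_src_of_ne hb]
      exact zero_mem _
  | zero => rw [mul_zero]; exact zero_mem _
  | add y z _ _ hy hz => rw [mul_add]; exact add_mem hy hz
  | smul r y _ hy => rw [mul_smul_comm]; exact D.arrowIdeal.smul_mem r hy

end

namespace ArrowFiltration

variable {v : V} {N : ℕ} {G : ℕ → Submodule K D.Alg} (F : D.ArrowFiltration D.e D.x v N G)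
include F

lemma mul_mem_succ {k : ℕ} {y z : D.Alg} (hy : y ∈ G k) (hz : z ∈ D.arrowIdeal) :
    y * z ∈ G (k + 1) := by
  induction hz using Submodule.span_induction with
  | mem z hz =>
    obtain ⟨b, rfl⟩ := hz
    exact F.mul_arrow _ _ _ hy
  | zero => rw [mul_zero]; exact zero_mem _
  | add z w _ _ hz hw => rw [mul_add]; exact add_mem hz hw
  | smul r z _ hz =>
    rw [← MulOpposite.op_unop r, op_smul_eq_mul, ← mul_assoc]
    exact F.mul_mem D.adjoin_alg hz _

lemma mul_pow_mem {y : D.Alg} (hy : y ∈ D.arrowIdeal) (k : ℕ) : D.e v * y ^ k ∈ G k := by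
  induction k with
  | zero => rw [pow_zero, mul_one]; exact F.mem_zero
  | succ k ih => rw [pow_succ, ← mul_assoc]; exact F.mul_mem_succ ih hy

include two_le

lemma isNilpotent {y : D.Alg} (hy : y ∈ D.arrowIdeal) (hyP : y ∈ D.P v) : IsNilpotent y := by
  refine ⟨N + 1, ?_⟩
  have h1 := F.mul_pow_mem hy N
  rw [F.eq_bot, Submodule.mem_bot] at h1
  rw [pow_succ', ← (mem_P two_le).1 hyP]
  by_cases hN : N = 0
  · subst hN
    rw [pow_zero, mul_one] at h1 ⊢
    rw [h1, zero_mul]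
  · obtain ⟨M, rfl⟩ := Nat.exists_eq_succ_of_ne_zero hN
    have h3 : D.e v * y ^ (M + 1) = y ^ (M + 1) := by
      rw [pow_succ', ← mul_assoc, (mem_P two_le).1 hyP]
    rw [Nat.succ_eq_add_one, h3] at h1
    rw [(mem_P two_le).1 hyP, Nat.succ_eq_add_one, h1, mul_zero]

/-- Here `l = e_v (1 - n)` with `n` nilpotent, so a right inverse of `1 - n` recovers `e_v` from
`l`. -/
lemma eq_top_of_add_mem {L : Submodule D.Algᵐᵒᵖ (D.P v)} {n l : D.P v}
    (hn : (n : D.Alg) ∈ D.arrowIdeal) (hl : l ∈ L) (he : (n : D.Alg) + l = D.e v) : L = ⊤ := by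
  refine eq_top_of_e_mem two_le ?_
  obtain ⟨s, hs⟩ := (F.isNilpotent two_le hn n.2).isUnit_one_sub.exists_right_inv
  have : (⟨D.e v, e_mem_P two_le v⟩ : D.P v) = MulOpposite.op s • l := by
    refine Subtype.ext ?_
    change D.e v = MulOpposite.op s • (l : D.Alg)
    have h1 : (l : D.Alg) = D.e v * (1 - n) := by
      rw [mul_sub, mul_one, (mem_P two_le).1 n.2, ← he, add_sub_cancel_left]
    rw [op_smul_eq_mul, h1, mul_assoc, hs, mul_one]
  rw [this]
  exact L.smul_mem _ hl

lemma isSuperfluous {N' : Submodule D.Algᵐᵒᵖ (D.P v)}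
    (h : ∀ y ∈ N', (y : D.Alg) ∈ D.arrowIdeal) : IsSuperfluous N' := by
  intro L hL
  have he : (⟨D.e v, e_mem_P two_le v⟩ : D.P v) ∈ N' ⊔ L := hL ▸ Submodule.mem_top
  obtain ⟨n, hn, l, hl, hnl⟩ := Submodule.mem_sup.1 he
  exact F.eq_top_of_add_mem two_le (h n hn) hl (congrArg Subtype.val hnl)

/-- The arrow part of `P_v` is maximal, and, being superfluous, it is contained in every maximal
submodule. -/
lemma jacobson_eq (hdec : ∀ y ∈ D.P v, ∃ r : K, y - r • D.e v ∈ D.arrowIdeal)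
    (hne : D.e v ∉ D.arrowIdeal) :
    Module.jacobson D.Algᵐᵒᵖ (D.P v) = D.arrowIdeal.comap (D.P v).subtype := by
  set J : Submodule D.Algᵐᵒᵖ (D.P v) := D.arrowIdeal.comap (D.P v).subtype with hJ
  have hsup : IsSuperfluous J := F.isSuperfluous two_le fun y hy => hy
  have hco : IsCoatom J := by
    refine ⟨?_, fun L hL => ?_⟩
    · intro h1
      have : (⟨D.e v, e_mem_P two_le v⟩ : D.P v) ∈ J := h1 ▸ Submodule.mem_top
      exact hne this
    · obtain ⟨y, hyL, hyJ⟩ := SetLike.exists_of_lt hL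
      obtain ⟨r, hr⟩ := hdec y y.2
      have hr0 : r ≠ 0 := by
        rintro rfl
        rw [zero_smul, sub_zero] at hr
        exact hyJ hr
      refine F.eq_top_of_add_mem two_le (L := L)
        (n := -(MulOpposite.op (algebraMap K D.Alg r⁻¹) • y - ⟨D.e v, e_mem_P two_le v⟩))
        (l := MulOpposite.op (algebraMap K D.Alg r⁻¹) • y) ?_ (L.smul_mem _ hyL) ?_
      · have h1 : ((-(MulOpposite.op (algebraMap K D.Alg r⁻¹) • y - ⟨D.e v, e_mem_P two_le v⟩) :
            D.P v) : D.Alg) = -(r⁻¹ • ((y : D.Alg) - r • D.e v)) := by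
          change -(MulOpposite.op (algebraMap K D.Alg r⁻¹) • (y : D.Alg) - D.e v) = _
          rw [op_smul_eq_mul, ← Algebra.commutes, ← Algebra.smul_def, smul_sub,
            inv_smul_smul₀ hr0]
        rw [h1]
        exact neg_mem (smul_mem_arrowIdeal hr _)
      · change -(MulOpposite.op (algebraMap K D.Alg r⁻¹) • (y : D.Alg) - D.e v) +
          MulOpposite.op (algebraMap K D.Alg r⁻¹) • (y : D.Alg) = _
        abel
  refine le_antisymm (sInf_le hco) (le_sInf fun L hL => ?_)
  by_contra h1
  have h2 : J ⊔ L = ⊤ := by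
    refine hL.2 _ (lt_of_le_of_ne le_sup_right fun h3 => h1 ?_)
    rw [h3]
    exact le_sup_left
  exact hL.1 (hsup L h2)

end ArrowFiltration

/-! ### Injectivity from a nondegenerate pairing -/

/-- The pairing identifies `P_v` with the dual of `Λ e_v`. A map into it amounts to a linear
functional, and functionals extend along injections of vector spaces. -/
lemma injective_P_of_pairing (v : V) (φ : D.Alg →ₗ[K] K)
    (hnondeg : ∀ y ∈ D.P v, (∀ t, t * D.e v = t → φ (y * t) = 0) → y = 0)
    (hsurj : ∀ θ : D.Alg →ₗ[K] K, ∃ y ∈ D.P v, ∀ t, t * D.e v = t → φ (y * t) = θ t) :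
    Module.Injective D.Algᵐᵒᵖ (D.P v) := by
  refine ⟨fun X Y _ _ _ _ f hf g => ?_⟩
  let _ : Module K X := Module.compHom X (algebraMap K D.Algᵐᵒᵖ)
  let _ : Module K Y := Module.compHom Y (algebraMap K D.Algᵐᵒᵖ)
  have hsX (r : K) (z : X) : r • z = algebraMap K D.Algᵐᵒᵖ r • z := rfl
  have hsY (r : K) (z : Y) : r • z = algebraMap K D.Algᵐᵒᵖ r • z := rfl
  have hsA (r : K) (z : D.Alg) : algebraMap K D.Algᵐᵒᵖ r • z = r • z := by
    change z * algebraMap K D.Alg r = _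
    rw [← Algebra.commutes, ← Algebra.smul_def]
  let fK : X →ₗ[K] Y :=
    { toFun := f, map_add' := f.map_add, map_smul' := fun r z => f.map_smul _ z }
  let gK : X →ₗ[K] K :=
    { toFun := fun z => φ (g z)
      map_add' := fun z w => by rw [map_add, Submodule.coe_add, map_add]
      map_smul' := fun r z => by
        rw [hsX, map_smul, Submodule.coe_smul, hsA, map_smul, RingHom.id_apply] }
  -- A `K`-linear retraction is enough; linearity over the algebra is restored by the uniqueness of
  -- representing elements.
  obtain ⟨s, hs⟩ := fK.exists_leftInverse_of_injective (LinearMap.ker_eq_bot.2 hf)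
  have hs' (z : X) : s (f z) = z := LinearMap.congr_fun hs z
  let θ (y : Y) : D.Alg →ₗ[K] K :=
    { toFun := fun t => gK (s (MulOpposite.op t • y))
      map_add' := fun t t' => by rw [MulOpposite.op_add, add_smul, map_add, map_add]
      map_smul' := fun r t => by
        have : MulOpposite.op (r • t) • y = r • (MulOpposite.op t • y) := by
          rw [hsY, smul_smul, ← Algebra.smul_def]
          rfl
        rw [this, map_smul, map_smul, RingHom.id_apply] }
  -- `h y` represents the functional `t ↦ φ (g (s (y · t)))` on `Λ e_v`.
  choose h hP ht using fun y => hsurj (θ y)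
  have huniq {z w : D.Alg} (hz : z ∈ D.P v) (hw : w ∈ D.P v)
      (hzw : ∀ t, t * D.e v = t → φ (z * t) = φ (w * t)) : z = w := by
    refine sub_eq_zero.1 (hnondeg _ (sub_mem hz hw) fun t ht => ?_)
    rw [sub_mul, map_sub, hzw t ht, sub_self]
  refine ⟨⟨⟨fun y => ⟨h y, hP y⟩, fun y z => Subtype.ext ?_⟩, fun r y => Subtype.ext ?_⟩,
    fun z => Subtype.ext ?_⟩
  · refine huniq (hP _) (add_mem (hP y) (hP z)) fun t ht' => ?_
    change φ (h (y + z) * t) = φ ((h y + h z) * t)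
    rw [add_mul, map_add, ht _ _ ht', ht _ _ ht', ht _ _ ht']
    change gK (s (_ • (y + z))) = gK (s (_ • y)) + gK (s (_ • z))
    rw [smul_add, map_add, map_add]
  · refine huniq (hP _) ((D.P v).smul_mem r (hP y)) fun t ht' => ?_
    have h1 : r • h y * t = h y * (r.unop * t) := by
      rw [← MulOpposite.op_unop r, op_smul_eq_mul, mul_assoc]
      rfl
    change φ (h (r • y) * t) = φ (r • h y * t)
    rw [h1, ht _ _ ht', ht _ _ (by rw [mul_assoc, ht'])]
    change gK (s (_ • r • y)) = gK (s (_ • y))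
    rw [smul_smul]
    rfl
  · refine huniq (hP _) (g z).2 fun t ht' => ?_
    change φ (h (f z) * t) = φ ((g z : D.Alg) * t)
    rw [ht _ _ ht']
    change gK (s (MulOpposite.op t • f z)) = _
    rw [← map_smul, hs']
    change φ (g (MulOpposite.op t • z)) = _
    rw [map_smul]
    rfl

end WeightedTriangulationQuiver

/-! ### Coordinates, and the socle of `P_i`. -/

namespace WeightedTriangulationQuiver

variable {K : Type*} [Field K] {V : Type*} {E : Type*} {D : WeightedTriangulationQuiver K V E}
  [Fintype V]

omit [Fintype V] in
lemma map_pathProd {R S F : Type*} [Ring R] [Ring S] [FunLike F R S] [RingHomClass F R S] (φ : F)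
    (X : E → R) (b : E) (k : ℕ) : φ (D.pathProd X b k) = D.pathProd (fun b => φ (X b)) b k := by
  rw [pathProd, map_list_prod, List.map_map]
  rfl

section Coordinates

variable {I : Type*} {vtx : I → V} {act : E → I → (I →₀ K)}

/-- The image of a basis vector under the right action of the weighted surface algebra. -/
def coord (two_le : ∀ b, 2 ≤ D.weight b)
    (h : D.RelSystem (fun v => MulOpposite.op (vtxProj vtx v : Module.End K (I →₀ K)))
      (fun b => MulOpposite.op (actLin act b : Module.End K (I →₀ K)))) (y : I) :
    D.Alg →ₗ[K] (I →₀ K) where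
  toFun z := (h.lift two_le z).unop (Finsupp.single y 1)
  map_add' z w := by rw [map_add]; rfl
  map_smul' r z := by rw [map_smul]; rfl

variable {two_le : ∀ b, 2 ≤ D.weight b}
    {h : D.RelSystem (fun v => MulOpposite.op (vtxProj vtx v : Module.End K (I →₀ K)))
      (fun b => MulOpposite.op (actLin act b : Module.End K (I →₀ K)))}

lemma coord_mul (y : I) (z w : D.Alg) :
    coord two_le h y (z * w) = (h.lift two_le w).unop (coord two_le h y z) := by
  change (h.lift two_le (z * w)).unop _ = (h.lift two_le w).unop ((h.lift two_le z).unop _)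
  rw [map_mul]
  rfl

lemma coord_mul_x (y : I) (z : D.Alg) (b : E) :
    coord two_le h y (z * D.x b) = actLin act b (coord two_le h y z) := by
  rw [coord_mul, h.lift_x]
  rfl

lemma coord_mul_pathProd (y : I) (z : D.Alg) (b : E) (k : ℕ) :
    coord two_le h y (z * D.pathProd D.x b k) = D.pathAct act b k (coord two_le h y z) := by
  rw [coord_mul, map_pathProd]
  simp only [h.lift_x]
  rw [pathProd_op_actLin]
  rfl

lemma coord_one (y : I) : coord two_le h y 1 = Finsupp.single y 1 := by
  change (h.lift two_le 1).unop _ = _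
  rw [map_one]
  rfl

lemma coord_x (y : I) (b : E) : coord two_le h y (D.x b) = act b y := by
  rw [← one_mul (D.x b), coord_mul_x, coord_one, actLin_single, one_smul]

lemma coord_pathProd (y : I) (b : E) (k : ℕ) :
    coord two_le h y (D.pathProd D.x b k) = D.pathAct act b k (Finsupp.single y 1) := by
  rw [← one_mul (D.pathProd D.x b k), coord_mul_pathProd, coord_one]

lemma coord_e {y : I} {v : V} (hv : vtx y = v) :
    coord two_le h y (D.e v) = Finsupp.single y 1 := by
  change (h.lift two_le (D.e v)).unop _ = _
  rw [h.lift_e]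
  exact vtxProj_single_of_eq vtx hv 1

lemma coord_e_mul {y : I} {v : V} (hv : vtx y = v) (z : D.Alg) :
    coord two_le h y (D.e v * z) = coord two_le h y z := by
  rw [coord_mul, coord_e hv]
  rfl

end Coordinates

namespace NearVirtualLoop

variable {a : E} (H : D.NearVirtualLoop a)
include H

/-- The coordinates of elements of the projective module at the virtual loop. -/
def srcCoord : D.Alg →ₗ[K] (Option ℕ →₀ K) := coord H.two_le (relSystem_srcAct H) (some 0)

/-- The coordinates of elements of the projective module at the end point of `a`. -/
def tgtCoord : D.Alg →ₗ[K] (ℕ ⊕ ℕ →₀ K) := coord H.two_le (relSystem_tgtAct H) (Sum.inl 0)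

lemma srcCoord_e : H.srcCoord (D.e (D.src a)) = srcVec K 0 := coord_e rfl

lemma srcCoord_e_mul (z : D.Alg) : H.srcCoord (D.e (D.src a) * z) = H.srcCoord z :=
  coord_e_mul rfl z

lemma srcCoord_mul_x (z : D.Alg) (b : E) :
    H.srcCoord (z * D.x b) = actLin (D.srcAct a) b (H.srcCoord z) := coord_mul_x _ _ _

lemma srcCoord_pathProd {k : ℕ} (hk : k ≤ D.weight a) :
    H.srcCoord (D.pathProd D.x a k) = srcVec K k := by
  rw [srcCoord, coord_pathProd]
  have := pathAct_srcAct (D := D) (a := a) H (k := 0) (l := k) (by omega)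
  simp only [zero_add] at this
  exact this

lemma srcCoord_loop : H.srcCoord (D.x (D.bar a)) = loopVec K := by
  rw [srcCoord, coord_x, srcAct_zero_loop]

lemma tgtCoord_pathProd_g {k : ℕ} (hk : k ≤ D.weight a) :
    H.tgtCoord (D.pathProd D.x (D.g a) k) = gVec K k := by
  rw [tgtCoord, coord_pathProd]
  have := pathAct_gVec (D := D) (a := a) (k := 0) (l := k) (by omega)
  simp only [zero_add] at this
  exact this

/-- The index of the basis vector of the path of length `k` starting with `f a`. -/
def fIdx (_ : D.NearVirtualLoop a) (k : ℕ) : ℕ ⊕ ℕ :=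
  if k < D.weight a then Sum.inr k else Sum.inl (D.weight a)

lemma tgtCoord_pathProd_f {k : ℕ} (hk : k + 1 ≤ D.weight a) :
    H.tgtCoord (D.pathProd D.x (D.f a) (k + 1)) = Finsupp.single (H.fIdx (k + 1)) 1 := by
  have h4 := H.four_le
  rw [fIdx]
  split_ifs with hk'
  · rw [tgtCoord, coord_pathProd, pathAct_succ_single, tgtAct_zero_f, H.g_f]
    have := pathAct_fVec (D := D) (a := a) (k := 0) (l := k) (by omega)
    rw [show 0 + 1 + k = k + 1 by omega] at this
    exact this
  · obtain rfl : k = D.weight a - 1 := by omega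
    rw [show D.weight a - 1 + 1 = D.weight a by omega,
      (D.relSystem_alg H.two_le).pathProd_f_weight H, tgtCoord_pathProd_g H le_rfl]

omit [Fintype V] in
lemma fIdx_injOn {k l : ℕ} (hk : k ≤ D.weight a) (hl : l ≤ D.weight a)
    (h : H.fIdx k = H.fIdx l) : k = l := by
  unfold fIdx at h
  split_ifs at h with h1 h2 h2
  · exact Sum.inr_injective h
  · omega

lemma mem_P_src_iff {y : D.Alg} :
    y ∈ D.P (D.src a) ↔ y ∈ (D.relSystem_alg H.two_le).srcFiltration a 0 := by
  rw [mem_P H.two_le]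
  constructor
  · intro hy
    rw [← hy]
    exact ((D.relSystem_alg H.two_le).arrowFiltration_src H).vertex_mul_mem D.adjoin_alg y
  · intro hy
    suffices (D.relSystem_alg H.two_le).srcFiltration a 0 ≤
        LinearMap.eqLocus (LinearMap.mulLeft K (D.e (D.src a))) LinearMap.id from this hy
    refine Submodule.span_le.2 ?_
    rintro _ (⟨l, -, rfl⟩ | ⟨-, rfl⟩)
    · change D.e _ * (_ * _) = _
      rw [← mul_assoc, (D.relSystem_alg H.two_le).idem]
      rfl
    · change D.e _ * _ = _
      rw [← D.src_bar, (D.relSystem_alg H.two_le).src_mul]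
      rfl

lemma mem_P_tgt_iff {y : D.Alg} :
    y ∈ D.P (D.tgt a) ↔ y ∈ (D.relSystem_alg H.two_le).tgtFiltration a 0 := by
  rw [mem_P H.two_le]
  constructor
  · intro hy
    rw [← hy]
    exact ((D.relSystem_alg H.two_le).arrowFiltration_tgt H).vertex_mul_mem D.adjoin_alg y
  · intro hy
    suffices (D.relSystem_alg H.two_le).tgtFiltration a 0 ≤
        LinearMap.eqLocus (LinearMap.mulLeft K (D.e (D.tgt a))) LinearMap.id from this hy
    refine Submodule.span_le.2 ?_
    rintro _ (⟨l, -, rfl⟩ | ⟨l, -, rfl⟩) <;>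
    · change D.e _ * (_ * _) = _
      rw [← mul_assoc, (D.relSystem_alg H.two_le).idem]
      rfl

lemma exists_sub_smul_e_mem {y : D.Alg} (hy : y ∈ D.P (D.src a)) :
    ∃ r : K, y - r • D.e (D.src a) ∈ D.arrowIdeal := by
  rw [H.mem_P_src_iff] at hy
  induction hy using Submodule.span_induction with
  | mem y hy =>
    obtain ⟨l, -, rfl⟩ | ⟨-, rfl⟩ := hy
    · cases l with
      | zero => exact ⟨1, by rw [pathProd_zero, mul_one, one_smul, sub_self]; exact zero_mem _⟩
      | succ l =>
        refine ⟨0, ?_⟩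
        rw [(D.relSystem_alg H.two_le).src_mul_pathProd, zero_smul, sub_zero]
        exact pathProd_mem_arrowIdeal _ _
    · exact ⟨0, by rw [zero_smul, sub_zero]; exact x_mem_arrowIdeal _⟩
  | zero => exact ⟨0, by rw [zero_smul, sub_zero]; exact zero_mem _⟩
  | add y z _ _ hy hz =>
    obtain ⟨r, hr⟩ := hy
    obtain ⟨s, hs⟩ := hz
    refine ⟨r + s, ?_⟩
    rw [add_smul, add_sub_add_comm]
    exact add_mem hr hs
  | smul t y _ hy =>
    obtain ⟨r, hr⟩ := hy
    refine ⟨t * r, ?_⟩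
    rw [mul_smul, ← smul_sub]
    exact smul_mem_arrowIdeal hr _

/-- An idempotent in the arrow ideal would be nilpotent, hence zero, but `e_i` has a nonzero
coordinate. -/
lemma e_src_not_mem : D.e (D.src a) ∉ D.arrowIdeal := by
  intro h1
  have h2 := ((D.relSystem_alg H.two_le).arrowFiltration_src H).isNilpotent H.two_le h1
    (e_mem_P H.two_le _)
  have h3 : IsIdempotentElem (D.e (D.src a)) := (D.relSystem_alg H.two_le).idem _
  obtain ⟨k, hk⟩ := h2
  have h4 : D.e (D.src a) = 0 := by
    cases k with
    | zero =>
      rw [pow_zero] at hk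
      rw [← mul_one (D.e _), hk, mul_zero]
    | succ k => rwa [h3.pow_succ_eq] at hk
  have h5 := H.srcCoord_e
  rw [h4, map_zero] at h5
  exact one_ne_zero ((Finsupp.single_eq_zero (b := (1 : K))).1 h5.symm)

/-! ### The socle -/

/-- The socle element of the projective module at the virtual loop. -/
def soc (_ : D.NearVirtualLoop a) : D.Alg := D.pathProd D.x a (D.weight a)

lemma e_mul_soc : D.e (D.src a) * H.soc = H.soc := by
  obtain ⟨k, hk⟩ : ∃ k, D.weight a = k + 1 := ⟨D.weight a - 1, by have := H.four_le; omega⟩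
  rw [soc, hk, (D.relSystem_alg H.two_le).src_mul_pathProd]

lemma soc_eq : H.soc = ((D.c a)⁻¹ * D.c (D.bar a)) • (D.x (D.bar a) * D.x (D.bar a)) :=
  (D.relSystem_alg H.two_le).pathProd_weight H

lemma soc_mul_e : H.soc * D.e (D.src a) = H.soc := by
  rw [soc_eq, smul_mul_assoc, mul_assoc, ← tgt_bar_a H, (D.relSystem_alg H.two_le).mul_tgt]

lemma srcCoord_soc : H.srcCoord H.soc = srcVec K (D.weight a) := H.srcCoord_pathProd le_rfl

lemma soc_ne_zero : H.soc ≠ 0 := by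
  intro h
  have h1 := H.srcCoord_soc
  rw [h, map_zero] at h1
  exact one_ne_zero ((Finsupp.single_eq_zero (b := (1 : K))).1 h1.symm)

lemma soc_mul_x (b : E) : H.soc * D.x b = 0 := by
  have h1 := ((D.relSystem_alg H.two_le).arrowFiltration_src H).mul_arrow (D.weight a) _ b
    (by simpa using (D.relSystem_alg H.two_le).mem_srcFiltration (a := a) (le_refl (D.weight a)))
  rw [((D.relSystem_alg H.two_le).arrowFiltration_src H).eq_bot, Submodule.mem_bot] at h1
  have h2 : D.e (D.src a) * D.pathProd D.x a (D.weight a) = H.soc := H.e_mul_soc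
  rwa [h2] at h1

lemma soc_mul_of_mem {y : D.Alg} (hy : y ∈ D.arrowIdeal) : H.soc * y = 0 := by
  induction hy using Submodule.span_induction with
  | mem y hy =>
    obtain ⟨b, rfl⟩ := hy
    exact H.soc_mul_x b
  | zero => rw [mul_zero]
  | add y z _ _ hy hz => rw [mul_add, hy, hz, add_zero]
  | smul r y _ hy => rw [mul_smul_comm, hy, smul_zero]

/-- The element of the projective module at the virtual loop with given coordinates. -/
def srcElem (_ : D.NearVirtualLoop a) : (Option ℕ →₀ K) →ₗ[K] D.Alg :=
  Finsupp.linearCombination K fun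
    | some k => D.e (D.src a) * D.pathProd D.x a k
    | none => D.x (D.bar a)

lemma srcElem_srcCoord {y : D.Alg} (hy : y ∈ D.P (D.src a)) : H.srcElem (H.srcCoord y) = y := by
  rw [H.mem_P_src_iff] at hy
  suffices (D.relSystem_alg H.two_le).srcFiltration a 0 ≤
      LinearMap.eqLocus (H.srcElem ∘ₗ H.srcCoord) LinearMap.id from this hy
  refine Submodule.span_le.2 ?_
  rintro _ (⟨l, -, rfl⟩ | ⟨-, rfl⟩)
  · change H.srcElem (H.srcCoord _) = _
    by_cases hl : l ≤ D.weight a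
    · rw [srcCoord_e_mul, H.srcCoord_pathProd hl, srcElem, Finsupp.linearCombination_single,
        one_smul]
      rfl
    · rw [(D.relSystem_alg H.two_le).pathProd_eq_zero H (by omega), mul_zero, map_zero, map_zero,
        map_zero]
  · change H.srcElem (H.srcCoord _) = _
    rw [srcCoord_loop, srcElem, Finsupp.linearCombination_single, one_smul]
    rfl

-- No other basis vector contributes to this coefficient, so an element killed by the arrow has no
-- component at `some k`.
omit [Fintype V] in
lemma actLin_iterate_apply {k : ℕ} (hk : k < D.weight a) (w : Option ℕ →₀ K) :
    actLin (D.srcAct a) (D.g^[k] a) w (some (k + 1)) = w (some k) := by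
  have h4 := H.four_le
  suffices Finsupp.lapply (some (k + 1)) ∘ₗ actLin (D.srcAct a) (D.g^[k] a) =
    (Finsupp.lapply (some k) : (Option ℕ →₀ K) →ₗ[K] K) from LinearMap.congr_fun this w
  refine Finsupp.lhom_ext' fun y => LinearMap.ext_ring ?_
  simp only [LinearMap.comp_apply, Finsupp.lsingle_apply, actLin_single, one_smul,
    Finsupp.lapply_apply]
  match y with
  | some l =>
    by_cases hl : l = k
    · subst hl
      rw [srcAct_iterate hk, Finsupp.single_eq_same, Finsupp.single_eq_same]
    · rw [Finsupp.single_eq_of_ne (by simpa using Ne.symm hl)]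
      simp only [srcAct]
      split_ifs
      · exact Finsupp.single_eq_of_ne (by simpa using Ne.symm hl)
      · exact Finsupp.single_eq_of_ne (by simp)
      · rw [Finsupp.smul_apply, Finsupp.single_eq_of_ne (by simp), smul_zero]
      · rfl
  | none =>
    rw [Finsupp.single_eq_of_ne (by simp)]
    simp only [srcAct]
    split_ifs with h1 h2
    · rw [Finsupp.smul_apply, Finsupp.single_eq_of_ne, smul_zero]
      intro h3
      rw [Option.some_inj] at h3
      -- The loop vector contributes only if `g^[k] a = a` with `k + 2 = w`, which would give `g (g
      -- a) = a`.
      have h5 : D.g (D.g (D.g^[k] a)) = a := by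
        rw [D.g_iterate, D.g_iterate, show k + 1 + 1 = D.weight a by omega, D.iterate_weight]
      rw [h1] at h5
      exact H.g_g_ne h5
    · exact absurd h2.symm (H.bar_ne_iterate k)
    · rfl

omit [Fintype V] in
lemma actLin_bar_apply (w : Option ℕ →₀ K) : actLin (D.srcAct a) (D.bar a) w (some (D.weight a)) =
    (D.c (D.bar a))⁻¹ * D.c a * w none := by
  suffices Finsupp.lapply (some (D.weight a)) ∘ₗ actLin (D.srcAct a) (D.bar a) =
    ((D.c (D.bar a))⁻¹ * D.c a) • (Finsupp.lapply none : (Option ℕ →₀ K) →ₗ[K] K) from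
      LinearMap.congr_fun this w
  refine Finsupp.lhom_ext' fun y => LinearMap.ext_ring ?_
  simp only [LinearMap.comp_apply, Finsupp.lsingle_apply, actLin_single, one_smul,
    Finsupp.lapply_apply, LinearMap.smul_apply, smul_eq_mul]
  match y with
  | some l =>
    rw [Finsupp.single_eq_of_ne (by simp), mul_zero]
    simp only [srcAct]
    split_ifs with h1
    · exact absurd h1.2 (H.bar_ne_iterate l)
    · exact Finsupp.single_eq_of_ne (by simp)
    · rw [Finsupp.smul_apply, Finsupp.single_eq_of_ne (by simp), smul_zero]
    · rfl
  | none =>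
    rw [srcAct_loop_loop, Finsupp.smul_apply, Finsupp.single_eq_same, Finsupp.single_eq_same,
      smul_eq_mul]

/-- Each arrow of the `g`-cycle detects one path coordinate below `w`, and `bar a` detects the loop
coordinate; only the full turn is left. -/
lemma eq_smul_soc {y : D.Alg} (hy : y ∈ D.P (D.src a)) (h0 : ∀ b, y * D.x b = 0) :
    y = H.srcCoord y (some (D.weight a)) • H.soc := by
  have h1 (k : ℕ) (hk : k < D.weight a) : H.srcCoord y (some k) = 0 := by
    rw [← H.actLin_iterate_apply hk, ← srcCoord_mul_x, h0, map_zero]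
    rfl
  have h2 : H.srcCoord y none = 0 := by
    have h3 := H.actLin_bar_apply (H.srcCoord y)
    rw [← srcCoord_mul_x, h0, map_zero] at h3
    exact (mul_eq_zero.1 h3.symm).resolve_left
      (mul_ne_zero (inv_ne_zero (D.c_ne_zero _)) (D.c_ne_zero _))
  conv_lhs => rw [← H.srcElem_srcCoord hy]
  rw [srcElem, Finsupp.linearCombination_apply, Finsupp.sum,
    Finset.sum_eq_single (some (D.weight a))]
  · rw [← H.e_mul_soc]
    rfl
  · rintro (_ | k) - hk
    · rw [h2, zero_smul]
    · rcases lt_trichotomy k (D.weight a) with h3 | h3 | h3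
      · rw [h1 k h3, zero_smul]
      · exact absurd (congrArg some h3) hk
      · change _ • (_ * D.pathProd D.x a k) = 0
        rw [(D.relSystem_alg H.two_le).pathProd_eq_zero H h3, mul_zero, smul_zero]
  · intro h3
    rw [Finsupp.notMem_support_iff.1 h3, zero_smul]

/-- Multiplication by arrows that do not kill the element raises its degree, so the process stops
before the filtration reaches zero. -/
lemma exists_mul_ne_zero (m : ℕ) : ∀ k, m + k = D.weight a + 1 → ∀ y,
    y ∈ (D.relSystem_alg H.two_le).srcFiltration a k → y ≠ 0 →
      ∃ t, y * t ≠ 0 ∧ ∀ b, y * t * D.x b = 0 := by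
  induction m with
  | zero =>
    rintro k hk y hy h0
    rw [zero_add] at hk
    rw [hk, ((D.relSystem_alg H.two_le).arrowFiltration_src H).eq_bot] at hy
    exact absurd ((Submodule.mem_bot K).1 hy) h0
  | succ m ih =>
    rintro k hk y hy h0
    by_cases hall : ∀ b, y * D.x b = 0
    · exact ⟨1, by rwa [mul_one], by rwa [mul_one]⟩
    · push Not at hall
      obtain ⟨b, hb⟩ := hall
      obtain ⟨t, ht, ht'⟩ := ih (k + 1) (by omega) _
        (((D.relSystem_alg H.two_le).arrowFiltration_src H).mul_arrow k y b hy) hb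
      exact ⟨D.x b * t, by rwa [← mul_assoc], by simpa only [mul_assoc] using ht'⟩

lemma exists_mul_eq_soc {y : D.Alg} (hy : y ∈ D.P (D.src a)) (h0 : y ≠ 0) :
    ∃ t, t * D.e (D.src a) = t ∧ y * t = H.soc := by
  obtain ⟨t, ht, ht'⟩ := H.exists_mul_ne_zero (D.weight a + 1) 0 (by omega) y
    (H.mem_P_src_iff.1 hy) h0
  have h1 := H.eq_smul_soc ((mem_P H.two_le).2 (by rw [← mul_assoc, (mem_P H.two_le).1 hy])) ht'
  set r := H.srcCoord (y * t) (some (D.weight a))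
  have hr : r ≠ 0 := by
    intro hr
    rw [hr, zero_smul] at h1
    exact ht h1
  refine ⟨r⁻¹ • t * D.e (D.src a), ?_, ?_⟩
  · rw [mul_assoc, (D.relSystem_alg H.two_le).idem]
  · rw [← mul_assoc, mul_smul_comm, h1, inv_smul_smul₀ hr, soc_mul_e]

end NearVirtualLoop

end WeightedTriangulationQuiver

lemma card_le_finrank_of_single {K A : Type*} [Field K] [AddCommGroup A] [Module K A]
    {W : Submodule K A} [FiniteDimensional K W] {ι I : Type*} [Fintype ι] (Ψ : A →ₗ[K] (I →₀ K))
    (v : ι → A) (hv : ∀ t, v t ∈ W) (idx : ι → I) (hidx : Function.Injective idx)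
    (h : ∀ t, Ψ (v t) = Finsupp.single (idx t) 1) : Fintype.card ι ≤ Module.finrank K W := by
  refine card_le_finrank_of_dual v hv (fun t => Finsupp.lapply (idx t) ∘ₗ Ψ) ?_ ?_
  · intro s t hst
    rw [LinearMap.comp_apply, h, Finsupp.lapply_apply, Finsupp.single_eq_of_ne (hidx.ne hst)]
  · intro t
    rw [LinearMap.comp_apply, h, Finsupp.lapply_apply, Finsupp.single_eq_same]
    exact one_ne_zero

/-! ### The maps of the exact sequence, their ranks, and the injectivity of `P_i`. -/

namespace WeightedTriangulationQuiver

variable {K : Type*} [Field K] {V : Type*} {E : Type*} {D : WeightedTriangulationQuiver K V E}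

/-- The cycle length divides four and is neither one nor two, because `g a ≠ a` and `g (g a) ≠ a`;
hence `n a = 4` and `m a = 1`. -/
lemma NearVirtualLoop.isSingularTriangle {a : E} (H : D.NearVirtualLoop a)
    (hloop : D.IsLoop (D.bar a)) (hw : D.weight a = 4) (hv : D.Virtual (D.f (D.g a)))
    (hc : D.c (D.bar a) * D.c a ^ 2 * D.c (D.f (D.g a)) = 1) : D.IsSingularTriangle := by
  have h1 := H.f_f_g
  rw [hw] at h1
  have hn : D.n a ≠ 1 ∧ D.n a ≠ 2 := by
    have h2 : D.g^[D.n a] a = a := Function.iterate_minimalPeriod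
    refine ⟨fun h3 => H.g_ne ?_, fun h3 => H.g_g_ne ?_⟩ <;> rw [h3] at h2 <;> exact h2
  have hmn : D.m a * D.n a = 4 := hw
  have hn4 : D.n a = 4 := by
    have h2 : D.n a ∣ 4 := ⟨D.m a, by rw [← hmn, mul_comm]⟩
    have h3 := Nat.le_of_dvd (by norm_num) h2
    have h4 := hn.1
    have h5 := hn.2
    generalize D.n a = n at *
    interval_cases n <;> omega
  refine ⟨a, hloop, H.virtual, ?_, hv, ?_, hn4, hc⟩
  -- `f (g a)` is a loop because `f (f (g a)) = g (g a)` when `w = 4`.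
  · change D.src _ = D.tgt _
    rw [← D.src_f (D.f (D.g a)), h1, D.src_f, ← D.src_g]
    rfl
  · rw [hn4] at hmn
    omega

variable [Fintype V]

namespace NearVirtualLoop

variable {a : E} (H : D.NearVirtualLoop a)
include H

omit [Fintype V] in
lemma tgt_f : D.tgt (D.f a) = D.src a := by
  rw [← D.src_f, H.f_f, D.src_bar]

lemma e_mul_x_f : D.e (D.tgt a) * D.x (D.f a) = D.x (D.f a) := by
  rw [← D.src_f, (D.relSystem_alg H.two_le).src_mul]

lemma x_f_mul_e : D.x (D.f a) * D.e (D.src a) = D.x (D.f a) := by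
  rw [← H.tgt_f, (D.relSystem_alg H.two_le).mul_tgt]

lemma e_mul_x_bar : D.e (D.src a) * D.x (D.bar a) = D.x (D.bar a) := by
  rw [← D.src_bar, (D.relSystem_alg H.two_le).src_mul]

/-- The relation which generates the kernel of left multiplication by `a`. -/
def mid (_ : D.NearVirtualLoop a) : D.Alg :=
  D.x (D.f a) * D.x a - (D.c (D.bar a) * D.c a) • D.pathProd D.x (D.g a) (D.weight a - 2)

lemma e_mul_mid : D.e (D.tgt a) * H.mid = H.mid := by
  have h4 := H.four_le
  obtain ⟨k, hk⟩ : ∃ k, D.weight a - 2 = k + 1 := ⟨D.weight a - 3, by omega⟩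
  rw [mid, mul_sub, ← mul_assoc, H.e_mul_x_f, mul_smul_comm, hk,
    (D.relSystem_alg H.two_le).tgt_mul_pathProd_g]

lemma mid_mul_e : H.mid * D.e (D.tgt a) = H.mid := by
  have h4 := H.four_le
  obtain ⟨k, hk⟩ : ∃ k, D.weight a - 2 = k + 1 := ⟨D.weight a - 3, by omega⟩
  have h1 : D.tgt (D.g^[k] (D.g a)) = D.tgt a := by
    rw [D.iterate_g, ← hk, ← D.src_f, H.f_iterate_pred_pred, D.src_g]
  rw [mid, sub_mul, mul_assoc, (D.relSystem_alg H.two_le).mul_tgt, smul_mul_assoc, hk,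
    pathProd_succ, mul_assoc]
  conv_lhs => rw [← h1, (D.relSystem_alg H.two_le).mul_tgt]

/-- Both terms of `mid` become the same multiple of `A a`. -/
lemma x_mul_mid : D.x a * H.mid = 0 := by
  have h4 := H.four_le
  have h1 : D.weight a - 1 = D.weight a - 2 + 1 := by omega
  rw [mid, mul_sub, ← mul_assoc, (D.relSystem_alg H.two_le).mul_f_a H, smul_mul_assoc,
    (D.relSystem_alg H.two_le).loop_mul_a H, mul_smul_comm, ← pathProd_succ', smul_smul, h1,
    sub_self]

/-- Both terms of `mid` become the same multiple of `A (g a)`, whose last arrow is `f a`. -/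
lemma mid_mul_x_f : H.mid * D.x (D.f a) = 0 := by
  have h4 := H.four_le
  have h1 : D.weight a - 1 = D.weight a - 2 + 1 := by omega
  have h2 : D.g^[D.weight a - 2] (D.g a) = D.f a := by
    rw [D.iterate_g, ← h1, H.iterate_pred]
  have h3 := D.pathProd_succ D.x (D.g a) (D.weight a - 2)
  rw [h2] at h3
  rw [mid, sub_mul, (D.relSystem_alg H.two_le).pathProd_f_two_mul_f H, smul_mul_assoc, ← h3, h1,
    sub_self]

lemma x_f_mul_soc : D.x (D.f a) * H.soc = 0 := by
  rw [soc_eq, mul_smul_comm, ← mul_assoc, (D.relSystem_alg H.two_le).f_mul_loop_mul_loop H,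
    smul_zero]

lemma x_f_mul_pathProd (k : ℕ) :
    D.x (D.f a) * D.pathProd D.x a k = D.pathProd D.x (D.f a) (k + 1) := by
  rw [pathProd_succ', H.g_f]

/-- The second term of `mid` followed by `g a` leaves its `g`-cycle, since `f (g^[w - 2] a) = g a`.
For `w ≥ 5` this is zero. For `w = 4` a virtual `f (g a)` gives the coefficient `1 - c_{bar a} c_a²
c_{f (g a)}`, which is nonzero outside the singular triangle algebra. -/
lemma exists_mid_mul_x_g (hloop : D.IsLoop (D.bar a)) (hsing : ¬ D.IsSingularTriangle) :
    ∃ r : K, r ≠ 0 ∧ H.mid * D.x (D.g a) = r • D.pathProd D.x (D.f a) 3 := by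
  have h4 := H.four_le
  have h := D.relSystem_alg H.two_le
  have h3 : D.x (D.f a) * D.x a * D.x (D.g a) = D.pathProd D.x (D.f a) 3 := by
    rw [pathProd_three, H.g_f]
  have hf := H.f_iterate_pred_pred
  rw [mid, sub_mul, h3, smul_mul_assoc]
  by_cases hw : D.weight a = 4
  · have h5 : D.pathProd D.x (D.g a) (D.weight a - 2) * D.x (D.g a) =
        D.x (D.g a) * D.x (D.g (D.g a)) * D.x (D.f (D.g (D.g a))) := by
      rw [hw] at hf ⊢
      have hf' : D.f (D.g (D.g a)) = D.g a := hf
      rw [hf', pathProd_succ, pathProd_one]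
      rfl
    obtain ⟨q, hq, hq'⟩ : ∃ q : K, 1 - D.c (D.bar a) * D.c a * q ≠ 0 ∧
        D.x (D.g a) * D.x (D.g (D.g a)) * D.x (D.f (D.g (D.g a))) =
          q • D.pathProd D.x (D.f a) (D.weight a - 1) := by
      refine ⟨_, ?_, h.pathProd_g_two_mul_f H⟩
      split_ifs with hv
      · intro h6
        refine hsing (H.isSingularTriangle hloop hw hv ?_)
        rw [sub_eq_zero.1 h6]
        ring
      · simp
    refine ⟨_, hq, ?_⟩
    rw [h5, hq', smul_smul, hw, sub_smul, one_smul]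
  -- Now `w ≥ 5`, so at least three arrows precede the departure from the `g`-cycle.
  · obtain ⟨k, hk⟩ : ∃ k, D.weight a - 2 = k + 3 := ⟨D.weight a - 5, by omega⟩
    refine ⟨1, one_ne_zero, ?_⟩
    have h6 := h.pathProd_g_mul_f H k
    rw [← hk, hf] at h6
    rw [h6, smul_zero, sub_zero, one_smul]

lemma mid_mul_pathProd {r : K} (hr : H.mid * D.x (D.g a) = r • D.pathProd D.x (D.f a) 3)
    (k : ℕ) : H.mid * D.pathProd D.x (D.g a) (k + 1) = r • D.pathProd D.x (D.f a) (k + 2 + 1) := by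
  have h1 : D.g^[3] (D.f a) = D.g (D.g a) := by
    change D.g (D.g (D.g (D.f a))) = _
    rw [H.g_f]
  rw [pathProd_succ', ← mul_assoc, hr, smul_mul_assoc, ← h1, ← pathProd_add,
    show 3 + k = k + 2 + 1 by omega]

lemma mid_mem_arrowIdeal : H.mid ∈ D.arrowIdeal := by
  have h4 := H.four_le
  obtain ⟨k, hk⟩ : ∃ k, D.weight a - 2 = k + 1 := ⟨D.weight a - 3, by omega⟩
  rw [mid, hk]
  exact sub_mem (mul_mem_arrowIdeal (x_mem_arrowIdeal _) _)
    (smul_mem_arrowIdeal (pathProd_mem_arrowIdeal _ _) _)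

lemma soc_mem_arrowIdeal : H.soc ∈ D.arrowIdeal := by
  have h4 := H.four_le
  obtain ⟨k, hk⟩ : ∃ k, D.weight a = k + 1 := ⟨D.weight a - 1, by omega⟩
  rw [soc, hk]
  exact pathProd_mem_arrowIdeal _ _

/-! ### Ranks and exactness -/

/-- The image contains the loop `bar a` and the paths of lengths `1` to `w` from `a`. -/
lemma le_finrank_map_x :
    D.weight a + 1 ≤ Module.finrank K
      (((D.relSystem_alg H.two_le).tgtFiltration a 0).map (LinearMap.mulLeft K (D.x a))) := by
  have h := D.relSystem_alg H.two_le
  have := (D.relSystem_alg H.two_le).finiteDimensional_tgtFiltration H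
  refine le_trans (by simp) (card_le_finrank_of_single (ι := Option (Fin (D.weight a)))
    H.srcCoord (fun | none => D.x (D.bar a) | some t => D.pathProd D.x a (t + 1)) ?_
    (fun | none => none | some t => some (t + 1)) ?_ ?_)
  · rintro (_ | t)
    · refine ⟨(D.c (D.bar a))⁻¹ • D.x (D.f a), Submodule.smul_mem _ _ ?_, ?_⟩
      · rw [← D.pathProd_one D.x (D.f a)]
        exact h.f_mem_tgtFiltration_succ (by omega)
      · rw [LinearMap.mulLeft_apply, mul_smul_comm, h.mul_f_a H, inv_smul_smul₀ (D.c_ne_zero _)]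
    · refine ⟨_, h.g_mem_tgtFiltration (a := a) (Nat.zero_le t), ?_⟩
      rw [LinearMap.mulLeft_apply, ← mul_assoc, h.mul_tgt, ← pathProd_succ']
  · rintro (_ | s) (_ | t) hst
    · rfl
    · simp at hst
    · simp at hst
    · simp only [Option.some_inj, Nat.add_right_cancel_iff] at hst
      rw [Fin.ext hst]
  · rintro (_ | t)
    · exact H.srcCoord_loop
    · exact H.srcCoord_pathProd (by omega)

lemma le_finrank_src :
    D.weight a + 2 ≤ Module.finrank K ((D.relSystem_alg H.two_le).srcFiltration a 0) := by
  have h := D.relSystem_alg H.two_le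
  have := (D.relSystem_alg H.two_le).finiteDimensional_srcFiltration H
  refine le_trans (by simp) (card_le_finrank_of_single (ι := Option (Fin (D.weight a + 1)))
    H.srcCoord (fun | none => D.x (D.bar a) | some t => D.e (D.src a) * D.pathProd D.x a t) ?_
    (fun | none => none | some t => some t) ?_ ?_)
  · rintro (_ | t)
    · exact h.bar_mem_srcFiltration (by omega)
    · exact h.mem_srcFiltration (Nat.zero_le _)
  · rintro (_ | s) (_ | t) hst
    · rfl
    · simp at hst
    · simp at hst
    · simp only [Option.some_inj] at hst
      rw [Fin.ext hst]
  · rintro (_ | t)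
    · exact H.srcCoord_loop
    · exact (H.srcCoord_e_mul _).trans (H.srcCoord_pathProd (by omega))

/-- The image contains `A (g a)`, from the loop `bar a`, and the paths of lengths `1` to `w` from `f
a`. -/
lemma le_finrank_map_x_f :
    D.weight a + 1 ≤ Module.finrank K
      (((D.relSystem_alg H.two_le).srcFiltration a 0).map (LinearMap.mulLeft K (D.x (D.f a)))) := by
  have h4 := H.four_le
  have h := D.relSystem_alg H.two_le
  have := (D.relSystem_alg H.two_le).finiteDimensional_srcFiltration H
  refine le_trans (by simp) (card_le_finrank_of_single (ι := Option (Fin (D.weight a)))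
    H.tgtCoord (fun
      | none => D.pathProd D.x (D.g a) (D.weight a - 1)
      | some t => D.pathProd D.x (D.f a) (t + 1)) ?_
    (fun | none => Sum.inl (D.weight a - 1) | some t => H.fIdx (t + 1)) ?_ ?_)
  · rintro (_ | t)
    · refine ⟨(D.c a)⁻¹ • D.x (D.bar a), Submodule.smul_mem _ _ ?_, ?_⟩
      · exact h.bar_mem_srcFiltration (by omega)
      · rw [LinearMap.mulLeft_apply, mul_smul_comm, h.f_mul_loop H, inv_smul_smul₀ (D.c_ne_zero _)]
    · refine ⟨_, h.mem_srcFiltration (a := a) (Nat.zero_le t), ?_⟩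
      rw [LinearMap.mulLeft_apply, ← mul_assoc, H.x_f_mul_e, H.x_f_mul_pathProd]
  · have hne (t : ℕ) : H.fIdx t ≠ Sum.inl (D.weight a - 1) := by
      unfold fIdx
      split_ifs
      · simp
      · intro h1
        have := Sum.inl_injective h1
        omega
    rintro (_ | s) (_ | t) hst
    · rfl
    · exact absurd hst.symm (hne _)
    · exact absurd hst (hne _)
    · have h1 := H.fIdx_injOn (by omega) (by omega) hst
      simp only [Nat.add_right_cancel_iff] at h1
      rw [Fin.ext h1]
  · rintro (_ | t)
    · exact H.tgtCoord_pathProd_g (by omega)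
    · exact H.tgtCoord_pathProd_f (by omega)

/-- The image contains `mid` and, as `r ≠ 0`, the paths of lengths `3` to `w` from `f a`. The first
term of `mid` supplies the missing length two. -/
lemma le_finrank_map_mid (hloop : D.IsLoop (D.bar a)) (hsing : ¬ D.IsSingularTriangle) :
    D.weight a - 1 ≤ Module.finrank K
      (((D.relSystem_alg H.two_le).tgtFiltration a 0).map (LinearMap.mulLeft K H.mid)) := by
  have h4 := H.four_le
  have h := D.relSystem_alg H.two_le
  have := (D.relSystem_alg H.two_le).finiteDimensional_tgtFiltration H
  obtain ⟨r, hr0, hr⟩ := H.exists_mid_mul_x_g hloop hsing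
  -- The second term of `mid` is invisible to the coordinates of the paths from `f a`.
  have hne (t : ℕ) : H.fIdx t ≠ Sum.inl (D.weight a - 2) := by
    unfold fIdx
    split_ifs
    · simp
    · intro h1
      have := Sum.inl_injective h1
      omega
  have hmid : H.tgtCoord H.mid = Finsupp.single (H.fIdx 2) 1 -
      (D.c (D.bar a) * D.c a) • gVec K (D.weight a - 2) := by
    have h1 : D.x (D.f a) * D.x a = D.pathProd D.x (D.f a) (1 + 1) := by
      rw [← H.x_f_mul_pathProd, pathProd_one]
    rw [mid, map_sub, map_smul, H.tgtCoord_pathProd_g (by omega), h1,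
      H.tgtCoord_pathProd_f (by omega)]
  have hval (s t : Fin (D.weight a - 1)) : H.tgtCoord (H.mid * D.pathProd D.x (D.g a) t)
      (H.fIdx (s + 2)) = if s = t then (if (t : ℕ) = 0 then 1 else r) else 0 := by
    have hinj : s ≠ t → H.fIdx (s + 2) ≠ H.fIdx (t + 2) := fun hst h1 => by
      have h2 := H.fIdx_injOn (by omega) (by omega) h1
      exact hst (Fin.ext (by omega))
    obtain ⟨t, ht⟩ := t
    match t with
    | 0 =>
      rw [pathProd_zero, mul_one, hmid, Finsupp.sub_apply, Finsupp.smul_apply,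
        Finsupp.single_eq_of_ne (hne _), smul_zero, sub_zero]
      by_cases hst : s = ⟨0, ht⟩
      · rw [if_pos hst, if_pos rfl, hst]
        exact Finsupp.single_eq_same
      · rw [if_neg hst]
        exact Finsupp.single_eq_of_ne (hinj hst)
    | t + 1 =>
      rw [H.mid_mul_pathProd hr, map_smul, H.tgtCoord_pathProd_f (by omega), Finsupp.smul_apply]
      split_ifs with hst h0
      · simp at h0
      · rw [hst]
        simp only [Nat.add_right_comm t 2 1, Finsupp.single_eq_same, smul_eq_mul, mul_one]
      · rw [Finsupp.single_eq_of_ne, smul_zero]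
        have := hinj hst
        rwa [show t + 2 + 1 = t + 1 + 2 by omega]
  refine le_trans (by simp) (card_le_finrank_of_dual (ι := Fin (D.weight a - 1))
    (fun t => H.mid * D.pathProd D.x (D.g a) t) ?_
    (fun t => Finsupp.lapply (H.fIdx (t + 2)) ∘ₗ H.tgtCoord) ?_ ?_)
  · intro t
    refine ⟨_, h.g_mem_tgtFiltration (a := a) (Nat.zero_le (t : ℕ)), ?_⟩
    rw [LinearMap.mulLeft_apply, ← mul_assoc, H.mid_mul_e]
  · intro s t hst
    change H.tgtCoord _ _ = 0
    rw [hval, if_neg hst]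
  · intro t
    change H.tgtCoord _ _ ≠ 0
    rw [hval, if_pos rfl]
    split_ifs
    · exact one_ne_zero
    · exact hr0

/-- The ranks satisfy `(w - 1) + (w + 1) = 2w`, the bound for the dimension of `P_j`. -/
lemma exists_mid_mul_eq (hloop : D.IsLoop (D.bar a)) (hsing : ¬ D.IsSingularTriangle) {y : D.Alg}
    (hy : y ∈ D.P (D.tgt a)) (h0 : D.x a * y = 0) : ∃ z ∈ D.P (D.tgt a), H.mid * z = y := by
  have h4 := H.four_le
  have := (D.relSystem_alg H.two_le).finiteDimensional_tgtFiltration H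
  obtain ⟨z, hz, hzy⟩ := exists_of_finrank_le
    (U := (D.relSystem_alg H.two_le).tgtFiltration a 0)
    (W := (D.relSystem_alg H.two_le).tgtFiltration a 0)
    (LinearMap.mulLeft K H.mid) (LinearMap.mulLeft K (D.x a))
    (r := D.weight a - 1) (s := D.weight a + 1)
    (fun x _ => H.mem_P_tgt_iff.1 ((mem_P H.two_le).2 (by
      rw [LinearMap.mulLeft_apply, ← mul_assoc, H.e_mul_mid])))
    (fun x _ => by
      rw [LinearMap.mulLeft_apply, LinearMap.mulLeft_apply, ← mul_assoc, H.x_mul_mid, zero_mul])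
    (((D.relSystem_alg H.two_le).finrank_tgtFiltration_le H).trans (by omega))
    (H.le_finrank_map_mid hloop hsing) H.le_finrank_map_x (H.mem_P_tgt_iff.1 hy) h0
  exact ⟨z, H.mem_P_tgt_iff.2 hz, hzy⟩

lemma exists_x_f_mul_eq (hloop : D.IsLoop (D.bar a)) (hsing : ¬ D.IsSingularTriangle) {y : D.Alg}
    (hy : y ∈ D.P (D.tgt a)) (h0 : H.mid * y = 0) : ∃ z ∈ D.P (D.src a), D.x (D.f a) * z = y := by
  have h4 := H.four_le
  have := (D.relSystem_alg H.two_le).finiteDimensional_tgtFiltration H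
  obtain ⟨z, hz, hzy⟩ := exists_of_finrank_le
    (U := (D.relSystem_alg H.two_le).srcFiltration a 0)
    (W := (D.relSystem_alg H.two_le).tgtFiltration a 0)
    (LinearMap.mulLeft K (D.x (D.f a))) (LinearMap.mulLeft K H.mid)
    (r := D.weight a + 1) (s := D.weight a - 1)
    (fun x _ => H.mem_P_tgt_iff.1 ((mem_P H.two_le).2 (by
      rw [LinearMap.mulLeft_apply, ← mul_assoc, H.e_mul_x_f])))
    (fun x _ => by
      rw [LinearMap.mulLeft_apply, LinearMap.mulLeft_apply, ← mul_assoc, H.mid_mul_x_f, zero_mul])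
    (((D.relSystem_alg H.two_le).finrank_tgtFiltration_le H).trans (by omega))
    H.le_finrank_map_x_f (H.le_finrank_map_mid hloop hsing) (H.mem_P_tgt_iff.1 hy) h0
  exact ⟨z, H.mem_P_src_iff.2 hz, hzy⟩

/-- The ranks satisfy `1 + (w + 1) = w + 2`, the bound for the dimension of `P_i`. -/
lemma exists_soc_mul_eq {y : D.Alg} (hy : y ∈ D.P (D.src a)) (h0 : D.x (D.f a) * y = 0) :
    ∃ z ∈ D.P (D.src a), H.soc * z = y := by
  have := (D.relSystem_alg H.two_le).finiteDimensional_srcFiltration H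
  obtain ⟨z, hz, hzy⟩ := exists_of_finrank_le
    (U := (D.relSystem_alg H.two_le).srcFiltration a 0)
    (W := (D.relSystem_alg H.two_le).srcFiltration a 0)
    (LinearMap.mulLeft K H.soc) (LinearMap.mulLeft K (D.x (D.f a)))
    (r := 1) (s := D.weight a + 1)
    (fun x _ => H.mem_P_src_iff.1 ((mem_P H.two_le).2 (by
      rw [LinearMap.mulLeft_apply, ← mul_assoc, H.e_mul_soc])))
    (fun x _ => by
      rw [LinearMap.mulLeft_apply, LinearMap.mulLeft_apply, ← mul_assoc, H.x_f_mul_soc, zero_mul])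
    (((D.relSystem_alg H.two_le).finrank_srcFiltration_le H).trans (by omega))
    (le_trans (by simp) (card_le_finrank_of_single (ι := Unit) H.srcCoord (fun _ => H.soc)
      (fun _ => ⟨D.e (D.src a), H.mem_P_src_iff.1 (e_mem_P H.two_le _), H.soc_mul_e⟩)
      (fun _ => some (D.weight a)) (Function.injective_of_subsingleton _)
      (fun _ => H.srcCoord_soc)))
    H.le_finrank_map_x_f (H.mem_P_src_iff.1 hy) h0
  exact ⟨z, H.mem_P_src_iff.2 hz, hzy⟩

/-- Of the two arrows starting at `i`, the loop `bar a` is a multiple of `a · f a`, so `a` alone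
generates the radical of `P_i`. -/
lemma exists_x_mul_eq {y : D.Alg} (hy : y ∈ D.arrowIdeal) :
    ∃ z ∈ D.P (D.tgt a), D.x a * z = D.e (D.src a) * y := by
  have h := D.relSystem_alg H.two_le
  induction hy using Submodule.span_induction with
  | mem y hy =>
    obtain ⟨b, rfl⟩ := hy
    rcases h.vertex_mul_arr_cases a b with h1 | rfl | rfl
    · exact ⟨0, zero_mem _, by rw [h1, mul_zero]⟩
    · exact ⟨_, e_mem_P H.two_le _, by rw [h.mul_tgt, h.src_mul]⟩
    · refine ⟨(D.c (D.bar a))⁻¹ • D.x (D.f a), (mem_P H.two_le).2 ?_, ?_⟩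
      · rw [mul_smul_comm, H.e_mul_x_f]
      · rw [mul_smul_comm, h.mul_f_a H, inv_smul_smul₀ (D.c_ne_zero _), H.e_mul_x_bar]
  | zero => exact ⟨0, zero_mem _, by rw [mul_zero, mul_zero]⟩
  | add y y' _ _ hy hy' =>
    obtain ⟨z, hz, h1⟩ := hy
    obtain ⟨z', hz', h1'⟩ := hy'
    exact ⟨z + z', add_mem hz hz', by rw [mul_add, mul_add, h1, h1']⟩
  | smul r y _ hy =>
    obtain ⟨z, hz, h1⟩ := hy
    exact ⟨r • z, (D.P _).smul_mem r hz, by rw [mul_smul_comm, mul_smul_comm, h1]⟩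

/-! ### Injectivity -/

/-- In the opposite algebra `Λ e_i` becomes the right ideal at the same virtual loop, with `f a` in
the role of `a`. -/
lemma finrank_mul_e_le :
    FiniteDimensional K (LinearMap.eqLocus (LinearMap.mulRight K (D.e (D.src a))) LinearMap.id) ∧
    Module.finrank K (LinearMap.eqLocus (LinearMap.mulRight K (D.e (D.src a))) LinearMap.id) ≤
      D.weight a + 2 := by
  have hop := (D.relSystem_alg H.two_le).op H.two_le
  set L := LinearMap.eqLocus (LinearMap.mulRight K (D.e (D.src a))) LinearMap.id
  have hfd := hop.finiteDimensional_srcFiltration H.op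
  have hle : L.map (MulOpposite.opLinearEquiv K : D.Alg ≃ₗ[K] D.Algᵐᵒᵖ).toLinearMap ≤
      hop.srcFiltration (D.f a) 0 := by
    rintro _ ⟨t, ht, rfl⟩
    have ht' : t * D.e (D.src a) = t := ht
    have h1 := (hop.arrowFiltration_src H.op).vertex_mul_mem D.adjoin_op_alg (MulOpposite.op t)
    have h2 : D.op.src (D.f a) = D.src a := H.tgt_f
    rw [h2, ← MulOpposite.op_mul, ht'] at h1
    exact h1
  have hfd' := Submodule.finiteDimensional_of_le hle
  refine ⟨?_, ?_⟩
  · exact Module.Finite.equiv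
      ((MulOpposite.opLinearEquiv K : D.Alg ≃ₗ[K] D.Algᵐᵒᵖ).submoduleMap L).symm
  · rw [← (MulOpposite.opLinearEquiv K : D.Alg ≃ₗ[K] D.Algᵐᵒᵖ).finrank_map_eq L]
    refine (Submodule.finrank_mono hle).trans ((hop.finrank_srcFiltration_le H.op).trans ?_)
    rw [op_weight, H.weight_f]

/-- The pairing is nondegenerate on the side of `P_i`, whose dimension is at least the bound for `Λ
e_i`; hence every functional on `Λ e_i` is represented. -/
lemma injective_P : Module.Injective D.Algᵐᵒᵖ (D.P (D.src a)) := by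
  set φ : D.Alg →ₗ[K] K := Finsupp.lapply (some (D.weight a)) ∘ₗ H.srcCoord with hφ
  have hφs : φ H.soc = 1 := by
    rw [hφ, LinearMap.comp_apply, H.srcCoord_soc, Finsupp.lapply_apply, Finsupp.single_eq_same]
  have hnd : ∀ y ∈ D.P (D.src a), (∀ t, t * D.e (D.src a) = t → φ (y * t) = 0) → y = 0 := by
    intro y hy h0
    by_contra hne
    obtain ⟨t, ht, hyt⟩ := H.exists_mul_eq_soc hy hne
    have := h0 t ht
    rw [hyt, hφs] at this
    exact one_ne_zero this
  refine injective_P_of_pairing (D.src a) φ hnd fun θ => ?_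
  obtain ⟨hfd, hle⟩ := H.finrank_mul_e_le
  set L := LinearMap.eqLocus (LinearMap.mulRight K (D.e (D.src a))) LinearMap.id
  set G := (D.relSystem_alg H.two_le).srcFiltration a 0
  have hfdG : FiniteDimensional K G := (D.relSystem_alg H.two_le).finiteDimensional_srcFiltration H
  let T : G →ₗ[K] Module.Dual K L := ((LinearMap.mul K D.Alg).compr₂ φ).domRestrict₁₂ G L
  have hT : Function.Injective T := by
    refine (injective_iff_map_eq_zero T).2 fun y hy => Subtype.ext ?_
    exact hnd y (H.mem_P_src_iff.2 y.2) fun t ht => LinearMap.congr_fun hy ⟨t, ht⟩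
  have hdim : Module.finrank K G = Module.finrank K (Module.Dual K L) := by
    refine le_antisymm (LinearMap.finrank_le_finrank_of_injective hT) ?_
    rw [Subspace.dual_finrank_eq]
    exact hle.trans H.le_finrank_src
  obtain ⟨y, hy⟩ := (LinearMap.injective_iff_surjective_of_finrank_eq_finrank hdim).1 hT
    (θ.domRestrict L)
  exact ⟨y, H.mem_P_src_iff.2 y.2, fun t ht => LinearMap.congr_fun hy ⟨t, ht⟩⟩

end NearVirtualLoop

end WeightedTriangulationQuiver

universe u in
lemma IsProjectiveCover.isSyzygy {R : Type u} [Ring R] {P M N : Type u} [AddCommGroup P] [Module R P]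
    [AddCommGroup M] [Module R M] [AddCommGroup N] [Module R N] {p : P →ₗ[R] M}
    (hp : IsProjectiveCover p) (e : N ≃ₗ[R] LinearMap.ker p) :
    IsSyzygy (ModuleCat.of R M) (ModuleCat.of R N) :=
  ⟨ModuleCat.of R P, p, hp, ⟨e⟩⟩

/-! ### The exact sequence, the minimal resolution and the period. -/

namespace WeightedTriangulationQuiver

variable {K : Type*} [Field K] {V : Type*} {E : Type*} {D : WeightedTriangulationQuiver K V E}
  [Fintype V] {a : E} (H : D.NearVirtualLoop a)

namespace NearVirtualLoop

include H in
lemma mem_ker_toTop {y : D.P (D.src a)} :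
    y ∈ LinearMap.ker (D.toTop (D.src a)) ↔ (y : D.Alg) ∈ D.arrowIdeal := by
  rw [Submodule.ker_mkQ, ((D.relSystem_alg H.two_le).arrowFiltration_src H).jacobson_eq H.two_le
    (fun _ hy => H.exists_sub_smul_e_mem hy) H.e_src_not_mem]
  rfl

include H in
lemma isSuperfluous_src {N : Submodule D.Algᵐᵒᵖ (D.P (D.src a))}
    (h : ∀ y ∈ N, (y : D.Alg) ∈ D.arrowIdeal) : IsSuperfluous N :=
  ((D.relSystem_alg H.two_le).arrowFiltration_src H).isSuperfluous H.two_le h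

include H in
lemma isSuperfluous_tgt {N : Submodule D.Algᵐᵒᵖ (D.P (D.tgt a))}
    (h : ∀ y ∈ N, (y : D.Alg) ∈ D.arrowIdeal) : IsSuperfluous N :=
  ((D.relSystem_alg H.two_le).arrowFiltration_tgt H).isSuperfluous H.two_le h

include H in
lemma isProjectiveCover_toTop : IsProjectiveCover (D.toTop (D.src a)) where
  projective := projective_P H.two_le _
  surjective := Submodule.mkQ_surjective _
  superfluous := H.isSuperfluous_src fun _ hy => H.mem_ker_toTop.1 hy

/-- The embedding of the simple module as the socle of the projective module. -/
def socHom : D.S (D.src a) →ₗ[D.Algᵐᵒᵖ] D.P (D.src a) :=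
  Submodule.liftQ _ (leftMul H.two_le _ _ H.soc H.e_mul_soc) fun y hy => by
    rw [← Submodule.ker_mkQ (Module.jacobson D.Algᵐᵒᵖ (D.P (D.src a)))] at hy
    exact Subtype.ext (H.soc_mul_of_mem (H.mem_ker_toTop.1 hy))

lemma mem_arrowIdeal_of_soc_mul {y : D.Alg} (hy : y ∈ D.P (D.src a)) (h0 : H.soc * y = 0) :
    y ∈ D.arrowIdeal := by
  obtain ⟨r, hr⟩ := H.exists_sub_smul_e_mem hy
  have h1 := H.soc_mul_of_mem hr
  rw [mul_sub, h0, mul_smul_comm, H.soc_mul_e, zero_sub, neg_eq_zero] at h1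
  rw [(smul_eq_zero.1 h1).resolve_right H.soc_ne_zero, zero_smul, sub_zero] at hr
  exact hr

lemma injective_socHom : Function.Injective H.socHom := by
  refine (injective_iff_map_eq_zero _).2 fun s hs => ?_
  obtain ⟨y, rfl⟩ := Submodule.mkQ_surjective _ s
  exact H.mem_ker_toTop.2 (H.mem_arrowIdeal_of_soc_mul y.2 (congrArg Subtype.val hs))

lemma mem_range_socHom {y : D.P (D.src a)} :
    y ∈ LinearMap.range H.socHom ↔ D.x (D.f a) * (y : D.Alg) = 0 := by
  constructor
  · rintro ⟨s, rfl⟩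
    obtain ⟨z, rfl⟩ := Submodule.mkQ_surjective _ s
    change D.x (D.f a) * (H.soc * (z : D.Alg)) = 0
    rw [← mul_assoc, H.x_f_mul_soc, zero_mul]
  · intro h0
    obtain ⟨z, hz, hzy⟩ := H.exists_soc_mul_eq y.2 h0
    exact ⟨D.toTop _ ⟨z, hz⟩, Subtype.ext hzy⟩

lemma isInjectiveHull_socHom : IsInjectiveHull H.socHom where
  injective_module := H.injective_P
  injective := H.injective_socHom
  essential := by
    intro L hL
    refine (Submodule.eq_bot_iff L).2 fun y hy => ?_
    by_contra hne
    -- Every nonzero submodule of `P_i` contains the socle element.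
    obtain ⟨t, -, ht⟩ := H.exists_mul_eq_soc y.2 fun h => hne (Subtype.ext h)
    have h1 : ((MulOpposite.op t • y : D.P (D.src a)) : D.Alg) = H.soc := ht
    have h2 : MulOpposite.op t • y ∈ LinearMap.range H.socHom ⊓ L :=
      ⟨H.mem_range_socHom.2 (by rw [h1, H.x_f_mul_soc]), L.smul_mem _ hy⟩
    rw [hL, Submodule.mem_bot] at h2
    rw [h2] at h1
    exact H.soc_ne_zero h1.symm

/-- The embedding of `Ω⁻¹(S_i)` into `P_j`. -/
def cosyzygyHom : (D.P (D.src a) ⧸ LinearMap.range H.socHom) →ₗ[D.Algᵐᵒᵖ] D.P (D.tgt a) :=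
  Submodule.liftQ _ (leftMul H.two_le _ _ (D.x (D.f a)) H.e_mul_x_f) fun _ hy =>
    Subtype.ext (H.mem_range_socHom.1 hy)

lemma cosyzygyHom_mkQ (y : D.P (D.src a)) :
    (H.cosyzygyHom ((LinearMap.range H.socHom).mkQ y) : D.Alg) = D.x (D.f a) * y := rfl

lemma injective_cosyzygyHom : Function.Injective H.cosyzygyHom := by
  refine (injective_iff_map_eq_zero _).2 fun s hs => ?_
  obtain ⟨y, rfl⟩ := Submodule.mkQ_surjective _ s
  exact (Submodule.Quotient.mk_eq_zero _).2 (H.mem_range_socHom.2 (congrArg Subtype.val hs))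

/-- The middle map of the four term exact sequence. -/
def midHom : D.P (D.tgt a) →ₗ[D.Algᵐᵒᵖ] D.P (D.tgt a) :=
  leftMul H.two_le _ _ H.mid H.e_mul_mid

lemma midHom_coe (y : D.P (D.tgt a)) : (H.midHom y : D.Alg) = H.mid * y := rfl

/-- The map from `P_j` onto `Ω(S_i)`. -/
def syzygyHom : D.P (D.tgt a) →ₗ[D.Algᵐᵒᵖ] LinearMap.ker (D.toTop (D.src a)) :=
  (leftMul H.two_le _ _ (D.x a) ((D.relSystem_alg H.two_le).src_mul a)).codRestrict _ fun _ =>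
    H.mem_ker_toTop.2 (mul_mem_arrowIdeal (x_mem_arrowIdeal a) _)

lemma mem_ker_syzygyHom {y : D.P (D.tgt a)} :
    y ∈ LinearMap.ker H.syzygyHom ↔ D.x a * (y : D.Alg) = 0 :=
  ⟨fun h => congrArg (fun z : LinearMap.ker (D.toTop (D.src a)) => ((z : D.P (D.src a)) : D.Alg))
    (LinearMap.mem_ker.1 h), fun h => Subtype.ext (Subtype.ext h)⟩

lemma mem_ker_midHom {y : D.P (D.tgt a)} :
    y ∈ LinearMap.ker H.midHom ↔ H.mid * (y : D.Alg) = 0 :=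
  ⟨fun h => congrArg Subtype.val h, fun h => Subtype.ext h⟩

lemma surjective_syzygyHom : Function.Surjective H.syzygyHom := by
  rintro ⟨y, hy⟩
  obtain ⟨z, hz, hzy⟩ := H.exists_x_mul_eq (H.mem_ker_toTop.1 hy)
  exact ⟨⟨z, hz⟩, Subtype.ext (Subtype.ext (hzy.trans ((mem_P H.two_le).1 y.2)))⟩

lemma mem_arrowIdeal_of_mem_ker_midHom (hloop : D.IsLoop (D.bar a)) (hsing : ¬ D.IsSingularTriangle)
    {y : D.P (D.tgt a)} (hy : y ∈ LinearMap.ker H.midHom) : (y : D.Alg) ∈ D.arrowIdeal := by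
  obtain ⟨z, -, hz⟩ := H.exists_x_f_mul_eq hloop hsing y.2 (H.mem_ker_midHom.1 hy)
  rw [← hz]
  exact mul_mem_arrowIdeal (x_mem_arrowIdeal _) _

lemma mem_arrowIdeal_of_mem_ker_syzygyHom (hloop : D.IsLoop (D.bar a))
    (hsing : ¬ D.IsSingularTriangle) {y : D.P (D.tgt a)} (hy : y ∈ LinearMap.ker H.syzygyHom) :
    (y : D.Alg) ∈ D.arrowIdeal := by
  obtain ⟨z, -, hz⟩ := H.exists_mid_mul_eq hloop hsing y.2 (H.mem_ker_syzygyHom.1 hy)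
  rw [← hz]
  exact mul_mem_arrowIdeal H.mid_mem_arrowIdeal _

lemma exact_cosyzygyHom_midHom (hloop : D.IsLoop (D.bar a)) (hsing : ¬ D.IsSingularTriangle) :
    Function.Exact H.cosyzygyHom H.midHom := by
  intro y
  constructor
  · intro hy
    obtain ⟨z, hz, hzy⟩ := H.exists_x_f_mul_eq hloop hsing y.2 (congrArg Subtype.val hy)
    exact ⟨(LinearMap.range H.socHom).mkQ ⟨z, hz⟩, Subtype.ext hzy⟩
  · rintro ⟨s, rfl⟩
    obtain ⟨z, rfl⟩ := Submodule.mkQ_surjective _ s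
    refine Subtype.ext ?_
    rw [midHom_coe, cosyzygyHom_mkQ, ← mul_assoc, H.mid_mul_x_f, zero_mul]
    rfl

lemma exact_midHom_syzygyHom (hloop : D.IsLoop (D.bar a)) (hsing : ¬ D.IsSingularTriangle) :
    Function.Exact H.midHom H.syzygyHom := by
  intro y
  constructor
  · intro hy
    obtain ⟨z, hz, hzy⟩ := H.exists_mid_mul_eq hloop hsing y.2 (H.mem_ker_syzygyHom.1 hy)
    exact ⟨⟨z, hz⟩, Subtype.ext hzy⟩
  · rintro ⟨z, rfl⟩
    refine H.mem_ker_syzygyHom.2 ?_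
    rw [midHom_coe, ← mul_assoc, H.x_mul_mid, zero_mul]

/-- The splicing maps are injective or surjective, so kernels and ranges reduce to those of the
pieces, all contained in the arrow ideal. -/
lemma isMinimalProjectiveResolution (hloop : D.IsLoop (D.bar a))
    (hsing : ¬ D.IsSingularTriangle) :
    IsMinimalProjectiveResolution
      (fun k => (fourPeriodic (D.P (D.src a)) (D.P (D.tgt a)) (D.P (D.tgt a)) (D.P (D.src a)) k :
        Submodule (D.Alg)ᵐᵒᵖ D.Alg))
      (fourPeriodicMap (D.P (D.src a)) (D.P (D.tgt a)) (D.P (D.tgt a)) (D.P (D.src a))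
        ((LinearMap.ker (D.toTop (D.src a))).subtype ∘ₗ H.syzygyHom) H.midHom
        (H.cosyzygyHom ∘ₗ (LinearMap.range H.socHom).mkQ) (H.socHom ∘ₗ D.toTop (D.src a)))
      (D.toTop (D.src a)) := by
  have hker₀ : LinearMap.ker ((LinearMap.ker (D.toTop (D.src a))).subtype ∘ₗ H.syzygyHom) =
      LinearMap.ker H.syzygyHom :=
    LinearMap.ker_comp_of_ker_eq_bot _ (Submodule.ker_subtype _)
  have hker₂ : LinearMap.ker (H.cosyzygyHom ∘ₗ (LinearMap.range H.socHom).mkQ) =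
      LinearMap.range H.socHom := by
    rw [LinearMap.ker_comp_of_ker_eq_bot _ (LinearMap.ker_eq_bot.2 H.injective_cosyzygyHom),
      Submodule.ker_mkQ]
  have hker₃ : LinearMap.ker (H.socHom ∘ₗ D.toTop (D.src a)) =
      LinearMap.ker (D.toTop (D.src a)) :=
    LinearMap.ker_comp_of_ker_eq_bot _ (LinearMap.ker_eq_bot.2 H.injective_socHom)
  have hran₀ : LinearMap.range ((LinearMap.ker (D.toTop (D.src a))).subtype ∘ₗ H.syzygyHom) =
      LinearMap.ker (D.toTop (D.src a)) := by
    rw [LinearMap.range_comp_of_range_eq_top _ (LinearMap.range_eq_top.2 H.surjective_syzygyHom),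
      Submodule.range_subtype]
  have hran₂ : LinearMap.range (H.cosyzygyHom ∘ₗ (LinearMap.range H.socHom).mkQ) =
      LinearMap.range H.cosyzygyHom :=
    LinearMap.range_comp_of_range_eq_top _ (Submodule.range_mkQ _)
  have hran₃ : LinearMap.range (H.socHom ∘ₗ D.toTop (D.src a)) = LinearMap.range H.socHom :=
    LinearMap.range_comp_of_range_eq_top _ (Submodule.range_mkQ _)
  refine isMinimalProjectiveResolution_four (projective_P H.two_le _) (projective_P H.two_le _)
    (projective_P H.two_le _) (projective_P H.two_le _) (finite_P _) (finite_P _) (finite_P _)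
    (finite_P _) (Submodule.mkQ_surjective _) ?_ ?_ ?_ ?_ ?_ ?_ ?_ ?_ ?_ ?_
  · rw [LinearMap.exact_iff, hran₀]
  · rw [LinearMap.exact_iff, hker₀]
    exact LinearMap.exact_iff.1 (H.exact_midHom_syzygyHom hloop hsing)
  · rw [LinearMap.exact_iff, hran₂]
    exact LinearMap.exact_iff.1 (H.exact_cosyzygyHom_midHom hloop hsing)
  · rw [LinearMap.exact_iff, hker₂, hran₃]
  · rw [LinearMap.exact_iff, hker₃, hran₀]
  · exact H.isProjectiveCover_toTop.superfluous
  · rw [hker₀]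
    exact H.isSuperfluous_tgt fun _ => H.mem_arrowIdeal_of_mem_ker_syzygyHom hloop hsing
  · exact H.isSuperfluous_tgt fun _ => H.mem_arrowIdeal_of_mem_ker_midHom hloop hsing
  · rw [hker₂]
    refine H.isSuperfluous_src fun y hy => ?_
    obtain ⟨z, -, hz⟩ := H.exists_soc_mul_eq y.2 (H.mem_range_socHom.1 hy)
    rw [← hz]
    exact mul_mem_arrowIdeal H.soc_mem_arrowIdeal _
  · rw [hker₃]
    exact H.isProjectiveCover_toTop.superfluous

/-! ### Periodicity -/

-- This property separates `S_i` from its first three syzygies.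
include H in
lemma op_x_smul_eq_zero (b : E) (s : D.S (D.src a)) : MulOpposite.op (D.x b) • s = 0 := by
  obtain ⟨y, rfl⟩ := Submodule.mkQ_surjective _ s
  rw [← map_smul]
  refine H.mem_ker_toTop.2 ?_
  change (y : D.Alg) * D.x b ∈ _
  obtain ⟨r, hr⟩ := H.exists_sub_smul_e_mem y.2
  rw [← sub_add_cancel (y : D.Alg) (r • D.e (D.src a)), add_mul, smul_mul_assoc]
  exact add_mem (mul_mem_arrowIdeal hr _)
    (smul_mem_arrowIdeal (e_mul_mem_arrowIdeal H.two_le _ (x_mem_arrowIdeal b)) _)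

include H in
lemma not_nonempty_equiv {M : Type*} [AddCommGroup M] [Module D.Algᵐᵒᵖ M] {y : M} {b : E}
    (h : MulOpposite.op (D.x b) • y ≠ 0) : ¬ Nonempty (D.S (D.src a) ≃ₗ[D.Algᵐᵒᵖ] M) := by
  rintro ⟨e⟩
  refine h ?_
  rw [← e.apply_symm_apply y, ← map_smul, H.op_x_smul_eq_zero, map_zero]

include H in
lemma x_mul_x_g_ne_zero : D.x a * D.x (D.g a) ≠ 0 := by
  intro h0
  have h4 := H.four_le
  have h1 := H.srcCoord_pathProd (k := 2) (by omega)
  have h2 : D.pathProd D.x a (1 + 1) = D.x a * D.x (D.g a) := by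
    rw [pathProd_succ', pathProd_one]
  rw [h2, h0, map_zero] at h1
  exact one_ne_zero ((Finsupp.single_eq_zero (b := (1 : K))).1 h1.symm)

include H in
lemma pathProd_f_ne_zero {k : ℕ} (hk : k + 1 ≤ D.weight a) :
    D.pathProd D.x (D.f a) (k + 1) ≠ 0 := by
  intro h0
  have h1 := H.tgtCoord_pathProd_f hk
  rw [h0, map_zero] at h1
  exact one_ne_zero ((Finsupp.single_eq_zero (b := (1 : K))).1 h1.symm)

include H in
lemma x_f_mul_x_ne_zero : D.x (D.f a) * D.x a ≠ 0 := by
  have h4 := H.four_le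
  have h1 := H.x_f_mul_pathProd 1
  rw [pathProd_one] at h1
  rw [h1]
  exact H.pathProd_f_ne_zero (by omega)

lemma mid_mul_x_g_ne_zero (hloop : D.IsLoop (D.bar a)) (hsing : ¬ D.IsSingularTriangle) :
    H.mid * D.x (D.g a) ≠ 0 := by
  have h4 := H.four_le
  obtain ⟨r, hr0, hr⟩ := H.exists_mid_mul_x_g hloop hsing
  rw [hr]
  exact smul_ne_zero hr0 (H.pathProd_f_ne_zero (by omega))

include H in
lemma isPeriodicOfPeriod (hloop : D.IsLoop (D.bar a)) (hsing : ¬ D.IsSingularTriangle) :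
    IsPeriodicOfPeriod (ModuleCat.of (D.Alg)ᵐᵒᵖ (D.S (D.src a))) 4 := by
  have hmid := LinearMap.exact_iff.1 (H.exact_midHom_syzygyHom hloop hsing)
  have hcos := LinearMap.exact_iff.1 (H.exact_cosyzygyHom_midHom hloop hsing)
  -- The middle map and the map by `f a`, corestricted to their images, are projective covers of the
  -- second and third syzygies.
  let δ : D.P (D.tgt a) →ₗ[D.Algᵐᵒᵖ] LinearMap.ker H.syzygyHom :=
    H.midHom.codRestrict _ fun z => hmid ▸ LinearMap.mem_range_self _ z
  let β : D.P (D.src a) →ₗ[D.Algᵐᵒᵖ] LinearMap.ker H.midHom :=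
    (H.cosyzygyHom ∘ₗ (LinearMap.range H.socHom).mkQ).codRestrict _ fun z =>
      hcos ▸ LinearMap.mem_range_self _ ((LinearMap.range H.socHom).mkQ z)
  have hδ : IsProjectiveCover (R := D.Algᵐᵒᵖ) (P := D.P (D.tgt a))
      (M := LinearMap.ker H.syzygyHom) δ := by
    refine ⟨projective_P H.two_le _, ?_, ?_⟩
    · rintro ⟨y, hy⟩
      rw [hmid] at hy
      obtain ⟨z, rfl⟩ := hy
      exact ⟨z, rfl⟩
    · rw [LinearMap.ker_codRestrict]
      exact H.isSuperfluous_tgt fun _ => H.mem_arrowIdeal_of_mem_ker_midHom hloop hsing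
  have hkerβ : LinearMap.ker β = LinearMap.range H.socHom := by
    rw [LinearMap.ker_codRestrict,
      LinearMap.ker_comp_of_ker_eq_bot _ (LinearMap.ker_eq_bot.2 H.injective_cosyzygyHom),
      Submodule.ker_mkQ]
  have hβ : IsProjectiveCover (R := D.Algᵐᵒᵖ) (P := D.P (D.src a))
      (M := LinearMap.ker H.midHom) β := by
    refine ⟨projective_P H.two_le _, ?_, ?_⟩
    · rintro ⟨y, hy⟩
      rw [hcos] at hy
      obtain ⟨s, rfl⟩ := hy
      obtain ⟨z, rfl⟩ := Submodule.mkQ_surjective _ s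
      exact ⟨z, rfl⟩
    · rw [hkerβ]
      refine H.isSuperfluous_src fun y hy => ?_
      obtain ⟨z, -, hz⟩ := H.exists_soc_mul_eq y.2 (H.mem_range_socHom.1 hy)
      rw [← hz]
      exact mul_mem_arrowIdeal H.soc_mem_arrowIdeal _
  have hπs : IsSuperfluous (LinearMap.ker H.syzygyHom) :=
    H.isSuperfluous_tgt fun _ => H.mem_arrowIdeal_of_mem_ker_syzygyHom hloop hsing
  have hπ : IsProjectiveCover (R := D.Algᵐᵒᵖ) (P := D.P (D.tgt a))
      (M := LinearMap.ker (D.toTop (D.src a))) H.syzygyHom :=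
    ⟨projective_P H.two_le _, H.surjective_syzygyHom, hπs⟩
  have h₀ := H.isProjectiveCover_toTop.isSyzygy (N := LinearMap.ker (D.toTop (D.src a)))
    (LinearEquiv.refl _ _)
  have h₁ := hπ.isSyzygy (N := LinearMap.ker H.syzygyHom) (LinearEquiv.refl _ _)
  have h₂ := hδ.isSyzygy (N := LinearMap.ker H.midHom)
    (LinearEquiv.ofEq _ _ (LinearMap.ker_codRestrict _ _ _).symm)
  have h₃ := hβ.isSyzygy ((LinearEquiv.ofInjective H.socHom H.injective_socHom).trans
    (LinearEquiv.ofEq _ _ hkerβ.symm))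
  refine isPeriodicOfPeriod_four h₀ h₁ h₂ h₃ ?_ ?_ ?_
  -- In each syzygy the image of the vertex generator is not killed by a suitable arrow: `a · g a`,
  -- `mid · g a` and `f a · a` are nonzero.
  · refine H.not_nonempty_equiv
      (y := H.syzygyHom ⟨D.e (D.tgt a), e_mem_P H.two_le _⟩) (b := D.g a) fun h0 => ?_
    have h1 : D.x a * D.e (D.tgt a) * D.x (D.g a) = 0 :=
      congrArg (fun z : LinearMap.ker (D.toTop (D.src a)) => ((z : D.P (D.src a)) : D.Alg)) h0
    rw [(D.relSystem_alg H.two_le).mul_tgt] at h1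
    exact H.x_mul_x_g_ne_zero h1
  · refine H.not_nonempty_equiv
      (y := δ ⟨D.e (D.tgt a), e_mem_P H.two_le _⟩) (b := D.g a) fun h0 => ?_
    have h1 : H.mid * D.e (D.tgt a) * D.x (D.g a) = 0 :=
      congrArg (fun z : LinearMap.ker H.syzygyHom => ((z : D.P (D.tgt a)) : D.Alg)) h0
    rw [H.mid_mul_e] at h1
    exact H.mid_mul_x_g_ne_zero hloop hsing h1
  · refine H.not_nonempty_equiv
      (y := β ⟨D.e (D.src a), e_mem_P H.two_le _⟩) (b := a) fun h0 => ?_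
    have h1 : D.x (D.f a) * D.e (D.src a) * D.x a = 0 :=
      congrArg (fun z : LinearMap.ker H.midHom => ((z : D.P (D.tgt a)) : D.Alg)) h0
    rw [H.x_f_mul_e] at h1
    exact H.x_f_mul_x_ne_zero h1

end NearVirtualLoop

end WeightedTriangulationQuiver

end

theorem lemma5p1 {K : Type*} [Field K] [IsAlgClosed K] {V : Type*} [Fintype V] {E : Type*}
    (D : WeightedTriangulationQuiver K V E) (hD : D.GeneralAssumption)
    (a : E) (hloop : D.IsLoop (D.bar a)) (hvirt : D.Virtual (D.bar a))
    (hsing : ¬ D.IsSingularTriangle)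
    (i j : V) (hi : D.src a = i) (hj : D.tgt a = j) :
    IsProjectiveCover (D.toTop i) ∧
    ∃ u : D.S i →ₗ[(D.Alg)ᵐᵒᵖ] D.P i, IsInjectiveHull u ∧
    ∃ (ι : (D.P i ⧸ LinearMap.range u) →ₗ[(D.Alg)ᵐᵒᵖ] D.P j)
      (d : D.P j →ₗ[(D.Alg)ᵐᵒᵖ] D.P j)
      (π : D.P j →ₗ[(D.Alg)ᵐᵒᵖ] LinearMap.ker (D.toTop i)),
      Function.Injective ι ∧ Function.Exact ι d ∧ Function.Exact d π ∧ Function.Surjective π ∧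
      IsMinimalProjectiveResolution
        (fun k => (fourPeriodic (D.P i) (D.P j) (D.P j) (D.P i) k : Submodule (D.Alg)ᵐᵒᵖ D.Alg))
        (fourPeriodicMap (D.P i) (D.P j) (D.P j) (D.P i)
          ((LinearMap.ker (D.toTop i)).subtype ∘ₗ π) d
          (ι ∘ₗ (LinearMap.range u).mkQ) (u ∘ₗ D.toTop i))
        (D.toTop i) ∧
      IsPeriodicOfPeriod (ModuleCat.of (D.Alg)ᵐᵒᵖ (D.S i)) 4 := by
  subst hi hj
  have H := hD.nearVirtualLoop hloop hvirt
  exact ⟨H.isProjectiveCover_toTop, H.socHom, H.isInjectiveHull_socHom, H.cosyzygyHom, H.midHom,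
    H.syzygyHom, H.injective_cosyzygyHom, H.exact_cosyzygyHom_midHom hloop hsing,
    H.exact_midHom_syzygyHom hloop hsing, H.surjective_syzygyHom,
    H.isMinimalProjectiveResolution hloop hsing, H.isPeriodicOfPeriod hloop hsing⟩
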